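/- Let $(M^{2n},J,\bar g)$ be an almost Kähler manifold: $J$ is a smooth almost complex structure, $\bar g$ a smooth $J$-Hermitian Riemannian metric, and $\bar\omega=\bar g(J\cdot,\cdot)$ is closed; $M$ is Kähler if moreover $J$ is integrable. Let $\widetilde\nabla$ be the Chern connection of $M$ (the connection with $\widetilde\nabla\bar g=0$, $\widetilde\nabla J=0$ whose torsion $\widetilde T$ satisfies $\widetilde T(J\cdot,J\cdot)=-\widetilde T$), let $\widetilde R$ be its curvature and $\widetilde P(U,V)=\sum_j\bar\omega(\widetilde R(U,V)\bar e_j,\bar e_j)$ for an orthonormal basis $\bar e_j$ of $T_xM$. In the Kähler case $\overline{\mathrm{Ric}}$ denotes the Ricci tensor of $\bar g$. Let $L$ be a smooth $n$-manifold and $\iota:L\to M$ a smooth totally real immersion, i.e. $\iota_*T_pL\cap J\iota_*T_pL=0$ for all $p$, so that $T_{\iota(p)}M=\iota_*T_pL\oplus J\iota_*T_pL$ with projections $\pi_L,\pi_J$. Let $g=\iota^*\bar g$, with divergence $\mathrm{Div}$, codifferential $d^*$ and musical isomorphism $\flat$. Put $\rho_J=(\det_{\mathbb C}h(e_i,e_j))^{1/2}$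 for an orthonormal basis $e_i$ of $T_pL$, where $h=\bar g-i\bar\omega$. The Maslov form $\xi_J[\iota]$ is the 1-form on $L$ whose value at $X\in T_pL$ is the trace of the endomorphism $v\mapsto J\pi_J\widetilde\nabla_Xv$ of $T_pL$. For a smooth section $Z$ of $\iota^*TM$, the differential of the Maslov map is $D\xi_{J|\iota}(Z)=\frac{d}{dt}\xi_J[\iota_t]|_{t=0}$ (pointwise, in each $T_p^*L$), where $\iota_t$ is any smooth family of totally real immersions with $\iota_0=\iota$ and $\frac{\partial}{\partial t}\iota_t|_{t=0}=Z$. Let $X,Y$ be smooth vector fields on $L$, identified with $\iota_*X,\iota_*Y$, and let $V\in T_pL$. (a) If $M$ is almost Kähler, then $$D\xi_{J|\iota}(JY)(V)=-V\Big(\frac{\mathrm{Div}(\rho_JY)}{\rho_J}-2\sum_j\bar g(\pi_L\widetilde T(Y,e_j),e_j)\Big)+\tfrac12\widetilde P(JY,V).$$ (b) If $M$ is Kähler, then $$D\xi_{J|\iota}(JY)(V)=-V\Big(\frac{\mathrm{Div}(\rho_JY)}{\rho_J}\Big)-\overline{\mathrm{Ric}}(V,Y).$$ (c) If $M$ is Kähler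 and $\xi_J[\iota]=0$, then $$D\xi_{J|\iota}(X+JY)=d\big(\rho_J^{-1}d^*(\rho_JY^\flat)\big)-\iota^*\overline{\mathrm{Ric}}(Y,\cdot).$$ In particular $D\xi_{J|\iota}(X)=0$ for every vector field $X$ on $L$. -/

import Mathlib

open Bundle Manifold ContDiff

noncomputable section

/-! ### Linear algebra of totally real subspaces -/

section LinearAlgebra

variable {W V : Type*} [AddCommGroup W] [Module ℝ W] [AddCommGroup V] [Module ℝ V]

/-- A subspace `S` of `(V, J)` with `S ∩ JS = 0`. It is used with `dim V = 2 dim S`. -/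
def IsTotallyRealSubspace (J : V →ₗ[ℝ] V) (S : Submodule ℝ V) : Prop :=
  Disjoint S (S.map J)

/-- The map `(X, Y) ↦ A X + J (A Y)`. If `A` is injective with totally real image of half
dimension, it is bijective, and it is the splitting `V = S ⊕ JS` for `S = A(W)`. -/
def splitMap (J : V →ₗ[ℝ] V) (A : W →ₗ[ℝ] V) : W × W →ₗ[ℝ] V :=
  A.coprod (J ∘ₗ A)

open Classical in
/-- The inverse `Z = A X + J (A Y) ↦ (X, Y)` of the splitting (zero if there is no splitting). -/
def splitInv (J : V →ₗ[ℝ] V) (A : W →ₗ[ℝ] V) : V →ₗ[ℝ] W × W :=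
  if h : Function.Bijective (splitMap J A) then
    ((LinearEquiv.ofBijective (splitMap J A) h).symm : V →ₗ[ℝ] W × W)
  else 0

/-- `A X + J (A Y) ↦ X`: the tangential component, as an element of `W`. -/
def tangentialPart (J : V →ₗ[ℝ] V) (A : W →ₗ[ℝ] V) : V →ₗ[ℝ] W :=
  LinearMap.fst ℝ W W ∘ₗ splitInv J A

/-- The projection `π_L` of `V = S ⊕ JS` onto `S = A(W)`. -/
def projL (J : V →ₗ[ℝ] V) (A : W →ₗ[ℝ] V) : V →ₗ[ℝ] V :=
  A ∘ₗ LinearMap.fst ℝ W W ∘ₗ splitInv J A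

/-- The projection `π_J` of `V = S ⊕ JS` onto `JS`, where `S = A(W)`. -/
def projJ (J : V →ₗ[ℝ] V) (A : W →ₗ[ℝ] V) : V →ₗ[ℝ] V :=
  J ∘ₗ A ∘ₗ LinearMap.snd ℝ W W ∘ₗ splitInv J A

end LinearAlgebra

section Density

variable {V : Type*} [NormedAddCommGroup V] [InnerProductSpace ℝ V] [FiniteDimensional ℝ V]

/-- `ρ_J(S) = (det_ℂ h(e_i, e_j))^{1/2}` for an orthonormal basis `e` of `S`, where
`h = g - i ω` and `ω = g(J·, ·)`. The determinant is a real number in `[0, 1]`. -/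
def rhoSubspace (J : V →ₗ[ℝ] V) (S : Submodule ℝ V) : ℝ :=
  Real.sqrt (Matrix.det (Matrix.of fun i j : Fin (Module.finrank ℝ S) =>
    ((inner ℝ (stdOrthonormalBasis ℝ S i : V) (stdOrthonormalBasis ℝ S j : V) : ℝ) : ℂ)
      - Complex.I *
        ((inner ℝ (J (stdOrthonormalBasis ℝ S i : V)) (stdOrthonormalBasis ℝ S j : V) : ℝ) : ℂ))).re

end Density

/-! ### The ambient manifold -/

section Ambient

variable {E : Type*} [NormedAddCommGroup E] [NormedSpace ℝ E]
  {H : Type*} [TopologicalSpace H] (I : ModelWithCorners ℝ E H)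
  {M : Type*} [TopologicalSpace M] [ChartedSpace H M]

section Bracket

variable [IsManifold I 1 M]

/-- The Nijenhuis tensor `[X,Y] + J[JX,Y] + J[X,JY] - [JX,JY]`, evaluated on the fields which
extend `u` and `v` with constant coefficients in the chart at `x`. -/
def nijenhuis (J : Π x : M, TangentSpace I x →L[ℝ] TangentSpace I x) (x : M)
    (u v : TangentSpace I x) : TangentSpace I x :=
  VectorField.mlieBracket I (FiberBundle.extend E u) (FiberBundle.extend E v) x
  + J x (VectorField.mlieBracket I (fun y => J y (FiberBundle.extend E u y))
      (FiberBundle.extend E v) x)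
  + J x (VectorField.mlieBracket I (FiberBundle.extend E u)
      (fun y => J y (FiberBundle.extend E v y)) x)
  - VectorField.mlieBracket I (fun y => J y (FiberBundle.extend E u y))
      (fun y => J y (FiberBundle.extend E v y)) x

/-- The exterior derivative of a 2-form, by the invariant formula
`Xα(Y,Z) - Yα(X,Z) + Zα(X,Y) - α([X,Y],Z) + α([X,Z],Y) - α([Y,Z],X)`, evaluated on the fields
which extend `u`, `v`, `w` with constant coefficients in the chart at `x`. -/
def extDerivTwoForm (α : Π x : M, TangentSpace I x → TangentSpace I x → ℝ) (x : M)
    (u v w : TangentSpace I x) : ℝ :=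
  mvfderiv I (fun y => α y (FiberBundle.extend E v y) (FiberBundle.extend E w y)) x u
  - mvfderiv I (fun y => α y (FiberBundle.extend E u y) (FiberBundle.extend E w y)) x v
  + mvfderiv I (fun y => α y (FiberBundle.extend E u y) (FiberBundle.extend E v y)) x w
  - α x (VectorField.mlieBracket I (FiberBundle.extend E u) (FiberBundle.extend E v) x) w
  + α x (VectorField.mlieBracket I (FiberBundle.extend E u) (FiberBundle.extend E w) x) v
  - α x (VectorField.mlieBracket I (FiberBundle.extend E v) (FiberBundle.extend E w) x) u

/-- The curvature `R(u,v)w = ∇_u∇_v w - ∇_v∇_u w - ∇_[u,v] w` of a connection on `TM`, evaluated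
on the fields which extend `u`, `v`, `w` with constant coefficients in the chart at `x`. -/
def curvature (cov : CovariantDerivative I E (TangentSpace I : M → Type _)) (x : M)
    (u v w : TangentSpace I x) : TangentSpace I x :=
  cov (fun y => cov (FiberBundle.extend E w) y (FiberBundle.extend E v y)) x u
  - cov (fun y => cov (FiberBundle.extend E w) y (FiberBundle.extend E u y)) x v
  - cov (FiberBundle.extend E w) x
      (VectorField.mlieBracket I (FiberBundle.extend E u) (FiberBundle.extend E v) x)

end Bracket

variable [IsManifold I ∞ M] [RiemannianBundle (fun x : M => TangentSpace I x)]

/-- `J` is a smooth almost complex structure for which the Riemannian metric is Hermitian. -/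
structure IsAlmostHermitian (J : Π x : M, TangentSpace I x →L[ℝ] TangentSpace I x) : Prop where
  contMDiff : ContMDiff I (I.prod 𝓘(ℝ, E →L[ℝ] E)) ∞
    (fun x => TotalSpace.mk' (E →L[ℝ] E) (E := fun x : M => TangentSpace I x →L[ℝ] TangentSpace I x)
      x (J x))
  sq : ∀ (x : M) (v : TangentSpace I x), J x (J x v) = -v
  inner_map : ∀ (x : M) (u v : TangentSpace I x), inner ℝ (J x u) (J x v) = inner ℝ u v

/-- The fundamental form `ω = g(J·, ·)`. -/
def fundForm (J : Π x : M, TangentSpace I x →L[ℝ] TangentSpace I x) (x : M)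
    (u v : TangentSpace I x) : ℝ :=
  inner ℝ (J x u) v

/-- `(M, J, g)` is almost Kähler: almost Hermitian with closed fundamental form. -/
structure IsAlmostKahler (J : Π x : M, TangentSpace I x →L[ℝ] TangentSpace I x) : Prop
    extends IsAlmostHermitian I J where
  closed : ∀ (x : M) (u v w : TangentSpace I x), extDerivTwoForm I (fundForm I J) x u v w = 0

/-- `(M, J, g)` is Kähler: almost Kähler with integrable `J` (vanishing Nijenhuis tensor). -/
structure IsKahler (J : Π x : M, TangentSpace I x →L[ℝ] TangentSpace I x) : Prop
    extends IsAlmostKahler I J where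
  integrable : ∀ (x : M) (u v : TangentSpace I x), nijenhuis I J x u v = 0

/-- `∇g = 0`: `v(g(σ, τ)) = g(∇_v σ, τ) + g(σ, ∇_v τ)` for all vector fields `σ`, `τ`. -/
def IsMetricConnection (cov : CovariantDerivative I E (TangentSpace I : M → Type _)) : Prop :=
  ∀ (σ τ : Π x : M, TangentSpace I x) (x : M),
    MDifferentiableAt I (I.prod 𝓘(ℝ, E)) (fun y => TotalSpace.mk' E y (σ y)) x →
    MDifferentiableAt I (I.prod 𝓘(ℝ, E)) (fun y => TotalSpace.mk' E y (τ y)) x →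
      ∀ v : TangentSpace I x, mvfderiv I (fun y => (inner ℝ (σ y) (τ y) : ℝ)) x v
        = inner ℝ (cov σ x v) (τ x) + inner ℝ (σ x) (cov τ x v)

variable [FiniteDimensional ℝ E]

/-- `cov` is the Levi-Civita connection of the metric: smooth, metric and torsion-free. -/
structure IsLeviCivita (cov : CovariantDerivative I E (TangentSpace I : M → Type _)) : Prop where
  smooth : CovariantDerivative.ContMDiffCovariantDerivative cov ∞
  metric : IsMetricConnection I cov
  torsion_free : ∀ (x : M) (u v : TangentSpace I x), cov.torsion x u v = 0

/-- `cov` is the Chern connection of the almost Hermitian structure: smooth, `∇g = 0`, `∇J = 0`,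
and the `(1,1)`-component of the torsion (with respect to its two arguments) vanishes. -/
structure IsChernConnection (J : Π x : M, TangentSpace I x →L[ℝ] TangentSpace I x)
    (cov : CovariantDerivative I E (TangentSpace I : M → Type _)) : Prop where
  smooth : CovariantDerivative.ContMDiffCovariantDerivative cov ∞
  metric : IsMetricConnection I cov
  parallel : ∀ (σ : Π x : M, TangentSpace I x) (x : M),
    MDifferentiableAt I (I.prod 𝓘(ℝ, E)) (fun y => TotalSpace.mk' E y (σ y)) x →
      ∀ v : TangentSpace I x, cov (fun y => J y (σ y)) x v = J x (cov σ x v)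
  torsion_type : ∀ (x : M) (u v : TangentSpace I x),
    cov.torsion x (J x u) (J x v) = -cov.torsion x u v

/-- `P(u, v) = ∑ⱼ ω(R(u, v) eⱼ, eⱼ)` for an orthonormal basis `eⱼ` of the tangent space. -/
def chernRicciForm (J : Π x : M, TangentSpace I x →L[ℝ] TangentSpace I x)
    (cov : CovariantDerivative I E (TangentSpace I : M → Type _)) (x : M)
    (u v : TangentSpace I x) : ℝ :=
  haveI : FiniteDimensional ℝ (TangentSpace I x) := inferInstanceAs (FiniteDimensional ℝ E)
  ∑ j, fundForm I J x (curvature I cov x u v (stdOrthonormalBasis ℝ (TangentSpace I x) j))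
    (stdOrthonormalBasis ℝ (TangentSpace I x) j)

/-- The Ricci tensor `Ric(u, v) = ∑ⱼ g(R(eⱼ, u) v, eⱼ)` of a connection `cov`, for an orthonormal
basis `eⱼ` of the tangent space. -/
def ricci (cov : CovariantDerivative I E (TangentSpace I : M → Type _)) (x : M)
    (u v : TangentSpace I x) : ℝ :=
  haveI : FiniteDimensional ℝ (TangentSpace I x) := inferInstanceAs (FiniteDimensional ℝ E)
  ∑ j, inner ℝ (curvature I cov x (stdOrthonormalBasis ℝ (TangentSpace I x) j) u v)
    (stdOrthonormalBasis ℝ (TangentSpace I x) j)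

end Ambient

/-! ### Divergence and codifferential of a metric on an `n`-manifold -/

section Divergence

variable {n : ℕ} {L : Type*} [TopologicalSpace L] [ChartedSpace (EuclideanSpace ℝ (Fin n)) L]
  [IsManifold (𝓡 n) ∞ L]

/-- The basis `∂ᵢ` of `T_p L` given by the chart at `p`. -/
def coordBasis (p : L) : Module.Basis (Fin n) ℝ (TangentSpace (𝓡 n) p) :=
  (EuclideanSpace.basisFun (Fin n) ℝ).toBasis

/-- The coordinate vector field `∂ᵢ` of the chart at `p` (it matters near `p` only). -/
def coordField (p : L) (i : Fin n) (q : L) : TangentSpace (𝓡 n) q :=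
  FiberBundle.extend (EuclideanSpace ℝ (Fin n)) (coordBasis p i) q

/-- The component `Yⁱ` of a vector field in the chart at `p`, as a function near `p`. -/
def coordComp (p : L) (i : Fin n) (Y : Π q : L, TangentSpace (𝓡 n) q) (q : L) : ℝ :=
  (trivializationAt (EuclideanSpace ℝ (Fin n)) (TangentSpace (𝓡 n) : L → Type _) p
    (TotalSpace.mk' (EuclideanSpace ℝ (Fin n)) q (Y q))).2 i

/-- `√det g(∂ᵢ, ∂ⱼ)` in the chart at `p`. -/
def volDensity (g : Π q : L, TangentSpace (𝓡 n) q → TangentSpace (𝓡 n) q → ℝ) (p q : L) : ℝ :=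
  Real.sqrt (Matrix.det (Matrix.of fun i j => g q (coordField p i q) (coordField p j q)))

/-- The divergence `|g|^{-1/2} ∑ᵢ ∂ᵢ(|g|^{1/2} Yⁱ)` of a vector field, computed at `p` in the chart
at `p`. -/
def divergence (g : Π q : L, TangentSpace (𝓡 n) q → TangentSpace (𝓡 n) q → ℝ)
    (Y : Π q : L, TangentSpace (𝓡 n) q) (p : L) : ℝ :=
  (volDensity g p p)⁻¹ * ∑ i, mvfderiv (𝓡 n)
    (fun q => volDensity g p q * coordComp p i Y q) p (coordBasis p i)

/-- The 1-form `Y♭ = g(Y, ·)`. -/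
def flat (g : Π q : L, TangentSpace (𝓡 n) q → TangentSpace (𝓡 n) q → ℝ)
    (Y : Π q : L, TangentSpace (𝓡 n) q) (q : L) (v : TangentSpace (𝓡 n) q) : ℝ :=
  g q (Y q) v

/-- The vector field `α♯ = ∑ᵢⱼ gⁱʲ αⱼ ∂ᵢ`. -/
def sharp (g : Π q : L, TangentSpace (𝓡 n) q → TangentSpace (𝓡 n) q → ℝ)
    (α : Π q : L, TangentSpace (𝓡 n) q → ℝ) (q : L) : TangentSpace (𝓡 n) q :=
  ∑ i, ∑ j, ((Matrix.of fun k l => g q (coordBasis q k) (coordBasis q l))⁻¹ i j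
    * α q (coordBasis q j)) • coordBasis q i

/-- The codifferential of a 1-form, `d*α = -|g|^{-1/2} ∂ᵢ(|g|^{1/2} gⁱʲ αⱼ)`. -/
def codifferential (g : Π q : L, TangentSpace (𝓡 n) q → TangentSpace (𝓡 n) q → ℝ)
    (α : Π q : L, TangentSpace (𝓡 n) q → ℝ) (p : L) : ℝ :=
  -divergence g (sharp g α) p

end Divergence

/-! ### Totally real immersions and the Maslov form -/

section Immersions

variable {n : ℕ} {L : Type*} [TopologicalSpace L] [ChartedSpace (EuclideanSpace ℝ (Fin n)) L]
  {M : Type*} [TopologicalSpace M] [ChartedSpace (EuclideanSpace ℝ (Fin (2 * n))) M]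

/-- The differential `ι_* : T_p L → T_{ι(p)} M`, as a linear map. -/
def pushforward (ι : L → M) (p : L) :
    TangentSpace (𝓡 n) p →ₗ[ℝ] TangentSpace (𝓡 (2 * n)) (ι p) :=
  (mfderiv (𝓡 n) (𝓡 (2 * n)) ι p).toLinearMap

variable (J : Π x : M, TangentSpace (𝓡 (2 * n)) x →L[ℝ] TangentSpace (𝓡 (2 * n)) x)

/-- `ι` is a smooth immersion all of whose tangent spaces `ι_*(T_p L)` are totally real. -/
structure IsTotallyRealImmersion (ι : L → M) : Prop where
  contMDiff : ContMDiff (𝓡 n) (𝓡 (2 * n)) ∞ ι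
  immersion : ∀ p : L, Function.Injective (pushforward (n := n) ι p)
  totallyReal : ∀ p : L, IsTotallyRealSubspace (J (ι p)).toLinearMap
    (LinearMap.range (pushforward (n := n) ι p))

variable [IsManifold (𝓡 n) ∞ L] [IsManifold (𝓡 (2 * n)) ∞ M]

/-- The covariant derivative at `p` in the direction `X` of a section `W` of `ι^*TM`, for the
pulled-back connection: in the chart at `ι p`, the derivative of the components of `W` plus the
Christoffel term, the latter being `∇_{ι_*X}` of the field on `M` which extends `W p` with constant
components. -/
def covAlong (cov : CovariantDerivative (𝓡 (2 * n)) (EuclideanSpace ℝ (Fin (2 * n)))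
      (TangentSpace (𝓡 (2 * n)) : M → Type _)) (ι : L → M)
    (W : Π q : L, TangentSpace (𝓡 (2 * n)) (ι q)) (p : L) (X : TangentSpace (𝓡 n) p) :
    TangentSpace (𝓡 (2 * n)) (ι p) :=
  (trivializationAt (EuclideanSpace ℝ (Fin (2 * n)))
      (TangentSpace (𝓡 (2 * n)) : M → Type _) (ι p)).symm (ι p)
    (mvfderiv (𝓡 n) (fun q => (trivializationAt (EuclideanSpace ℝ (Fin (2 * n)))
      (TangentSpace (𝓡 (2 * n)) : M → Type _) (ι p)
        (TotalSpace.mk' (EuclideanSpace ℝ (Fin (2 * n))) (ι q) (W q))).2) p X)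
  + cov (FiberBundle.extend (EuclideanSpace ℝ (Fin (2 * n))) (W p)) (ι p) (pushforward ι p X)

/-- The Maslov form `ξ_J[ι]`: its value on `X ∈ T_p L` is the trace of the endomorphism
`v ↦ J π_J ∇_X v` of `T_p L`, computed in the coordinate frame `∂ᵢ` of the chart at `p`. -/
def maslovForm (cov : CovariantDerivative (𝓡 (2 * n)) (EuclideanSpace ℝ (Fin (2 * n)))
      (TangentSpace (𝓡 (2 * n)) : M → Type _)) (ι : L → M) (p : L) (X : TangentSpace (𝓡 n) p) : ℝ :=
  ∑ i, (coordBasis p).repr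
    (tangentialPart (J (ι p)).toLinearMap (pushforward ι p)
      (J (ι p) (projJ (J (ι p)).toLinearMap (pushforward ι p)
        (covAlong cov ι (fun q => pushforward ι q (coordField p i q)) p X)))) i

/-- `φ t`, `|t| < ε`, is a smooth family of totally real immersions with `φ 0 = ι` whose velocity at
`t = 0` is the section `Z` of `ι^*TM`. (In `velocity` the two sides live in the tangent spaces at
`φ 0 p` and at `ι p`, which is the same point by `initial`.) -/
structure IsTotallyRealVariation (ι : L → M) (Z : Π p : L, TangentSpace (𝓡 (2 * n)) (ι p))
    (ε : ℝ) (φ : ℝ → L → M) : Prop where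
  pos : 0 < ε
  contMDiffOn : ContMDiffOn (𝓘(ℝ, ℝ).prod (𝓡 n)) (𝓡 (2 * n)) ∞ (fun z : ℝ × L => φ z.1 z.2)
    (Set.Ioo (-ε) ε ×ˢ Set.univ)
  totallyReal : ∀ t ∈ Set.Ioo (-ε) ε, IsTotallyRealImmersion J (φ t)
  initial : φ 0 = ι
  velocity : ∀ p, mfderiv 𝓘(ℝ, ℝ) (𝓡 (2 * n)) (fun t => φ t p) 0 (1 : ℝ) = Z p

/-- `Dξ_J|_ι(Z) = α`: along every smooth family of totally real immersions through `ι` with initial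
velocity `Z`, the derivative of `ξ_J` at `t = 0`, taken in each fixed `T_p^*L`, exists and equals
`α`. -/
def HasMaslovDifferential
    (cov : CovariantDerivative (𝓡 (2 * n)) (EuclideanSpace ℝ (Fin (2 * n)))
      (TangentSpace (𝓡 (2 * n)) : M → Type _)) (ι : L → M)
    (Z : Π p : L, TangentSpace (𝓡 (2 * n)) (ι p)) (α : Π p : L, TangentSpace (𝓡 n) p → ℝ) : Prop :=
  ∀ (ε : ℝ) (φ : ℝ → L → M), IsTotallyRealVariation J ι Z ε φ →
    ∀ (p : L) (X : TangentSpace (𝓡 n) p),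
      HasDerivAt (fun t => maslovForm J cov (φ t) p X) (α p X) 0

/-- The trace over `T_p L` of `v ↦ π_L T(ι_*Y, ι_*v)`, i.e. `∑ⱼ g(π_L T(Y, eⱼ), eⱼ)` for an
orthonormal basis `eⱼ` of `T_p L`. -/
def torsionTrace (cov : CovariantDerivative (𝓡 (2 * n)) (EuclideanSpace ℝ (Fin (2 * n)))
      (TangentSpace (𝓡 (2 * n)) : M → Type _)) (ι : L → M) (p : L) (Y : TangentSpace (𝓡 n) p) : ℝ :=
  LinearMap.trace ℝ (TangentSpace (𝓡 n) p)
    (tangentialPart (J (ι p)).toLinearMap (pushforward ι p) ∘ₗ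
      (cov.torsion (ι p) (pushforward ι p Y)).toLinearMap ∘ₗ pushforward ι p)

variable [RiemannianBundle (fun x : M => TangentSpace (𝓡 (2 * n)) x)]

/-- The metric `g = ι^*ḡ` on `L`. -/
def inducedMetric (ι : L → M) (p : L) (u v : TangentSpace (𝓡 n) p) : ℝ :=
  inner ℝ (pushforward ι p u) (pushforward ι p v)

/-- The function `ρ_J` on `L`. -/
def rho (ι : L → M) (p : L) : ℝ :=
  haveI : FiniteDimensional ℝ (TangentSpace (𝓡 (2 * n)) (ι p)) :=
    inferInstanceAs (FiniteDimensional ℝ (EuclideanSpace ℝ (Fin (2 * n))))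
  rhoSubspace (J (ι p)).toLinearMap (LinearMap.range (pushforward ι p))

end Immersions

end

/-! Write `A` for the frame `ι_* ∂ᵢ`, and take real and imaginary parts in the splitting `ι_*TL ⊕ J
ι_*TL`. The Maslov form is `-tr Im (∇A)`. Since `∇J = 0`, the map `(a, b) ↦ A a + J A b` is a
complex frame of `ι^*TM`. If `S` is its inverse, then `η = (∇ frame) ∘ S` commutes with `J`, and the
Maslov form equals `½ tr (J η)`. It is thus a normalised connection form of a complex determinant
line, and its exterior derivative is half the pullback of the Ricci form `P` (`curl_frameMaslov`).
This holds for any map `f` with a totally real frame `A` along it; `A` need not be the full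
derivative of `f`.

A variation is therefore regarded as one map on `ℝ × L`, with the spatial derivative as frame. On
each slice the resulting 1-form `ξ` is the Maslov form of `ι_t`, so the formula for `dξ` gives `d/dt
ξ(V) = V(ξ(∂_t)) + ½ P(Z, V)` (`hasDerivAt_frameMaslov`). To find `ξ(∂_t)` for `Z = X + JY`, use
`∇_t ι_*v = ∇_v Z + T(Z, v)` and the antilinearity `T(JY, v) = -J T(Y, v)`, which follows from the
type of the torsion together with `dω = 0` (`torsion_antilinear`). The outcome is `ξ(∂_t) = ξ(X) -
(tr π_L ∇Y - tr π_L T(Y, ·))` (`frameMaslov_velocity`). The terms with `X` disappear if `X = 0`, and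
also if the Maslov form of `ι` vanishes, because then `½ P(X, V) = dξ(X, V) = 0` on `L`.

It remains to recognise the bracket. In a coordinate frame `ρ_J √det g = √det h`, where `h` is the
parallel Hermitian form, so the logarithmic derivative of this density is `tr Re (∇A)`. Hence
`Div(ρ_J Y)/ρ_J = tr π_L ∇Y + tr π_L T(Y, ·)`, and the bracket is `Div(ρ_J Y)/ρ_J - 2 tr π_L T(Y,
·)` (`divergence_eq_tangentialDiv`).

In the Kähler case the Nijenhuis tensor is `-4T`, so `T = 0`. The Chern and Levi-Civita connections
then have the same curvature, and its Kähler symmetries give `P(JY, V) = -2 Ric(V, Y)`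
(`IsKahlerCurvature.sum_inner_end`).

The global definitions use, at each point, the chart at that point. Differentiation needs a single
chart, so much of the work consists in rewriting every quantity in fixed charts of `L` and `M`. -/

noncomputable section

/-! ### Traces of complex-linear maps -/

section TraceAlgebra

theorem LinearMap.trace_prod_eq {R W : Type*} [CommRing R] [AddCommGroup W] [Module R W]
    [Module.Free R W] [Module.Finite R W] (f : W × W →ₗ[R] W × W) :
    LinearMap.trace R (W × W) f =
      LinearMap.trace R W (LinearMap.fst R W W ∘ₗ f ∘ₗ LinearMap.inl R W W) +
      LinearMap.trace R W (LinearMap.snd R W W ∘ₗ f ∘ₗ LinearMap.inr R W W) := by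
  have h : f = (f ∘ₗ LinearMap.inl R W W) ∘ₗ LinearMap.fst R W W +
      (f ∘ₗ LinearMap.inr R W W) ∘ₗ LinearMap.snd R W W := by
    ext x <;> simp [Prod.mk_zero_zero]
  conv_lhs => rw [h]
  rw [map_add, LinearMap.trace_comp_comm', LinearMap.trace_comp_comm' _ (LinearMap.snd R W W)]

variable {W V : Type*} [AddCommGroup W] [Module ℝ W] [AddCommGroup V] [Module ℝ V]

/-- A left and right inverse of `splitMap J A` intertwines `J` with `(a, b) ↦ (-b, a)`. -/
theorem splitMap_inverse_comp {J : V →ₗ[ℝ] V} {A : W →ₗ[ℝ] V} {S : V →ₗ[ℝ] W × W}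
    (hJ : ∀ v, J (J v) = -v) (hSE : ∀ k, S (splitMap J A k) = k)
    (hES : ∀ v, splitMap J A (S v) = v) (v : V) : S (J v) = (-(S v).2, (S v).1) := by
  rw [← hSE (-(S v).2, (S v).1)]
  congr 1
  conv_lhs => rw [← hES v]
  simp [splitMap, hJ, add_comm]

variable [FiniteDimensional ℝ W] [FiniteDimensional ℝ V]

/-- In the splitting, `splitMap J B ∘ S` is the complex-linear extension of `B`, with matrix `α +
iβ`. The real trace of `J` times it is `2 Re (i tr (α + iβ)) = -2 tr β`; each of the two diagonal
blocks contributes `-tr β`. -/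
theorem trace_complex_mul {J : V →ₗ[ℝ] V} {A : W →ₗ[ℝ] V} {S : V →ₗ[ℝ] W × W}
    (hJ : ∀ v, J (J v) = -v) (hSE : ∀ k, S (splitMap J A k) = k)
    (hES : ∀ v, splitMap J A (S v) = v) (B : W →ₗ[ℝ] V) :
    LinearMap.trace ℝ V (J ∘ₗ splitMap J B ∘ₗ S) =
      -(2 * LinearMap.trace ℝ W (LinearMap.snd ℝ W W ∘ₗ S ∘ₗ B)) := by
  rw [← LinearMap.comp_assoc, LinearMap.trace_comp_comm', LinearMap.trace_prod_eq]
  have h1 : LinearMap.fst ℝ W W ∘ₗ (S ∘ₗ J ∘ₗ splitMap J B) ∘ₗ LinearMap.inl ℝ W W =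
      -(LinearMap.snd ℝ W W ∘ₗ S ∘ₗ B) := by
    ext w
    simp [splitMap_inverse_comp hJ hSE hES, splitMap]
  have h2 : LinearMap.snd ℝ W W ∘ₗ (S ∘ₗ J ∘ₗ splitMap J B) ∘ₗ LinearMap.inr ℝ W W =
      -(LinearMap.snd ℝ W W ∘ₗ S ∘ₗ B) := by
    ext w
    simp [splitMap, hJ]
  rw [h1, h2, map_neg]
  ring

/-- The algebraic identity behind `tr (J F) = d tr (J η)` for a connection form `η = X + G` which
commutes with `J`. -/
theorem trace_commutator_identity {R : Type*} [Ring R] (τ : R →+ ℝ)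
    (hτ : ∀ x y, τ (x * y) = τ (y * x)) {j X Y G K : R}
    (hX : j * G - G * j = X * j - j * X) (hY : j * K - K * j = Y * j - j * Y) :
    τ ((j * G - G * j) * (Y + K) - j * (Y * X)) - τ ((j * K - K * j) * (X + G) - j * (X * Y)) =
      τ (j * (G * K - K * G)) := by
  have ha : j * (X + G) = (X + G) * j := by
    have := sub_eq_zero.2 hX
    rw [← sub_eq_zero, ← this]; noncomm_ring
  have hb : j * (Y + K) = (Y + K) * j := by
    have := sub_eq_zero.2 hY
    rw [← sub_eq_zero, ← this]; noncomm_ring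
  -- The sums `A` and `B` commute with `j`, so `j` can be moved cyclically through products
  -- containing them; in particular `τ (j (A B - B A)) = 0`.
  obtain ⟨A, hA⟩ : ∃ A, A = X + G := ⟨_, rfl⟩
  obtain ⟨B, hB⟩ : ∃ B, B = Y + K := ⟨_, rfl⟩
  have hG : G = A - X := by rw [hA]; abel
  have hK : K = B - Y := by rw [hB]; abel
  rw [← hA] at ha
  rw [← hB] at hb
  rw [hX, hY, ← hA, ← hB, hG, hK]
  have e1 : τ (X * j * B) = τ (j * X * B) := by
    rw [mul_assoc, hb, ← mul_assoc, hτ, ← mul_assoc]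
  have e2 : τ (Y * j * A) = τ (j * Y * A) := by
    rw [mul_assoc, ha, ← mul_assoc, hτ, ← mul_assoc]
  have e3 : τ (j * (A * B)) = τ (j * (B * A)) := by
    rw [← mul_assoc, ha, mul_assoc, hτ, mul_assoc]
  have e4 : τ (j * (A * Y)) = τ (j * (Y * A)) := by
    rw [← mul_assoc, ha, mul_assoc, hτ, mul_assoc]
  have e5 : τ (j * (B * X)) = τ (j * (X * B)) := by
    rw [← mul_assoc, hb, mul_assoc, hτ, mul_assoc]
  have l : (X * j - j * X) * B - j * (Y * X) = X * j * B - j * X * B - j * (Y * X) := by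
    noncomm_ring
  have l' : (Y * j - j * Y) * A - j * (X * Y) = Y * j * A - j * Y * A - j * (X * Y) := by
    noncomm_ring
  have r : j * ((A - X) * (B - Y) - (B - Y) * (A - X)) = j * (A * B) - j * (A * Y) - j * (X * B)
      + j * (X * Y) - j * (B * A) + j * (B * X) + j * (Y * A) - j * (Y * X) := by
    noncomm_ring
  rw [l, l', r]
  simp only [map_sub, map_add]
  linarith

end TraceAlgebra

/-! ### Product rules for derivatives of operator-valued functions -/

section FDeriv

variable {P E F G : Type*} [NormedAddCommGroup P] [NormedSpace ℝ P]
  [NormedAddCommGroup E] [NormedSpace ℝ E] [NormedAddCommGroup F] [NormedSpace ℝ F]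
  [NormedAddCommGroup G] [NormedSpace ℝ G]

theorem fderiv_apply_const {f : P → E →L[ℝ] F} {z : P} (hf : DifferentiableAt ℝ f z) (c : E)
    (a : P) : fderiv ℝ (fun y => f y c) z a = fderiv ℝ f z a c := by
  rw [fderiv_clm_apply hf (differentiableAt_const c)]
  simp

theorem fderiv_clm_comp_apply' {f : P → F →L[ℝ] G} {g : P → E →L[ℝ] F} {z : P}
    (hf : DifferentiableAt ℝ f z) (hg : DifferentiableAt ℝ g z) (a : P) :
    fderiv ℝ (fun y => f y ∘L g y) z a = f z ∘L fderiv ℝ g z a + fderiv ℝ f z a ∘L g z := by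
  rw [fderiv_clm_comp hf hg]
  simp

theorem fderiv_clm_apply' {f : P → F →L[ℝ] G} {g : P → F} {z : P}
    (hf : DifferentiableAt ℝ f z) (hg : DifferentiableAt ℝ g z) (a : P) :
    fderiv ℝ (fun y => f y (g y)) z a = f z (fderiv ℝ g z a) + fderiv ℝ f z a (g z) := by
  rw [fderiv_clm_apply hf hg]
  simp

theorem fderiv_mul_apply' {R : Type*} [NormedRing R] [NormedAlgebra ℝ R] {f g : P → R} {z : P}
    (hf : DifferentiableAt ℝ f z) (hg : DifferentiableAt ℝ g z) (a : P) :
    fderiv ℝ (fun y => f y * g y) z a = f z * fderiv ℝ g z a + fderiv ℝ f z a * g z := by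
  rw [fderiv_fun_mul' hf hg]
  simp

/-- Differentiate `Eh S = 1` and compose with `S` on the left; only the first identity is needed
near `z`. -/
theorem fderiv_inverse_frame {Eh : P → F →L[ℝ] E} {S : P → E →L[ℝ] F} {z : P}
    (hEh : DifferentiableAt ℝ Eh z) (hS : DifferentiableAt ℝ S z)
    (hES : ∀ᶠ y in nhds z, Eh y ∘L S y = ContinuousLinearMap.id ℝ E)
    (hSE : S z ∘L Eh z = ContinuousLinearMap.id ℝ F) (a : P) :
    fderiv ℝ S z a = -(S z ∘L fderiv ℝ Eh z a ∘L S z) := by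
  have h1 := fderiv_clm_comp_apply' hEh hS a
  have h2 : fderiv ℝ (fun y => Eh y ∘L S y) z = 0 := by
    rw [Filter.EventuallyEq.fderiv_eq (f := fun _ => ContinuousLinearMap.id ℝ E) hES]
    simp
  rw [h2] at h1
  have h3 := congrArg (fun l => S z ∘L l) h1
  simp only [ContinuousLinearMap.comp_add, zero_apply,
    ContinuousLinearMap.comp_zero, ← ContinuousLinearMap.comp_assoc, hSE,
    ContinuousLinearMap.id_comp] at h3
  rw [← ContinuousLinearMap.comp_assoc]
  exact eq_neg_of_add_eq_zero_left h3.symm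

end FDeriv

/-! ### The structure equation for the trace of a connection form -/

section ConnectionForm

variable {E : Type*} [NormedAddCommGroup E] [NormedSpace ℝ E] [FiniteDimensional ℝ E]

variable (E) in
/-- The trace, as a continuous linear functional on `E →L[ℝ] E`. -/
def clmTrace : (E →L[ℝ] E) →L[ℝ] ℝ :=
  LinearMap.toContinuousLinearMap
    (LinearMap.trace ℝ E ∘ₗ ContinuousLinearMap.coeLM ℝ)

theorem clmTrace_apply (f : E →L[ℝ] E) : clmTrace E f = LinearMap.trace ℝ E f.toLinearMap := rfl

theorem clmTrace_mul_comm (f g : E →L[ℝ] E) : clmTrace E (f * g) = clmTrace E (g * f) :=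
  LinearMap.trace_mul_comm ℝ (f.toLinearMap : Module.End ℝ E) g.toLinearMap

variable {P K : Type*} [NormedAddCommGroup P] [NormedSpace ℝ P]
  [NormedAddCommGroup K] [NormedSpace ℝ K]

/-- The 1-form `tr (j ((d Eh) S + γ))` of a frame `Eh` with inverse `S` and a connection form
`γ`. -/
def connTrace (j : P → E →L[ℝ] E) (γ : P → P →L[ℝ] E →L[ℝ] E) (Eh : P → K →L[ℝ] E)
    (S : P → E →L[ℝ] K) (c : P) (z : P) : ℝ :=
  clmTrace E (j z * (fderiv ℝ Eh z c ∘L S z + γ z c))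

variable {j : P → E →L[ℝ] E} {γ : P → P →L[ℝ] E →L[ℝ] E} {Eh : P → K →L[ℝ] E}
  {S : P → E →L[ℝ] K} {z : P}

theorem differentiableAt_connTrace (hj : DifferentiableAt ℝ j z) (hγ : DifferentiableAt ℝ γ z)
    (hEh : ContDiffAt ℝ 2 Eh z) (hS : DifferentiableAt ℝ S z) (c : P) :
    DifferentiableAt ℝ (connTrace j γ Eh S c) z := by
  have h2 : DifferentiableAt ℝ (fderiv ℝ Eh) z :=
    (hEh.fderiv_right (m := 1) (by norm_num)).differentiableAt (by norm_num)
  exact (clmTrace E).differentiableAt.comp z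
    (hj.mul (((h2.clm_apply (differentiableAt_const c)).clm_comp hS).add
      (hγ.clm_apply (differentiableAt_const c))))

theorem fderiv_connTrace (hj : DifferentiableAt ℝ j z) (hγ : DifferentiableAt ℝ γ z)
    (hEh : ContDiffAt ℝ 2 Eh z) (hS : DifferentiableAt ℝ S z) (c a : P) :
    fderiv ℝ (connTrace j γ Eh S c) z a =
      clmTrace E (fderiv ℝ j z a * (fderiv ℝ Eh z c ∘L S z + γ z c) +
        j z * (fderiv ℝ (fderiv ℝ Eh) z a c ∘L S z + fderiv ℝ Eh z c ∘L fderiv ℝ S z a +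
          fderiv ℝ γ z a c)) := by
  have h2 : DifferentiableAt ℝ (fderiv ℝ Eh) z :=
    (hEh.fderiv_right (m := 1) (by norm_num)).differentiableAt (by norm_num)
  have h3 := h2.clm_apply (differentiableAt_const c)
  have h4 := hγ.clm_apply (differentiableAt_const c)
  have h5 : DifferentiableAt ℝ (fun y => fderiv ℝ Eh y c ∘L S y + γ y c) z :=
    (h3.clm_comp hS).add h4
  have h6 : fderiv ℝ (connTrace j γ Eh S c) z a = clmTrace E
      (fderiv ℝ (fun y => j y * (fderiv ℝ Eh y c ∘L S y + γ y c)) z a) := by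
    have := fderiv_comp z (clmTrace E).differentiableAt (hj.mul h5)
    rw [ContinuousLinearMap.fderiv] at this
    exact congrArg (fun l => l a) this
  rw [h6, fderiv_mul_apply' hj h5, fderiv_fun_add (h3.clm_comp hS) h4,
    add_apply, fderiv_clm_comp_apply' h3 hS, fderiv_apply_const h2,
    fderiv_apply_const hγ, add_comm (j z * _),
    add_comm (fderiv ℝ Eh z c ∘L fderiv ℝ S z a)]

/-- The form `tr (j ((dEh) S + γ))` is a connection form on a complex determinant line, so its curl
is the trace of `j` times the curvature of `γ`. The second derivatives of `Eh` cancel by symmetry,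
and `dS` and `dj` are expressed through `dEh` and `γ`. The remaining quadratic terms are those of
`trace_commutator_identity`, which applies because `Eh` intertwines `j` with a constant `J₀`. -/
theorem curl_connTrace (hj : DifferentiableAt ℝ j z)
    (hjγ : ∀ a, fderiv ℝ j z a = j z * γ z a - γ z a * j z) (hγ : DifferentiableAt ℝ γ z)
    (hEh : ContDiffAt ℝ 2 Eh z) (hS : DifferentiableAt ℝ S z)
    (hES : ∀ᶠ y in nhds z, Eh y ∘L S y = ContinuousLinearMap.id ℝ E)
    (hSE : S z ∘L Eh z = ContinuousLinearMap.id ℝ K) {J₀ : K →L[ℝ] K}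
    (hJ : ∀ᶠ y in nhds z, j y ∘L Eh y = Eh y ∘L J₀) (a b : P) :
    fderiv ℝ (connTrace j γ Eh S b) z a - fderiv ℝ (connTrace j γ Eh S a) z b =
      clmTrace E (j z * (fderiv ℝ γ z a b - fderiv ℝ γ z b a + (γ z a * γ z b - γ z b * γ z a))) := by
  have hEd : DifferentiableAt ℝ Eh z := hEh.differentiableAt (by norm_num)
  have hJS : J₀ ∘L S z = S z ∘L j z := by
    have h1 := hJ.self_of_nhds
    calc J₀ ∘L S z = (S z ∘L Eh z) ∘L J₀ ∘L S z := by rw [hSE]; rfl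
      _ = S z ∘L (Eh z ∘L J₀) ∘L S z := rfl
      _ = S z ∘L j z ∘L (Eh z ∘L S z) := by rw [← h1]; rfl
      _ = S z ∘L j z := by rw [hES.self_of_nhds]; rfl
  -- Differentiating `j Eh = Eh J₀` and composing with `S` shows that `(dEh) S + γ` commutes with
  -- `j`.
  have key : ∀ a, j z * γ z a - γ z a * j z =
      (fderiv ℝ Eh z a ∘L S z) * j z - j z * (fderiv ℝ Eh z a ∘L S z) := by
    intro a
    have h1 := fderiv_clm_comp_apply' hj hEd a
    have h2 := fderiv_clm_comp_apply' hEd (differentiableAt_const J₀) a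
    rw [← Filter.EventuallyEq.fderiv_eq (f := fun y => Eh y ∘L J₀) hJ, h1] at h2
    have h3 := congrArg (fun l => l ∘L S z) h2
    simp only [hjγ, ContinuousLinearMap.comp_assoc, ContinuousLinearMap.add_comp,
      hES.self_of_nhds, hJS, fderiv_const_apply, zero_apply,
      ContinuousLinearMap.comp_zero, ContinuousLinearMap.comp_id, zero_add] at h3
    rw [eq_sub_iff_add_eq']
    exact h3
  have hsymm : fderiv ℝ (fderiv ℝ Eh) z a b = fderiv ℝ (fderiv ℝ Eh) z b a :=
    (hEh.isSymmSndFDerivAt (by simp)).eq a b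
  have main := trace_commutator_identity (clmTrace E).toLinearMap.toAddMonoidHom
    clmTrace_mul_comm (key a) (key b)
  simp only [LinearMap.toAddMonoidHom_coe, ContinuousLinearMap.coe_coe] at main
  rw [fderiv_connTrace hj hγ hEh hS, fderiv_connTrace hj hγ hEh hS,
    fderiv_inverse_frame hEd hS hES hSE, fderiv_inverse_frame hEd hS hES hSE, hjγ, hjγ, hsymm,
    mul_add (j z) (fderiv ℝ γ z a b - _), map_add _ (j z * (fderiv ℝ γ z a b - _)), ← main]
  simp only [mul_add, mul_sub, map_add, map_sub, ContinuousLinearMap.comp_neg, mul_neg, map_neg]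
  have c1 : fderiv ℝ Eh z b ∘L S z ∘L fderiv ℝ Eh z a ∘L S z =
    (fderiv ℝ Eh z b ∘L S z) * (fderiv ℝ Eh z a ∘L S z) := rfl
  have c2 : fderiv ℝ Eh z a ∘L S z ∘L fderiv ℝ Eh z b ∘L S z =
    (fderiv ℝ Eh z a ∘L S z) * (fderiv ℝ Eh z b ∘L S z) := rfl
  rw [c1, c2]
  ring

end ConnectionForm

/-! ### Tangent vectors, derivatives and Christoffel symbols in a fixed chart -/

section TangentCoordinates

variable {E : Type*} [NormedAddCommGroup E] [NormedSpace ℝ E]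
  {M : Type*} [TopologicalSpace M] [ChartedSpace E M]

theorem eventually_chart_symm {x₀ y : M} (hy : y ∈ (chartAt E x₀).source) :
    ∀ᶠ y' in nhds y, (extChartAt 𝓘(ℝ, E) x₀).symm (extChartAt 𝓘(ℝ, E) x₀ y') = y' := by
  filter_upwards [(chartAt E x₀).open_source.mem_nhds hy] with y hy
  exact (extChartAt 𝓘(ℝ, E) x₀).left_inv (by simpa using hy)

variable [IsManifold 𝓘(ℝ, E) ∞ M]

/-- The coordinates of tangent vectors at `y` in the chart at `x₀`. -/
def tcoord (x₀ y : M) : TangentSpace 𝓘(ℝ, E) y →L[ℝ] E :=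
  (trivializationAt E (TangentSpace 𝓘(ℝ, E) : M → Type _) x₀).continuousLinearMapAt ℝ y

/-- The vector field with constant coordinates in the chart at `x₀`. -/
def tfield (x₀ : M) (w : E) (y : M) : TangentSpace 𝓘(ℝ, E) y :=
  (trivializationAt E (TangentSpace 𝓘(ℝ, E) : M → Type _) x₀).symm y w

variable {x₀ y : M}

theorem tcoord_apply (hy : y ∈ (chartAt E x₀).source) (v : TangentSpace 𝓘(ℝ, E) y) :
    tcoord x₀ y v =
      (trivializationAt E (TangentSpace 𝓘(ℝ, E) : M → Type _) x₀ (TotalSpace.mk' E y v)).2 := by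
  rw [tcoord, Trivialization.continuousLinearMapAt_apply, Trivialization.coe_linearMapAt_of_mem]
  exact hy

theorem tcoord_tfield (hy : y ∈ (chartAt E x₀).source) (w : E) :
    tcoord x₀ y (tfield x₀ w y) = w := by
  have := (trivializationAt E (TangentSpace 𝓘(ℝ, E) : M → Type _) x₀).continuousLinearMapAt_symmL
    (R := ℝ) (b := y) hy w
  rwa [Trivialization.symmL_apply _ hy] at this

theorem tfield_tcoord (hy : y ∈ (chartAt E x₀).source) (v : TangentSpace 𝓘(ℝ, E) y) :
    tfield x₀ (tcoord x₀ y v) y = v := by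
  have := (trivializationAt E (TangentSpace 𝓘(ℝ, E) : M → Type _) x₀).symmL_continuousLinearMapAt
    (R := ℝ) (b := y) hy v
  rwa [Trivialization.symmL_apply _ hy] at this

theorem tcoord_injective (hy : y ∈ (chartAt E x₀).source) : Function.Injective (tcoord (E := E) x₀ y) :=
  fun v w h => by rw [← tfield_tcoord hy v, h, tfield_tcoord hy]

theorem tcoord_self (v : TangentSpace 𝓘(ℝ, E) x₀) : tcoord x₀ x₀ v = v := by
  rw [tcoord, TangentBundle.continuousLinearMapAt_trivializationAt_eq_core (mem_chart_source E x₀)]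
  exact (tangentBundleCore 𝓘(ℝ, E) M).coordChange_self (achart E x₀) x₀ (mem_chart_source E x₀) v

/-- The extensions that appear in the definitions of curvature, Nijenhuis tensor and exterior
derivative are coordinate fields of the chart at the point, so their brackets vanish near it
(`mlieBracket_tfield`). -/
theorem extend_eq_tfield (v : TangentSpace 𝓘(ℝ, E) x₀) :
    (FiberBundle.extend E v : Π y : M, TangentSpace 𝓘(ℝ, E) y) = tfield (E := E) x₀ (tcoord x₀ x₀ v) := by
  rw [tcoord_apply (mem_chart_source E x₀)]
  rfl

theorem mdifferentiableAt_iff_tcoord (hy : y ∈ (chartAt E x₀).source)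
    (σ : Π y : M, TangentSpace 𝓘(ℝ, E) y) :
    MDifferentiableAt 𝓘(ℝ, E) (𝓘(ℝ, E).prod 𝓘(ℝ, E)) (fun y => TotalSpace.mk' E y (σ y)) y ↔
      MDifferentiableAt 𝓘(ℝ, E) 𝓘(ℝ, E) (fun y => tcoord x₀ y (σ y)) y := by
  rw [(trivializationAt E (TangentSpace 𝓘(ℝ, E) : M → Type _) x₀).mdifferentiableAt_section_iff
    𝓘(ℝ, E) σ hy]
  apply Filter.EventuallyEq.mdifferentiableAt_iff
  filter_upwards [(chartAt E x₀).open_source.mem_nhds hy] with y hy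
  rw [tcoord_apply hy]

theorem contMDiffAt_iff_tcoord (hy : y ∈ (chartAt E x₀).source)
    (σ : Π y : M, TangentSpace 𝓘(ℝ, E) y) :
    ContMDiffAt 𝓘(ℝ, E) (𝓘(ℝ, E).prod 𝓘(ℝ, E)) ∞ (fun y => TotalSpace.mk' E y (σ y)) y ↔
      ContMDiffAt 𝓘(ℝ, E) 𝓘(ℝ, E) ∞ (fun y => tcoord x₀ y (σ y)) y := by
  have := (trivializationAt E (TangentSpace 𝓘(ℝ, E) : M → Type _) x₀).contMDiffAt_section_iff
    (n := ∞) (IB := 𝓘(ℝ, E)) (s := σ) hy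
  refine this.trans (Filter.EventuallyEq.contMDiffAt_iff ?_)
  filter_upwards [(chartAt E x₀).open_source.mem_nhds hy] with y hy
  rw [tcoord_apply hy]

theorem contMDiffAt_tfield (hy : y ∈ (chartAt E x₀).source) (w : E) :
    ContMDiffAt 𝓘(ℝ, E) (𝓘(ℝ, E).prod 𝓘(ℝ, E)) ∞
      (fun y => TotalSpace.mk' E y (tfield x₀ w y)) y := by
  rw [contMDiffAt_iff_tcoord hy]
  refine contMDiffAt_const (c := w) |>.congr_of_eventuallyEq ?_
  filter_upwards [(chartAt E x₀).open_source.mem_nhds hy] with y hy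
  rw [tcoord_tfield hy]

theorem mdifferentiableAt_tfield (hy : y ∈ (chartAt E x₀).source) (w : E) :
    MDifferentiableAt 𝓘(ℝ, E) (𝓘(ℝ, E).prod 𝓘(ℝ, E))
      (fun y => TotalSpace.mk' E y (tfield x₀ w y)) y :=
  (contMDiffAt_tfield hy w).mdifferentiableAt (by simp)

theorem mdifferentiableAt_extChartAt' (hy : y ∈ (chartAt E x₀).source) :
    MDifferentiableAt 𝓘(ℝ, E) 𝓘(ℝ, E) (extChartAt 𝓘(ℝ, E) x₀) y :=
  mdifferentiableAt_extChartAt hy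

theorem tcoord_eq_mvfderiv (hy : y ∈ (chartAt E x₀).source) (v : TangentSpace 𝓘(ℝ, E) y) :
    tcoord x₀ y v = mvfderiv 𝓘(ℝ, E) (extChartAt 𝓘(ℝ, E) x₀) y v := by
  rw [tcoord, TangentBundle.continuousLinearMapAt_trivializationAt hy]
  rfl

theorem tcoord_mfderiv {E' : Type*} [NormedAddCommGroup E'] [NormedSpace ℝ E']
    {N : Type*} [TopologicalSpace N] [ChartedSpace E' N] {f : N → M} {q : N}
    (hf : MDifferentiableAt 𝓘(ℝ, E') 𝓘(ℝ, E) f q) (hy : f q ∈ (chartAt E x₀).source)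
    (v : TangentSpace 𝓘(ℝ, E') q) :
    tcoord x₀ (f q) (mfderiv 𝓘(ℝ, E') 𝓘(ℝ, E) f q v) =
      mvfderiv 𝓘(ℝ, E') (fun q => extChartAt 𝓘(ℝ, E) x₀ (f q)) q v := by
  rw [tcoord_eq_mvfderiv hy]
  exact (mfderiv_comp_apply q (mdifferentiableAt_extChartAt' hy) hf v).symm

section LocalFunctions

variable {V : Type*} [NormedAddCommGroup V] [NormedSpace ℝ V] {g : M → V}

theorem contMDiffAt_chart_symm (hy : y ∈ (chartAt E x₀).source) :
    ContMDiffAt 𝓘(ℝ, E) 𝓘(ℝ, E) ∞ (extChartAt 𝓘(ℝ, E) x₀).symm (extChartAt 𝓘(ℝ, E) x₀ y) :=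
  (contMDiffOn_extChartAt_symm x₀).contMDiffAt
    (extChartAt_target_mem_nhds' ((extChartAt 𝓘(ℝ, E) x₀).map_source (by simpa using hy)))

theorem mdifferentiableAt_iff_chart (hy : y ∈ (chartAt E x₀).source) :
    MDifferentiableAt 𝓘(ℝ, E) 𝓘(ℝ, V) g y ↔
      DifferentiableAt ℝ (fun u => g ((extChartAt 𝓘(ℝ, E) x₀).symm u))
        (extChartAt 𝓘(ℝ, E) x₀ y) := by
  have hl := (eventually_chart_symm hy).self_of_nhds
  constructor
  · intro h
    rw [← mdifferentiableAt_iff_differentiableAt]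
    rw [← hl] at h
    exact h.comp (extChartAt 𝓘(ℝ, E) x₀ y)
      ((contMDiffAt_chart_symm hy).mdifferentiableAt (by simp))
  · intro h
    rw [← mdifferentiableAt_iff_differentiableAt] at h
    refine (h.comp y (mdifferentiableAt_extChartAt' hy)).congr_of_eventuallyEq ?_
    filter_upwards [eventually_chart_symm hy] with y' hy'
    simp only [Function.comp_apply, hy']

theorem contMDiffAt_iff_chart' (hy : y ∈ (chartAt E x₀).source) :
    ContMDiffAt 𝓘(ℝ, E) 𝓘(ℝ, V) ∞ g y ↔
      ContDiffAt ℝ ∞ (fun u => g ((extChartAt 𝓘(ℝ, E) x₀).symm u))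
        (extChartAt 𝓘(ℝ, E) x₀ y) := by
  have hl := (eventually_chart_symm hy).self_of_nhds
  constructor
  · intro h
    rw [← contMDiffAt_iff_contDiffAt]
    rw [← hl] at h
    exact h.comp (extChartAt 𝓘(ℝ, E) x₀ y) (contMDiffAt_chart_symm hy)
  · intro h
    rw [← contMDiffAt_iff_contDiffAt] at h
    refine (h.comp y (contMDiffAt_extChartAt' hy)).congr_of_eventuallyEq ?_
    filter_upwards [eventually_chart_symm hy] with y' hy'
    simp only [Function.comp_apply, hy']

theorem mvfderiv_eq_fderiv_chart (hy : y ∈ (chartAt E x₀).source)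
    (hg : MDifferentiableAt 𝓘(ℝ, E) 𝓘(ℝ, V) g y) (v : TangentSpace 𝓘(ℝ, E) y) :
    mvfderiv 𝓘(ℝ, E) g y v =
      fderiv ℝ (fun u => g ((extChartAt 𝓘(ℝ, E) x₀).symm u)) (extChartAt 𝓘(ℝ, E) x₀ y)
        (tcoord x₀ y v) := by
  have h1 := (mdifferentiableAt_iff_chart hy).1 hg
  have h2 := mfderiv_comp_apply y h1.mdifferentiableAt (mdifferentiableAt_extChartAt' hy) v
  have h3 : (fun u => g ((extChartAt 𝓘(ℝ, E) x₀).symm u)) ∘ (extChartAt 𝓘(ℝ, E) x₀) =ᶠ[nhds y] g := by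
    filter_upwards [eventually_chart_symm hy] with y' hy'
    simp only [Function.comp_apply, hy']
  have h4 : mvfderiv 𝓘(ℝ, E) g y v =
    mvfderiv 𝓘(ℝ, E) ((fun u => g ((extChartAt 𝓘(ℝ, E) x₀).symm u)) ∘ (extChartAt 𝓘(ℝ, E) x₀)) y v := by
    have := h3.mfderiv_eq (I := 𝓘(ℝ, E)) (I' := 𝓘(ℝ, V))
    exact congrArg (fun l : E →L[ℝ] V => l v) this.symm
  rw [h4, tcoord_eq_mvfderiv hy]
  refine Eq.trans h2 ?_
  rw [mfderiv_eq_fderiv]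
  rfl

end LocalFunctions

section Christoffel

theorem mdifferentiableAt_sum_smul {ι : Type*} (s : Finset ι) {g : ι → M → ℝ}
    {τ : ι → Π y : M, TangentSpace 𝓘(ℝ, E) y}
    (hg : ∀ i, MDifferentiableAt 𝓘(ℝ, E) 𝓘(ℝ, ℝ) (g i) y)
    (hτ : ∀ i, MDifferentiableAt 𝓘(ℝ, E) (𝓘(ℝ, E).prod 𝓘(ℝ, E))
      (fun y => TotalSpace.mk' E y (τ i y)) y) :
    MDifferentiableAt 𝓘(ℝ, E) (𝓘(ℝ, E).prod 𝓘(ℝ, E))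
      (fun y => TotalSpace.mk' E y ((∑ i ∈ s, g i • τ i) y)) y := by
  have := MDifferentiableAt.sum_section (I := 𝓘(ℝ, E)) (s := s)
    (t := fun i => g i • τ i) (fun i _ => (hg i).smul_section (hτ i))
  simpa using this

variable (cov : CovariantDerivative 𝓘(ℝ, E) E (TangentSpace 𝓘(ℝ, E) : M → Type _))

theorem cov_sum_smul {ι : Type*} (s : Finset ι) {g : ι → M → ℝ}
    {τ : ι → Π y : M, TangentSpace 𝓘(ℝ, E) y}
    (hg : ∀ i, MDifferentiableAt 𝓘(ℝ, E) 𝓘(ℝ, ℝ) (g i) y)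
    (hτ : ∀ i, MDifferentiableAt 𝓘(ℝ, E) (𝓘(ℝ, E).prod 𝓘(ℝ, E))
      (fun y => TotalSpace.mk' E y (τ i y)) y) (v : TangentSpace 𝓘(ℝ, E) y) :
    cov (∑ i ∈ s, g i • τ i) y v =
      ∑ i ∈ s, (g i y • cov (τ i) y v + mvfderiv 𝓘(ℝ, E) (g i) y v • τ i y) := by
  classical
  induction s using Finset.induction_on with
  | empty => simp
  | insert i s hi ih =>
    rw [Finset.sum_insert hi, Finset.sum_insert hi, ← ih,
      cov.isCovariantDerivativeOnUniv.add ((hg i).smul_section (hτ i))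
        (mdifferentiableAt_sum_smul s hg hτ), add_apply,
      cov.isCovariantDerivativeOnUniv.leibniz (hτ i) (hg i)]
    simp

variable [FiniteDimensional ℝ E]

/-- The Christoffel symbols of `cov` in the chart at `x₀`, as a bilinear map on the model space:
`christoffel cov x₀ y a w` represents `∇_a` of the field with constant coordinates `w`. -/
def christoffel (x₀ y : M) : E →L[ℝ] E →L[ℝ] E :=
  ∑ j, (ContinuousLinearMap.smulRightL ℝ E E
      (LinearMap.toContinuousLinearMap ((Module.finBasis ℝ E).coord j))) ∘L
    (tcoord x₀ y ∘L cov (tfield x₀ (Module.finBasis ℝ E j)) y ∘L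
      (trivializationAt E (TangentSpace 𝓘(ℝ, E) : M → Type _) x₀).symmL ℝ y)

theorem christoffel_apply (hy : y ∈ (chartAt E x₀).source) (v : TangentSpace 𝓘(ℝ, E) y) (w : E) :
    christoffel cov x₀ y (tcoord x₀ y v) w =
      ∑ j, (Module.finBasis ℝ E).coord j w •
        tcoord x₀ y (cov (tfield x₀ (Module.finBasis ℝ E j)) y v) := by
  have h : (trivializationAt E (TangentSpace 𝓘(ℝ, E) : M → Type _) x₀).symmL ℝ y (tcoord x₀ y v)
      = v := Trivialization.symmL_continuousLinearMapAt _ (b := y) hy v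
  simp only [christoffel, sum_apply, ContinuousLinearMap.comp_apply, h]
  rfl

theorem eventually_eq_sum_tfield (hy : y ∈ (chartAt E x₀).source)
    (σ : Π y : M, TangentSpace 𝓘(ℝ, E) y) :
    ∀ᶠ y in nhds y, σ y = (∑ j, (fun y => (Module.finBasis ℝ E).coord j (tcoord x₀ y (σ y))) •
      tfield (E := E) x₀ (Module.finBasis ℝ E j)) y := by
  filter_upwards [(chartAt E x₀).open_source.mem_nhds hy] with y hy
  apply tcoord_injective hy
  simp [tcoord_tfield hy, Module.Basis.sum_repr]

/-- This is `∇ = d + Γ`, valid at every point `y` of the chart domain and not only at its centre. It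
follows from the Leibniz rule applied to the expansion of `σ` in the coordinate frame. -/
theorem tcoord_cov (hy : y ∈ (chartAt E x₀).source) {σ : Π y : M, TangentSpace 𝓘(ℝ, E) y}
    (hσ : MDifferentiableAt 𝓘(ℝ, E) (𝓘(ℝ, E).prod 𝓘(ℝ, E))
      (fun y => TotalSpace.mk' E y (σ y)) y) (v : TangentSpace 𝓘(ℝ, E) y) :
    tcoord x₀ y (cov σ y v) = mvfderiv 𝓘(ℝ, E) (fun y => tcoord x₀ y (σ y)) y v +
      christoffel cov x₀ y (tcoord x₀ y v) (tcoord x₀ y (σ y)) := by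
  have hσ' := (mdifferentiableAt_iff_tcoord hy σ).1 hσ
  have hg : ∀ j, MDifferentiableAt 𝓘(ℝ, E) 𝓘(ℝ, ℝ)
      (fun y => (Module.finBasis ℝ E).coord j (tcoord x₀ y (σ y))) y := fun j =>
    ((LinearMap.toContinuousLinearMap
      ((Module.finBasis ℝ E).coord j)).mdifferentiableAt).comp y hσ'
  have hτ : ∀ j, MDifferentiableAt 𝓘(ℝ, E) (𝓘(ℝ, E).prod 𝓘(ℝ, E))
      (fun y => TotalSpace.mk' E y (tfield x₀ (Module.finBasis ℝ E j) y)) y := fun j =>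
    mdifferentiableAt_tfield hy _
  have hd : ∀ j, mvfderiv 𝓘(ℝ, E)
      (fun y => (Module.finBasis ℝ E).coord j (tcoord x₀ y (σ y))) y v =
      (Module.finBasis ℝ E).coord j (mvfderiv 𝓘(ℝ, E) (fun y => tcoord x₀ y (σ y)) y v) := by
    intro j
    have := mfderiv_comp_apply y (LinearMap.toContinuousLinearMap
      ((Module.finBasis ℝ E).coord j)).mdifferentiableAt hσ' v
    rw [mfderiv_eq_fderiv, ContinuousLinearMap.fderiv] at this
    exact this
  rw [cov.isCovariantDerivativeOnUniv.congr_of_eventuallyEq hσ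
    (mdifferentiableAt_sum_smul Finset.univ hg hτ) Filter.univ_mem
    (eventually_eq_sum_tfield hy σ), cov_sum_smul cov _ hg hτ, map_sum,
    christoffel_apply cov hy]
  simp only [map_add, map_smul, tcoord_tfield hy, hd]
  rw [Finset.sum_add_distrib, add_comm]
  congr 1
  exact (Module.finBasis ℝ E).sum_repr _

/-- Smoothness of `cov` concerns globally smooth sections, so the coordinate fields are first cut
off by a bump function. Since `cov` is local, the cut-off changes nothing near `x₀`. -/
theorem contMDiffAt_christoffel [T2Space M]
    (hcov : CovariantDerivative.ContMDiffCovariantDerivative cov ∞) :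
    ContMDiffAt 𝓘(ℝ, E) 𝓘(ℝ, E →L[ℝ] E →L[ℝ] E) ∞ (fun y => christoffel cov x₀ y) x₀ := by
  have key : ∀ w : E, ContMDiffAt 𝓘(ℝ, E) 𝓘(ℝ, E →L[ℝ] E) ∞ (fun y : M =>
      (tcoord x₀ y ∘L cov (tfield x₀ w) y ∘L
      (trivializationAt E (TangentSpace 𝓘(ℝ, E) : M → Type _) x₀).symmL ℝ y)) x₀ := by
    intro w
    let ψ : SmoothBumpFunction 𝓘(ℝ, E) x₀ := Classical.arbitrary _
    have h1 : ContMDiff 𝓘(ℝ, E) (𝓘(ℝ, E).prod 𝓘(ℝ, E)) ∞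
        (fun y => TotalSpace.mk' E y (((ψ : M → ℝ) • tfield (E := E) x₀ w) y)) :=
      ContMDiffOn.smul_section_of_tsupport (u := (chartAt E x₀).source) ψ.contMDiff.contMDiffOn
        (chartAt E x₀).open_source ψ.tsupport_subset_chartAt_source
        (fun y hy => (contMDiffAt_tfield hy w).contMDiffWithinAt)
    have h2 := hcov.contMDiff.contMDiff (σ := (ψ : M → ℝ) • tfield (E := E) x₀ w)
      (by simpa [contMDiffOn_univ] using h1)
    rw [contMDiffOn_univ] at h2
    have h3 := ((contMDiffAt_hom_bundle _).1 (h2 x₀)).2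
    refine h3.congr_of_eventuallyEq ?_
    filter_upwards [ψ.eventuallyEq_one.eventually_nhds,
      (chartAt E x₀).open_source.mem_nhds (mem_chart_source E x₀)] with y hy hys
    have h4 : cov (tfield x₀ w) y = cov ((ψ : M → ℝ) • tfield (E := E) x₀ w) y := by
      refine cov.isCovariantDerivativeOnUniv.congr_of_eventuallyEq (mdifferentiableAt_tfield hys w)
        (h1.mdifferentiableAt (by simp)) Filter.univ_mem ?_
      filter_upwards [hy] with y' hy'
      simp [hy']
    rw [h4]
    rfl
  unfold christoffel
  exact contMDiffAt_finsetSum fun j _ => contMDiffAt_const.clm_comp (key _)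

end Christoffel

end TangentCoordinates

/-! ### Brackets, torsion and curvature in a chart -/

section CurvatureCoordinates

variable {E : Type*} [NormedAddCommGroup E] [NormedSpace ℝ E] [FiniteDimensional ℝ E]
  {M : Type*} [TopologicalSpace M] [ChartedSpace E M] [IsManifold 𝓘(ℝ, E) ∞ M]
  {x₀ y : M} (cov : CovariantDerivative 𝓘(ℝ, E) E (TangentSpace 𝓘(ℝ, E) : M → Type _))

/-- The Christoffel symbols in the chart at `x₀`, as a function on the model space. -/
def chartChristoffel (x₀ : M) (u : E) : E →L[ℝ] E →L[ℝ] E :=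
  christoffel cov x₀ ((extChartAt 𝓘(ℝ, E) x₀).symm u)

theorem contDiffAt_chartChristoffel [T2Space M]
    (hcov : CovariantDerivative.ContMDiffCovariantDerivative cov ∞) :
    ContDiffAt ℝ ∞ (chartChristoffel cov x₀) (extChartAt 𝓘(ℝ, E) x₀ x₀) :=
  (contMDiffAt_iff_chart' (mem_chart_source E x₀)).1 (contMDiffAt_christoffel cov hcov)

omit [FiniteDimensional ℝ E] in
theorem mvfderiv_tcoord_tfield (hy : y ∈ (chartAt E x₀).source) (w : E) :
    mvfderiv 𝓘(ℝ, E) (fun y => tcoord x₀ y (tfield x₀ w y)) y = 0 := by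
  have h : (fun y => tcoord x₀ y (tfield x₀ w y)) =ᶠ[nhds y] fun _ => w := by
    filter_upwards [(chartAt E x₀).open_source.mem_nhds hy] with y hy
    exact tcoord_tfield hy w
  have h2 := h.mfderiv_eq (I := 𝓘(ℝ, E)) (I' := 𝓘(ℝ, E))
  have h3 : mvfderiv 𝓘(ℝ, E) (fun _ : M => w) y = 0 := mvfderiv_const w
  rw [← h3]
  ext v
  exact congrArg (fun l : E →L[ℝ] E => l v) h2

theorem tcoord_cov_tfield (hy : y ∈ (chartAt E x₀).source) (w : E) (v : TangentSpace 𝓘(ℝ, E) y) :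
    tcoord x₀ y (cov (tfield x₀ w) y v) = christoffel cov x₀ y (tcoord x₀ y v) w := by
  rw [tcoord_cov cov hy (mdifferentiableAt_tfield hy w), mvfderiv_tcoord_tfield hy,
    tcoord_tfield hy]
  simp

/-- The constant vector field on a normed space. -/
def constField (w : E) : Π z : E, TangentSpace 𝓘(ℝ, E) z := fun _ => w

omit [FiniteDimensional ℝ E] in
theorem mpullback_chart_const (hy : y ∈ (chartAt E x₀).source) (w : E) :
    VectorField.mpullback 𝓘(ℝ, E) 𝓘(ℝ, E) (extChartAt 𝓘(ℝ, E) x₀)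
      (constField w) y = tfield x₀ w y := by
  have h : mfderiv 𝓘(ℝ, E) 𝓘(ℝ, E) (extChartAt 𝓘(ℝ, E) x₀) y =
      ((trivializationAt E (TangentSpace 𝓘(ℝ, E) : M → Type _) x₀).continuousLinearEquivAt ℝ y hy :
        TangentSpace 𝓘(ℝ, E) y →L[ℝ] E) := by
    ext v
    have := tcoord_eq_mvfderiv hy v
    rw [tcoord_apply hy] at this
    exact this.symm
  rw [VectorField.mpullback_apply, h]
  refine (congrArg (fun l : E →L[ℝ] TangentSpace 𝓘(ℝ, E) y => l w)
    (ContinuousLinearMap.inverse_equiv _)).trans ?_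
  rfl

/-- A coordinate field is the pullback of a constant field under the chart, and pullback commutes
with the bracket. -/
theorem mlieBracket_tfield (hy : y ∈ (chartAt E x₀).source) (a b : E) :
    VectorField.mlieBracket 𝓘(ℝ, E) (tfield x₀ a) (tfield x₀ b) y = 0 := by
  have hev : ∀ w : E, (VectorField.mpullback 𝓘(ℝ, E) 𝓘(ℝ, E) (extChartAt 𝓘(ℝ, E) x₀)
      (constField w)) =ᶠ[nhds y] tfield x₀ w := by
    intro w
    filter_upwards [(chartAt E x₀).open_source.mem_nhds hy] with y hy
    exact mpullback_chart_const hy w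
  have : IsManifold 𝓘(ℝ, E) (minSmoothness ℝ 2) M := by
    rw [minSmoothness_of_isRCLikeNormedField]; infer_instance
  have : IsManifold 𝓘(ℝ, E) (minSmoothness ℝ 2) E := by
    rw [minSmoothness_of_isRCLikeNormedField]; infer_instance
  have : CompleteSpace E := FiniteDimensional.complete ℝ E
  have hc : ∀ w z : E, MDifferentiableAt 𝓘(ℝ, E) (𝓘(ℝ, E).prod 𝓘(ℝ, E))
      (fun z : E => TotalSpace.mk' E z (constField w z)) z := fun w z =>
    ((contMDiffAt_vectorSpace_iff_contDiffAt (n := 1) (V := constField w)).2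
      (contDiffAt_const (c := w))).mdifferentiableAt
      (by simp)
  have h1 := VectorField.mpullback_mlieBracket (n := ∞) (hc a (extChartAt 𝓘(ℝ, E) x₀ y))
    (hc b _) (contMDiffAt_extChartAt' hy)
    (by simp only [minSmoothness_of_isRCLikeNormedField]; exact ENat.LEInfty.out)
  rw [(hev a).mlieBracket_vectorField_eq (hev b)] at h1
  rw [← h1, VectorField.mpullback_apply, ← VectorField.mlieBracketWithin_univ,
    VectorField.mlieBracketWithin_eq_lieBracketWithin]
  have h2 : VectorField.lieBracketWithin ℝ (fun _ : E => a) (fun _ : E => b) Set.univ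
      (extChartAt 𝓘(ℝ, E) x₀ y) = 0 := by simp [VectorField.lieBracketWithin]
  exact (congrArg _ h2).trans (map_zero _)

theorem tcoord_torsion (hy : y ∈ (chartAt E x₀).source) (u v : TangentSpace 𝓘(ℝ, E) y) :
    tcoord x₀ y (cov.torsion y u v) =
      christoffel cov x₀ y (tcoord x₀ y u) (tcoord x₀ y v) -
        christoffel cov x₀ y (tcoord x₀ y v) (tcoord x₀ y u) := by
  have h := cov.torsion_apply (mdifferentiableAt_tfield hy (tcoord x₀ y u))
    (mdifferentiableAt_tfield hy (tcoord x₀ y v))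
  rw [tfield_tcoord hy, tfield_tcoord hy, mlieBracket_tfield hy, sub_zero] at h
  rw [h, map_sub, tcoord_cov_tfield cov hy, tcoord_cov_tfield cov hy]

variable [T2Space M]

/-- The bracket term drops out for coordinate fields; applying `∇ = d + Γ` twice leaves `dΓ + [Γ,
Γ]`. -/
theorem curvature_eq (hcov : CovariantDerivative.ContMDiffCovariantDerivative cov ∞)
    (u v w : TangentSpace 𝓘(ℝ, E) x₀) :
    tcoord x₀ x₀ (curvature 𝓘(ℝ, E) cov x₀ u v w) =
      let Γ := chartChristoffel cov x₀
      let z := extChartAt 𝓘(ℝ, E) x₀ x₀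
      let c := tcoord x₀ x₀
      fderiv ℝ Γ z (c u) (c v) (c w) - fderiv ℝ Γ z (c v) (c u) (c w) +
        (Γ z (c u) (Γ z (c v) (c w)) - Γ z (c v) (Γ z (c u) (c w))) := by
  have hx := mem_chart_source E x₀
  have hΓ := contDiffAt_chartChristoffel (x₀ := x₀) cov hcov
  have key : ∀ u v w : TangentSpace 𝓘(ℝ, E) x₀,
      tcoord x₀ x₀ (cov (fun y => cov (FiberBundle.extend E w) y (FiberBundle.extend E v y)) x₀ u) =
      fderiv ℝ (chartChristoffel cov x₀) (extChartAt 𝓘(ℝ, E) x₀ x₀)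
        (tcoord x₀ x₀ u) (tcoord x₀ x₀ v) (tcoord x₀ x₀ w) +
      chartChristoffel cov x₀ (extChartAt 𝓘(ℝ, E) x₀ x₀) (tcoord x₀ x₀ u)
        (chartChristoffel cov x₀ (extChartAt 𝓘(ℝ, E) x₀ x₀) (tcoord x₀ x₀ v) (tcoord x₀ x₀ w)) := by
    intro u v w
    rw [extend_eq_tfield, extend_eq_tfield]
    have hev : (fun y => tcoord x₀ y (cov (tfield x₀ (tcoord x₀ x₀ w)) y
        (tfield x₀ (tcoord x₀ x₀ v) y))) =ᶠ[nhds x₀]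
        fun y => christoffel cov x₀ y (tcoord x₀ x₀ v) (tcoord x₀ x₀ w) := by
      filter_upwards [(chartAt E x₀).open_source.mem_nhds hx] with y hy
      rw [tcoord_cov_tfield cov hy, tcoord_tfield hy]
    have hd2 : DifferentiableAt ℝ (fun z => chartChristoffel cov x₀ z (tcoord x₀ x₀ v))
        (extChartAt 𝓘(ℝ, E) x₀ x₀) :=
      (hΓ.differentiableAt (by simp)).clm_apply (differentiableAt_const _)
    have hd : MDifferentiableAt 𝓘(ℝ, E) 𝓘(ℝ, E)
        (fun y => christoffel cov x₀ y (tcoord x₀ x₀ v) (tcoord x₀ x₀ w)) x₀ :=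
      (mdifferentiableAt_iff_chart hx).2 (hd2.clm_apply (differentiableAt_const _))
    have hd' := hd.congr_of_eventuallyEq hev
    rw [tcoord_cov cov hx ((mdifferentiableAt_iff_tcoord hx _).2 hd'),
      mvfderiv_eq_fderiv_chart hx hd',
      show tcoord x₀ x₀ (cov (tfield x₀ (tcoord x₀ x₀ w)) x₀ (tfield x₀ (tcoord x₀ x₀ v) x₀)) = _ from
        hev.self_of_nhds]
    have hl : (extChartAt 𝓘(ℝ, E) x₀).symm (extChartAt 𝓘(ℝ, E) x₀ x₀) = x₀ :=
      (eventually_chart_symm hx).self_of_nhds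
    have hev' : (fun z => tcoord x₀ ((extChartAt 𝓘(ℝ, E) x₀).symm z)
        (cov (tfield x₀ (tcoord x₀ x₀ w)) ((extChartAt 𝓘(ℝ, E) x₀).symm z)
        (tfield x₀ (tcoord x₀ x₀ v) ((extChartAt 𝓘(ℝ, E) x₀).symm z))))
        =ᶠ[nhds (extChartAt 𝓘(ℝ, E) x₀ x₀)]
        fun z => chartChristoffel cov x₀ z (tcoord x₀ x₀ v) (tcoord x₀ x₀ w) := by
      have hc := (contMDiffAt_chart_symm hx).continuousAt
      rw [ContinuousAt, hl] at hc
      exact hc.eventually hev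
    rw [hev'.fderiv_eq, fderiv_apply_const hd2, fderiv_apply_const (hΓ.differentiableAt (by simp))]
    simp only [chartChristoffel, hl]
  rw [curvature, map_sub, map_sub, key, key, extend_eq_tfield u, extend_eq_tfield v,
    mlieBracket_tfield hx]
  simp only [map_zero]
  abel

end CurvatureCoordinates

/-! ### The pulled-back connection in a fixed chart -/

section AlongMaps

variable {n : ℕ} {L : Type*} [TopologicalSpace L] [ChartedSpace (EuclideanSpace ℝ (Fin n)) L]
  [IsManifold (𝓡 n) ∞ L]
  {M : Type*} [TopologicalSpace M] [ChartedSpace (EuclideanSpace ℝ (Fin (2 * n))) M]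
  [IsManifold (𝓡 (2 * n)) ∞ M]

theorem mvfderiv_congr_eventually {E V N : Type*} [NormedAddCommGroup E] [NormedSpace ℝ E]
    [TopologicalSpace N] [ChartedSpace E N] [NormedAddCommGroup V] [NormedSpace ℝ V]
    {f g : N → V} {q : N} (h : f =ᶠ[nhds q] g) (X : TangentSpace 𝓘(ℝ, E) q) :
    mvfderiv 𝓘(ℝ, E) f q X = mvfderiv 𝓘(ℝ, E) g q X :=
  congrArg (fun l : E →L[ℝ] V => l X) (h.mfderiv_eq (I := 𝓘(ℝ, E)) (I' := 𝓘(ℝ, V)))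

theorem mvfderiv_clm_apply_of_eq_zero {E V W N : Type*} [NormedAddCommGroup E] [NormedSpace ℝ E]
    [TopologicalSpace N] [ChartedSpace E N] [IsManifold 𝓘(ℝ, E) ∞ N]
    [NormedAddCommGroup V] [NormedSpace ℝ V] [NormedAddCommGroup W] [NormedSpace ℝ W]
    {f : N → V →L[ℝ] W} {g : N → V} {q : N}
    (hf : MDifferentiableAt 𝓘(ℝ, E) 𝓘(ℝ, V →L[ℝ] W) f q)
    (hg : MDifferentiableAt 𝓘(ℝ, E) 𝓘(ℝ, V) g q) (h0 : g q = 0) (X : TangentSpace 𝓘(ℝ, E) q) :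
    mvfderiv 𝓘(ℝ, E) (fun q => f q (g q)) q X = f q (mvfderiv 𝓘(ℝ, E) g q X) := by
  have hq := mem_chart_source E q
  have hl : (extChartAt 𝓘(ℝ, E) q).symm (extChartAt 𝓘(ℝ, E) q q) = q :=
    (eventually_chart_symm hq).self_of_nhds
  have hf' := (mdifferentiableAt_iff_chart hq).1 hf
  have hg' := (mdifferentiableAt_iff_chart hq).1 hg
  have hfg : MDifferentiableAt 𝓘(ℝ, E) 𝓘(ℝ, W) (fun q => f q (g q)) q :=
    (mdifferentiableAt_iff_chart hq).2 (hf'.clm_apply hg')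
  rw [mvfderiv_eq_fderiv_chart hq hfg, mvfderiv_eq_fderiv_chart hq hg,
    fderiv_clm_apply' hf' hg', hl, h0, map_zero, add_zero]

variable (cov : CovariantDerivative (𝓡 (2 * n)) (EuclideanSpace ℝ (Fin (2 * n)))
      (TangentSpace (𝓡 (2 * n)) : M → Type _))

/-- `covAlong` is defined in the chart at `ι q`, which moves with `q`; here the same formula is
obtained in any chart `x₀` around `ι q`. The section `W` is an ambient coordinate field restricted
to `L` plus a section that vanishes at `q`. For the first the chart change is that of `cov`, and for
the second the transition map need not be differentiated. -/
theorem tcoord_covAlong {x₀ : M} {ι : L → M} {q : L}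
    (hι : MDifferentiableAt (𝓡 n) (𝓡 (2 * n)) ι q)
    (hq : ι q ∈ (chartAt (EuclideanSpace ℝ (Fin (2 * n))) x₀).source)
    {W : Π q : L, TangentSpace (𝓡 (2 * n)) (ι q)}
    (hW : MDifferentiableAt (𝓡 n) 𝓘(ℝ, EuclideanSpace ℝ (Fin (2 * n)))
      (fun q => tcoord x₀ (ι q) (W q)) q) (X : TangentSpace (𝓡 n) q) :
    tcoord x₀ (ι q) (covAlong cov ι W q X) =
      mvfderiv (𝓡 n) (fun q => tcoord x₀ (ι q) (W q)) q X +
        christoffel cov x₀ (ι q) (tcoord x₀ (ι q) (mfderiv (𝓡 n) (𝓡 (2 * n)) ι q X))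
          (tcoord x₀ (ι q) (W q)) := by
  have hy := mem_chart_source (EuclideanSpace ℝ (Fin (2 * n))) (ι q)
  set w₀ := tcoord x₀ (ι q) (W q) with hw₀
  have hσq : tfield x₀ w₀ (ι q) = W q := tfield_tcoord hq _
  have hσ := mdifferentiableAt_tfield (x₀ := x₀) hq w₀
  -- the change of coordinates
  set τ : M → EuclideanSpace ℝ (Fin (2 * n)) →L[ℝ] EuclideanSpace ℝ (Fin (2 * n)) := fun y =>
    ((trivializationAt (EuclideanSpace ℝ (Fin (2 * n))) (TangentSpace (𝓡 (2 * n)) : M → Type _)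
      x₀).coordChangeL ℝ (trivializationAt (EuclideanSpace ℝ (Fin (2 * n)))
        (TangentSpace (𝓡 (2 * n)) : M → Type _) (ι q)) y :
      EuclideanSpace ℝ (Fin (2 * n)) →L[ℝ] EuclideanSpace ℝ (Fin (2 * n))) with hτ
  have hτ_apply : ∀ y, y ∈ (chartAt (EuclideanSpace ℝ (Fin (2 * n))) x₀).source →
      y ∈ (chartAt (EuclideanSpace ℝ (Fin (2 * n))) (ι q)).source → ∀ v, τ y v =
        tcoord (ι q) y (tfield x₀ v y) := by
    intro y h1 h2 v
    rw [tcoord_apply h2]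
    exact Trivialization.coordChangeL_apply _ _ ⟨h1, h2⟩ v
  have hτd : MDifferentiableAt (𝓡 n) 𝓘(ℝ, EuclideanSpace ℝ (Fin (2 * n)) →L[ℝ]
      EuclideanSpace ℝ (Fin (2 * n))) (fun q => τ (ι q)) q :=
    (mdifferentiableAt_coordChangeL hq hy).comp q hι
  have hev := hι.continuousAt.eventually (Filter.inter_mem
    ((chartAt (EuclideanSpace ℝ (Fin (2 * n))) x₀).open_source.mem_nhds hq)
    ((chartAt (EuclideanSpace ℝ (Fin (2 * n))) (ι q)).open_source.mem_nhds hy))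
  have hσd := (mdifferentiableAt_iff_tcoord hy _).1 hσ
  have hk : MDifferentiableAt (𝓡 n) 𝓘(ℝ, EuclideanSpace ℝ (Fin (2 * n)))
      (fun q => tcoord x₀ (ι q) (W q) - w₀) q := hW.sub mdifferentiableAt_const
  have e1 : (fun q' => (trivializationAt (EuclideanSpace ℝ (Fin (2 * n)))
      (TangentSpace (𝓡 (2 * n)) : M → Type _) (ι q)
        (TotalSpace.mk' (EuclideanSpace ℝ (Fin (2 * n))) (ι q') (W q'))).2) =ᶠ[nhds q]
      fun q' => tcoord (ι q) (ι q') (tfield x₀ w₀ (ι q')) +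
        τ (ι q') (tcoord x₀ (ι q') (W q') - w₀) := by
    filter_upwards [hev] with q' hq'
    rw [hτ_apply _ hq'.1 hq'.2, ← tcoord_apply hq'.2, ← map_add]
    congr 1
    apply tcoord_injective hq'.1
    rw [map_add, tcoord_tfield hq'.1, tcoord_tfield hq'.1]
    abel
  have hc : MDifferentiableAt (𝓡 n) 𝓘(ℝ, EuclideanSpace ℝ (Fin (2 * n)))
      (fun q' => tcoord (ι q) (ι q') (tfield x₀ w₀ (ι q'))) q := hσd.comp q hι
  have hm : MDifferentiableAt (𝓡 n) 𝓘(ℝ, EuclideanSpace ℝ (Fin (2 * n)))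
      (fun q' => τ (ι q') (tcoord x₀ (ι q') (W q') - w₀)) q := hτd.clm_apply hk
  have e2 : mvfderiv (𝓡 n) (fun q' => (trivializationAt (EuclideanSpace ℝ (Fin (2 * n)))
      (TangentSpace (𝓡 (2 * n)) : M → Type _) (ι q)
        (TotalSpace.mk' (EuclideanSpace ℝ (Fin (2 * n))) (ι q') (W q'))).2) q X =
      mvfderiv (𝓡 (2 * n)) (fun y => tcoord (ι q) y (tfield x₀ w₀ y)) (ι q)
        (mfderiv (𝓡 n) (𝓡 (2 * n)) ι q X) +
      τ (ι q) (mvfderiv (𝓡 n) (fun q => tcoord x₀ (ι q) (W q)) q X) := by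
    rw [mvfderiv_congr_eventually e1, mvfderiv_fun_add hc hm, add_apply,
      mvfderiv_clm_apply_of_eq_zero hτd hk (by simp [hw₀]), mvfderiv_fun_sub hW
        mdifferentiableAt_const, mvfderiv_const, sub_zero]
    congr 1
    exact mfderiv_comp_apply q hσd hι X
  have e3 := tcoord_cov cov hy hσ (mfderiv (𝓡 n) (𝓡 (2 * n)) ι q X)
  have e4 := tcoord_cov_tfield cov hy (tcoord (ι q) (ι q) (W q)) (mfderiv (𝓡 n) (𝓡 (2 * n)) ι q X)
  rw [hσq] at e3
  have e5 : covAlong cov ι W q X = cov (tfield x₀ w₀) (ι q) (mfderiv (𝓡 n) (𝓡 (2 * n)) ι q X) +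
      tfield x₀ (mvfderiv (𝓡 n) (fun q => tcoord x₀ (ι q) (W q)) q X) (ι q) := by
    have e6 : covAlong cov ι W q X = tfield (ι q) (mvfderiv (𝓡 n) (fun q' =>
        (trivializationAt (EuclideanSpace ℝ (Fin (2 * n)))
      (TangentSpace (𝓡 (2 * n)) : M → Type _) (ι q)
        (TotalSpace.mk' (EuclideanSpace ℝ (Fin (2 * n))) (ι q') (W q'))).2) q X) (ι q) +
      cov (FiberBundle.extend (EuclideanSpace ℝ (Fin (2 * n))) (W q)) (ι q)
        (mfderiv (𝓡 n) (𝓡 (2 * n)) ι q X) := rfl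
    apply tcoord_injective hy
    rw [e6, map_add, tcoord_tfield hy, e2, extend_eq_tfield, map_add, e4, e3,
      hτ_apply _ hq hy]
    abel
  rw [e5, map_add, tcoord_cov_tfield cov hq, tcoord_tfield hq, add_comm]

end AlongMaps

/-! ### The almost complex structure and the metric in a chart -/

section TensorCoordinates

variable {E : Type*} [NormedAddCommGroup E] [NormedSpace ℝ E]
  {M : Type*} [TopologicalSpace M] [ChartedSpace E M] [IsManifold 𝓘(ℝ, E) ∞ M]
  {x₀ y : M}

/-- The inverse of `tcoord x₀ y`. -/
def tcoordInv (x₀ y : M) : E →L[ℝ] TangentSpace 𝓘(ℝ, E) y :=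
  (trivializationAt E (TangentSpace 𝓘(ℝ, E) : M → Type _) x₀).symmL ℝ y

theorem tcoordInv_apply (hy : y ∈ (chartAt E x₀).source) (w : E) :
    tcoordInv x₀ y w = tfield x₀ w y :=
  Trivialization.symmL_apply _ hy w

theorem tcoordInv_tcoord (hy : y ∈ (chartAt E x₀).source) (v : TangentSpace 𝓘(ℝ, E) y) :
    tcoordInv x₀ y (tcoord x₀ y v) = v := by
  rw [tcoordInv_apply hy, tfield_tcoord hy]

omit [IsManifold 𝓘(ℝ, E) ∞ M] in
theorem mem_source_of_mem_target {u : E} (hu : u ∈ (extChartAt 𝓘(ℝ, E) x₀).target) :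
    (extChartAt 𝓘(ℝ, E) x₀).symm u ∈ (chartAt E x₀).source := by
  simpa using (extChartAt 𝓘(ℝ, E) x₀).map_target hu

omit [IsManifold 𝓘(ℝ, E) ∞ M] in
theorem chart_mem_target (hy : y ∈ (chartAt E x₀).source) :
    extChartAt 𝓘(ℝ, E) x₀ y ∈ (extChartAt 𝓘(ℝ, E) x₀).target :=
  (extChartAt 𝓘(ℝ, E) x₀).map_source (by simpa using hy)

omit [IsManifold 𝓘(ℝ, E) ∞ M] in
theorem chart_symm_chart (hy : y ∈ (chartAt E x₀).source) :
    (extChartAt 𝓘(ℝ, E) x₀).symm (extChartAt 𝓘(ℝ, E) x₀ y) = y :=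
  (extChartAt 𝓘(ℝ, E) x₀).left_inv (by simpa using hy)

variable (J : Π x : M, TangentSpace 𝓘(ℝ, E) x →L[ℝ] TangentSpace 𝓘(ℝ, E) x)

/-- An endomorphism field in the chart at `x₀`. -/
def chartEnd (x₀ : M) (u : E) : E →L[ℝ] E :=
  tcoord x₀ ((extChartAt 𝓘(ℝ, E) x₀).symm u) ∘L J ((extChartAt 𝓘(ℝ, E) x₀).symm u) ∘L
    tcoordInv x₀ ((extChartAt 𝓘(ℝ, E) x₀).symm u)

theorem chartEnd_tcoord (hy : y ∈ (chartAt E x₀).source) (v : TangentSpace 𝓘(ℝ, E) y) :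
    chartEnd J x₀ (extChartAt 𝓘(ℝ, E) x₀ y) (tcoord x₀ y v) = tcoord x₀ y (J y v) := by
  have h : ∀ y', y' = y → (tcoord x₀ y' ∘L J y' ∘L tcoordInv x₀ y') (tcoord x₀ y v) =
      tcoord x₀ y (J y v) := by
    rintro y' rfl
    change tcoord x₀ y' (J y' (tcoordInv x₀ y' (tcoord x₀ y' v))) = _
    rw [tcoordInv_tcoord hy]
  exact h _ (chart_symm_chart hy)

theorem chartEnd_apply {u : E} (hu : u ∈ (extChartAt 𝓘(ℝ, E) x₀).target) (w : E) :
    chartEnd J x₀ u w = tcoord x₀ ((extChartAt 𝓘(ℝ, E) x₀).symm u)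
      (J _ (tfield x₀ w ((extChartAt 𝓘(ℝ, E) x₀).symm u))) := by
  rw [← tcoordInv_apply (mem_source_of_mem_target hu)]
  rfl

theorem contMDiffAt_end_tfield
    (hJ : ContMDiff 𝓘(ℝ, E) (𝓘(ℝ, E).prod 𝓘(ℝ, E →L[ℝ] E)) ∞
    (fun x => TotalSpace.mk' (E →L[ℝ] E)
      (E := fun x : M => TangentSpace 𝓘(ℝ, E) x →L[ℝ] TangentSpace 𝓘(ℝ, E) x) x (J x)))
    (hy : y ∈ (chartAt E x₀).source) (w : E) :
    ContMDiffAt 𝓘(ℝ, E) (𝓘(ℝ, E).prod 𝓘(ℝ, E)) ∞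
      (fun y => TotalSpace.mk' E y (J y (tfield x₀ w y))) y :=
  ContMDiffAt.clm_bundle_apply (F₁ := E) (F₂ := E) (hJ y) (contMDiffAt_tfield hy w)

variable [FiniteDimensional ℝ E]

theorem contDiffOn_chartEnd (hJ : ContMDiff 𝓘(ℝ, E) (𝓘(ℝ, E).prod 𝓘(ℝ, E →L[ℝ] E)) ∞
    (fun x => TotalSpace.mk' (E →L[ℝ] E)
      (E := fun x : M => TangentSpace 𝓘(ℝ, E) x →L[ℝ] TangentSpace 𝓘(ℝ, E) x) x (J x))) :
    ContDiffOn ℝ ∞ (chartEnd J x₀) (extChartAt 𝓘(ℝ, E) x₀).target := by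
  rw [contDiffOn_clm_apply]
  intro w u hu
  have hy := mem_source_of_mem_target hu
  have h := (contMDiffAt_iff_tcoord hy _).1 (contMDiffAt_end_tfield J hJ hy w)
  have h2 := (contMDiffAt_iff_chart' hy).1 h
  rw [(extChartAt 𝓘(ℝ, E) x₀).right_inv hu] at h2
  refine (h2.congr_of_eventuallyEq ?_).contDiffWithinAt
  filter_upwards [(isOpen_extChartAt_target x₀).mem_nhds hu] with u hu
  exact chartEnd_apply J hu w

/-- Evaluated on coordinate fields, `∇J = 0` becomes `dj = [j, Γ]`, the form in which it enters all
later computations. -/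
theorem fderiv_chartEnd (cov : CovariantDerivative 𝓘(ℝ, E) E (TangentSpace 𝓘(ℝ, E) : M → Type _))
    (hJ : ContMDiff 𝓘(ℝ, E) (𝓘(ℝ, E).prod 𝓘(ℝ, E →L[ℝ] E)) ∞
    (fun x => TotalSpace.mk' (E →L[ℝ] E)
      (E := fun x : M => TangentSpace 𝓘(ℝ, E) x →L[ℝ] TangentSpace 𝓘(ℝ, E) x) x (J x)))
    (hp : ∀ (σ : Π x : M, TangentSpace 𝓘(ℝ, E) x) (x : M),
    MDifferentiableAt 𝓘(ℝ, E) (𝓘(ℝ, E).prod 𝓘(ℝ, E)) (fun y => TotalSpace.mk' E y (σ y)) x →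
      ∀ v : TangentSpace 𝓘(ℝ, E) x, cov (fun y => J y (σ y)) x v = J x (cov σ x v))
    {u : E} (hu : u ∈ (extChartAt 𝓘(ℝ, E) x₀).target) (a : E) :
    fderiv ℝ (chartEnd J x₀) u a = chartEnd J x₀ u * chartChristoffel cov x₀ u a -
      chartChristoffel cov x₀ u a * chartEnd J x₀ u := by
  ext w
  have hy := mem_source_of_mem_target hu
  have hr := (extChartAt 𝓘(ℝ, E) x₀).right_inv hu
  have hd : DifferentiableAt ℝ (chartEnd J x₀) u :=
    ((contDiffOn_chartEnd J hJ).contDiffAt ((isOpen_extChartAt_target x₀).mem_nhds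
      hu)).differentiableAt (by simp)
  set y := (extChartAt 𝓘(ℝ, E) x₀).symm u with hydef
  have h1 := hp (tfield x₀ w) y (mdifferentiableAt_tfield hy w) (tfield x₀ a y)
  have hm := (contMDiffAt_end_tfield J hJ hy w).mdifferentiableAt (by simp)
  have h2 := congrArg (tcoord x₀ y) h1
  have h3 := (mdifferentiableAt_iff_tcoord hy _).1 hm
  have hJw : ∀ v, tcoord x₀ y (J y v) = chartEnd J x₀ u (tcoord x₀ y v) := by
    intro v
    rw [← chartEnd_tcoord J hy v, hr]
  have hev : (fun u => tcoord x₀ ((extChartAt 𝓘(ℝ, E) x₀).symm u)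
      (J _ (tfield x₀ w ((extChartAt 𝓘(ℝ, E) x₀).symm u)))) =ᶠ[nhds u]
      fun u => chartEnd J x₀ u w := by
    filter_upwards [(isOpen_extChartAt_target x₀).mem_nhds hu] with u hu
    exact (chartEnd_apply J hu w).symm
  rw [tcoord_cov cov hy hm, mvfderiv_eq_fderiv_chart hy h3, hr, hev.fderiv_eq, hJw, hJw,
    tcoord_cov_tfield cov hy, tcoord_tfield hy, tcoord_tfield hy, fderiv_apply_const hd] at h2
  exact eq_sub_of_add_eq h2

section Metric

variable [RiemannianBundle (fun x : M => TangentSpace 𝓘(ℝ, E) x)]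

/-- The metric in the chart at `x₀`. -/
def chartMetric (x₀ : M) (u : E) : E →L[ℝ] E →L[ℝ] ℝ :=
  LinearMap.toContinuousLinearMap (LinearMap.toContinuousLinearMap.toLinearMap ∘ₗ
    LinearMap.mk₂ ℝ (fun b c => (inner ℝ (tcoordInv x₀ ((extChartAt 𝓘(ℝ, E) x₀).symm u) b)
      (tcoordInv x₀ ((extChartAt 𝓘(ℝ, E) x₀).symm u) c) : ℝ))
      (fun b b' c => by rw [map_add, inner_add_left])
      (fun r b c => by rw [map_smul, real_inner_smul_left, smul_eq_mul])
      (fun b c c' => by rw [map_add, inner_add_right])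
      (fun r b c => by rw [map_smul, real_inner_smul_right, smul_eq_mul]))

theorem chartMetric_apply {u : E} (hu : u ∈ (extChartAt 𝓘(ℝ, E) x₀).target) (b c : E) :
    chartMetric (M := M) x₀ u b c = inner ℝ (tfield x₀ b ((extChartAt 𝓘(ℝ, E) x₀).symm u))
      (tfield x₀ c ((extChartAt 𝓘(ℝ, E) x₀).symm u)) := by
  rw [← tcoordInv_apply (mem_source_of_mem_target hu),
    ← tcoordInv_apply (mem_source_of_mem_target hu)]
  rfl

theorem chartMetric_tcoord (hy : y ∈ (chartAt E x₀).source) (v w : TangentSpace 𝓘(ℝ, E) y) :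
    chartMetric x₀ (extChartAt 𝓘(ℝ, E) x₀ y) (tcoord x₀ y v) (tcoord x₀ y w) = inner ℝ v w := by
  have h : ∀ y', y' = y → (inner ℝ (tfield x₀ (tcoord x₀ y v) y') (tfield x₀ (tcoord x₀ y w) y') : ℝ)
      = inner ℝ v w := by
    rintro y' rfl
    rw [tfield_tcoord hy, tfield_tcoord hy]
  rw [chartMetric_apply (chart_mem_target hy), h _ (chart_symm_chart hy)]

omit [FiniteDimensional ℝ E] in
theorem contMDiffAt_inner_tfield
    [IsContMDiffRiemannianBundle 𝓘(ℝ, E) ∞ E (fun x : M => TangentSpace 𝓘(ℝ, E) x)]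
    (hy : y ∈ (chartAt E x₀).source) (b c : E) :
    ContMDiffAt 𝓘(ℝ, E) 𝓘(ℝ, ℝ) ∞
      (fun y : M => (inner ℝ (tfield x₀ b y) (tfield x₀ c y) : ℝ)) y :=
  ContMDiffAt.inner_bundle (F := E) (E := fun x : M => TangentSpace 𝓘(ℝ, E) x)
    (contMDiffAt_tfield hy b) (contMDiffAt_tfield hy c)

theorem contDiffOn_chartMetric
    [IsContMDiffRiemannianBundle 𝓘(ℝ, E) ∞ E (fun x : M => TangentSpace 𝓘(ℝ, E) x)] :
    ContDiffOn ℝ ∞ (chartMetric (M := M) x₀) (extChartAt 𝓘(ℝ, E) x₀).target := by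
  rw [contDiffOn_clm_apply]
  intro b
  rw [contDiffOn_clm_apply]
  intro c u hu
  have hy := mem_source_of_mem_target hu
  have h := contMDiffAt_inner_tfield hy b c
  have h2 := (contMDiffAt_iff_chart' hy).1 h
  rw [(extChartAt 𝓘(ℝ, E) x₀).right_inv hu] at h2
  refine (h2.congr_of_eventuallyEq ?_).contDiffWithinAt
  filter_upwards [(isOpen_extChartAt_target x₀).mem_nhds hu] with u hu
  exact chartMetric_apply hu b c

theorem fderiv_chartMetric
    [IsContMDiffRiemannianBundle 𝓘(ℝ, E) ∞ E (fun x : M => TangentSpace 𝓘(ℝ, E) x)]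
    {cov : CovariantDerivative 𝓘(ℝ, E) E (TangentSpace 𝓘(ℝ, E) : M → Type _)}
    (hcov : IsMetricConnection 𝓘(ℝ, E) cov)
    {u : E} (hu : u ∈ (extChartAt 𝓘(ℝ, E) x₀).target) (a b c : E) :
    fderiv ℝ (chartMetric (M := M) x₀) u a b c =
      chartMetric (M := M) x₀ u (chartChristoffel cov x₀ u a b) c +
      chartMetric (M := M) x₀ u b (chartChristoffel cov x₀ u a c) := by
  have hy := mem_source_of_mem_target hu
  have hr := (extChartAt 𝓘(ℝ, E) x₀).right_inv hu
  have hd : DifferentiableAt ℝ (chartMetric (M := M) x₀) u :=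
    (contDiffOn_chartMetric.contDiffAt ((isOpen_extChartAt_target x₀).mem_nhds
      hu)).differentiableAt (by simp)
  set y := (extChartAt 𝓘(ℝ, E) x₀).symm u with hydef
  have h1 := hcov (tfield x₀ b) (tfield x₀ c) y (mdifferentiableAt_tfield hy b)
    (mdifferentiableAt_tfield hy c) (tfield x₀ a y)
  have h := (contMDiffAt_inner_tfield hy b c).mdifferentiableAt (by simp)
  have hev : (fun u => (inner ℝ (tfield x₀ b ((extChartAt 𝓘(ℝ, E) x₀).symm u))
      (tfield x₀ c ((extChartAt 𝓘(ℝ, E) x₀).symm u)) : ℝ)) =ᶠ[nhds u]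
      fun u => chartMetric (M := M) x₀ u b c := by
    filter_upwards [(isOpen_extChartAt_target x₀).mem_nhds hu] with u hu
    exact (chartMetric_apply hu b c).symm
  rw [mvfderiv_eq_fderiv_chart hy h, hr, hev.fderiv_eq, tcoord_tfield hy,
    fderiv_apply_const (hd.clm_apply (differentiableAt_const b)), fderiv_apply_const hd,
    ← chartMetric_tcoord hy, ← chartMetric_tcoord hy, tcoord_cov_tfield cov hy,
    tcoord_cov_tfield cov hy, tcoord_tfield hy, tcoord_tfield hy, tcoord_tfield hy, hr] at h1
  exact h1

end Metric
end TensorCoordinates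

/-! ### Antilinearity of the torsion -/

section TorsionType

/-- A vector-valued 2-form `T` of type `(2,0) + (0,2)` for which `ω(T(·,·),·)` has vanishing cyclic
sum is `J`-antilinear in each argument. -/
theorem antilinear_of_cyclic {V : Type*} [NormedAddCommGroup V] [InnerProductSpace ℝ V]
    {J : V → V} {T : V → V → V} (hJ : ∀ v, J (J v) = -v)
    (hJi : ∀ u v, inner ℝ (J u) (J v) = (inner ℝ u v : ℝ))
    (hneg : ∀ u v, T (-u) v = -T u v) (hskew : ∀ u v, T u v = -T v u)
    (htype : ∀ u v, T (J u) (J v) = -T u v) (hJneg : ∀ v, J (-v) = -J v)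
    (hcyc : ∀ u v w, (inner ℝ (J (T u v)) w : ℝ) + inner ℝ (J (T v w)) u
      + inner ℝ (J (T w u)) v = 0) (u v : V) : T (J u) v = -J (T u v) := by
  have hswap : ∀ u v, T (J u) v = T u (J v) := by
    intro u v
    have h := htype (J u) v
    rw [hJ, hneg] at h
    exact (neg_injective h).symm
  refine ext_inner_right ℝ fun w => ?_
  -- The cyclic identity is used four times, with `J` inserted in none or in two of the three slots.
  -- If the instances are `e0`, …, `e3`, the combination `e1 + e2 - e3`, simplified by `e0`,
  -- isolates `T (J u) v`.
  have e0 := hcyc u v w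
  have e1 := hcyc u (J v) (J w)
  have e2 := hcyc (J u) v (J w)
  have e3 := hcyc (J u) (J v) w
  rw [htype, hJneg, inner_neg_left] at e1 e3
  rw [hskew (J w) (J u), htype, neg_neg, hskew u w, hJneg, inner_neg_left] at e2
  have e4 : (inner ℝ (J (T (J u) v)) (J w) : ℝ) = inner ℝ (T (J u) v) w := hJi _ _
  rw [← hswap u v] at e1
  rw [← hswap v w] at e2
  rw [← hswap w u] at e3
  rw [inner_neg_left]
  linarith

variable {E : Type*} [NormedAddCommGroup E] [NormedSpace ℝ E] [FiniteDimensional ℝ E]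
  {M : Type*} [TopologicalSpace M] [ChartedSpace E M] [IsManifold 𝓘(ℝ, E) ∞ M]
  [RiemannianBundle (fun x : M => TangentSpace 𝓘(ℝ, E) x)]
  {J : Π x : M, TangentSpace 𝓘(ℝ, E) x →L[ℝ] TangentSpace 𝓘(ℝ, E) x}
  {cov : CovariantDerivative 𝓘(ℝ, E) E (TangentSpace 𝓘(ℝ, E) : M → Type _)}

omit [RiemannianBundle (fun x : M => TangentSpace 𝓘(ℝ, E) x)] in
theorem torsion_eq_sub (x : M) (u v : TangentSpace 𝓘(ℝ, E) x) :
    cov.torsion x u v = cov (FiberBundle.extend E v) x u - cov (FiberBundle.extend E u) x v := by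
  have hx := mem_chart_source E x
  apply tcoord_injective hx
  rw [tcoord_torsion cov hx, map_sub, extend_eq_tfield, extend_eq_tfield, tcoord_cov_tfield cov hx,
    tcoord_cov_tfield cov hx]

omit [RiemannianBundle (fun x : M => TangentSpace 𝓘(ℝ, E) x)] in
theorem torsion_skew (x : M) (u v : TangentSpace 𝓘(ℝ, E) x) :
    cov.torsion x u v = -cov.torsion x v u := by
  rw [torsion_eq_sub, torsion_eq_sub, neg_sub]

omit [FiniteDimensional ℝ E] in
theorem IsAlmostHermitian.inner_map_left (hJ : IsAlmostHermitian 𝓘(ℝ, E) J) (x : M)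
    (u v : TangentSpace 𝓘(ℝ, E) x) : (inner ℝ (J x u) v : ℝ) = -inner ℝ u (J x v) := by
  rw [← hJ.inner_map x u (J x v), hJ.sq, inner_neg_right, neg_neg]

theorem mvfderiv_fundForm_extend (hJ : IsAlmostHermitian 𝓘(ℝ, E) J)
    (hcov : IsChernConnection 𝓘(ℝ, E) J cov) (x : M) (u v w : TangentSpace 𝓘(ℝ, E) x) :
    mvfderiv 𝓘(ℝ, E) (fun y => fundForm 𝓘(ℝ, E) J y (FiberBundle.extend E v y)
      (FiberBundle.extend E w y)) x u = inner ℝ (J x (cov (FiberBundle.extend E v) x u)) w -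
      inner ℝ (J x (cov (FiberBundle.extend E w) x u)) v := by
  have hx := mem_chart_source E x
  have hv : ∀ v : TangentSpace 𝓘(ℝ, E) x, (FiberBundle.extend E v : Π y : M, _) x = v := fun v => by
    rw [extend_eq_tfield, tfield_tcoord hx]
  have hd : ∀ v : TangentSpace 𝓘(ℝ, E) x, MDifferentiableAt 𝓘(ℝ, E) (𝓘(ℝ, E).prod 𝓘(ℝ, E))
      (fun y => TotalSpace.mk' E y (FiberBundle.extend E v y)) x := fun v => by
    rw [extend_eq_tfield]
    exact mdifferentiableAt_tfield hx _
  have hJd : MDifferentiableAt 𝓘(ℝ, E) (𝓘(ℝ, E).prod 𝓘(ℝ, E))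
      (fun y => TotalSpace.mk' E y (J y (FiberBundle.extend E v y))) x := by
    rw [extend_eq_tfield]
    exact (contMDiffAt_end_tfield J hJ.contMDiff hx _).mdifferentiableAt (by simp)
  have h := hcov.metric (fun y => J y (FiberBundle.extend E v y)) (FiberBundle.extend E w) x
    hJd (hd w) u
  rw [hcov.parallel _ x (hd v)] at h
  refine h.trans ?_
  rw [hv, hv, hJ.inner_map_left x v, real_inner_comm _ v]
  ring

/-- As `ω` is parallel and coordinate fields commute, `dω = 0` says that the cyclic sum of `ω(T(u,
v), w)` vanishes, which is the hypothesis of `antilinear_of_cyclic`. This is the only place where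
closedness of `ω` enters. -/
theorem torsion_antilinear (hJ : IsAlmostKahler 𝓘(ℝ, E) J)
    (hcov : IsChernConnection 𝓘(ℝ, E) J cov) (x : M) (u v : TangentSpace 𝓘(ℝ, E) x) :
    cov.torsion x (J x u) v = -J x (cov.torsion x u v) := by
  have hx := mem_chart_source E x
  have hbr : ∀ u v : TangentSpace 𝓘(ℝ, E) x, VectorField.mlieBracket 𝓘(ℝ, E)
      (FiberBundle.extend E u) (FiberBundle.extend E v) x = 0 := fun u v =>
    by rw [extend_eq_tfield, extend_eq_tfield, mlieBracket_tfield hx]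
  have hz : ∀ w, fundForm 𝓘(ℝ, E) J x 0 w = 0 := by
    intro w
    rw [fundForm, map_zero, inner_zero_left]
  refine antilinear_of_cyclic (V := TangentSpace 𝓘(ℝ, E) x) (J := J x)
    (T := fun u v => cov.torsion x u v) (hJ.sq x) (hJ.inner_map x) (fun u v => ?_)
    (torsion_skew x) (hcov.torsion_type x) (fun v => map_neg _ v) (fun u v w => ?_) u v
  · rw [map_neg]; rfl
  · have h := hJ.closed x u v w
    rw [extDerivTwoForm, hbr, hbr, hbr, hz, hz, hz,
      mvfderiv_fundForm_extend hJ.toIsAlmostHermitian hcov,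
      mvfderiv_fundForm_extend hJ.toIsAlmostHermitian hcov,
      mvfderiv_fundForm_extend hJ.toIsAlmostHermitian hcov] at h
    simp only [torsion_eq_sub, map_sub, inner_sub_left]
    linarith

end TorsionType

/-! ### Complex frames built from a totally real frame -/

section Frames

variable {E F : Type*} [NormedAddCommGroup E] [NormedSpace ℝ E]
  [NormedAddCommGroup F] [NormedSpace ℝ F]

/-- The map `(a, b) ↦ A a + j (A b)`. -/
def realFrame (j : E →L[ℝ] E) (A : F →L[ℝ] E) : F × F →L[ℝ] E :=
  A ∘L ContinuousLinearMap.fst ℝ F F + j ∘L A ∘L ContinuousLinearMap.snd ℝ F F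

/-- The splitting `A a + j (A b) ↦ (a, b)`. -/
def realCoframe (j : E →L[ℝ] E) (A : F →L[ℝ] E) : E →L[ℝ] F × F :=
  (realFrame j A).inverse

/-- `A a + j (A b) ↦ a`. -/
def rePart (j : E →L[ℝ] E) (A : F →L[ℝ] E) : E →L[ℝ] F :=
  ContinuousLinearMap.fst ℝ F F ∘L realCoframe j A

/-- `A a + j (A b) ↦ b`. -/
def imPart (j : E →L[ℝ] E) (A : F →L[ℝ] E) : E →L[ℝ] F :=
  ContinuousLinearMap.snd ℝ F F ∘L realCoframe j A

variable {j : E →L[ℝ] E} {A : F →L[ℝ] E}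

theorem realFrame_apply (k : F × F) : realFrame j A k = A k.1 + j (A k.2) := rfl

theorem realFrame_eq_splitMap : (realFrame j A).toLinearMap =
    splitMap j.toLinearMap A.toLinearMap := by
  ext k <;> simp [realFrame_apply, splitMap]

/-- The complex structure on `F × F` does not depend on the point; it is the constant `J₀` required
by `curl_connTrace`. -/
theorem comp_realFrame (hj : ∀ v, j (j v) = -v) :
    j ∘L realFrame j A = realFrame j A ∘L
      ((-ContinuousLinearMap.snd ℝ F F).prod (ContinuousLinearMap.fst ℝ F F)) := by
  refine ContinuousLinearMap.ext fun k => ?_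
  change j (A k.1 + j (A k.2)) = A (-k.2) + j (A k.1)
  rw [map_add, hj, map_neg, add_comm]

section Inverse

variable (hA : (realFrame j A).IsInvertible)
include hA

theorem realCoframe_realFrame (k : F × F) : realCoframe j A (realFrame j A k) = k :=
  hA.inverse_apply_self k

theorem realFrame_realCoframe (v : E) : realFrame j A (realCoframe j A v) = v :=
  hA.self_apply_inverse v

theorem rePart_map (a : F) : rePart j A (A a) = a := by
  have h := realCoframe_realFrame hA (a, 0)
  rw [realFrame_apply, map_zero, map_zero, add_zero] at h
  exact congrArg Prod.fst h

theorem imPart_map (a : F) : imPart j A (A a) = 0 := by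
  have h := realCoframe_realFrame hA (a, 0)
  rw [realFrame_apply, map_zero, map_zero, add_zero] at h
  exact congrArg Prod.snd h

theorem realCoframe_apply_map (hj : ∀ v, j (j v) = -v) (v : E) :
    realCoframe j A (j v) = (-(realCoframe j A v).2, (realCoframe j A v).1) := by
  conv_lhs => rw [← realFrame_realCoframe hA v]
  have h := congrArg (fun f => f (realCoframe j A v)) (comp_realFrame (A := A) hj)
  change j (realFrame j A (realCoframe j A v)) = realFrame j A _ at h
  rw [h, realCoframe_realFrame hA]
  rfl

theorem imPart_apply_map (hj : ∀ v, j (j v) = -v) (v : E) :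
    imPart j A (j v) = rePart j A v :=
  congrArg Prod.snd (realCoframe_apply_map hA hj v)

end Inverse

/-- `tr (j ∘ (B + j B) ∘ S) = -2 tr (Im B)`. -/
theorem clmTrace_realFrame [FiniteDimensional ℝ E] [FiniteDimensional ℝ F]
    (hA : (realFrame j A).IsInvertible) (hj : ∀ v, j (j v) = -v) (B : F →L[ℝ] E) :
    clmTrace E (j * (realFrame j B ∘L realCoframe j A)) =
      -(2 * clmTrace F (imPart j A ∘L B)) := by
  have h := trace_complex_mul (J := j.toLinearMap) (A := A.toLinearMap)
    (S := (realCoframe j A).toLinearMap) hj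
    (fun k => by rw [← realFrame_eq_splitMap]; exact realCoframe_realFrame hA k)
    (fun v => by rw [← realFrame_eq_splitMap]; exact realFrame_realCoframe hA v) B.toLinearMap
  rw [← realFrame_eq_splitMap] at h
  exact h

variable [CompleteSpace F] {P : Type*} [NormedAddCommGroup P] [NormedSpace ℝ P]

omit [NormedSpace ℝ P] in
theorem eventually_isInvertible [CompleteSpace E] {T : P → F →L[ℝ] E} {z : P}
    (hT : ContinuousAt T z) (h : (T z).IsInvertible) : ∀ᶠ y in nhds z, (T y).IsInvertible := by
  obtain ⟨e, he⟩ := h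
  have := e.nhds
  rw [he] at this
  filter_upwards [hT this] with y ⟨e', he'⟩
  exact ⟨e', he'⟩

variable {j : P → E →L[ℝ] E} {A : P → F →L[ℝ] E} {z : P} {m : WithTop ℕ∞}

omit [CompleteSpace F] in
theorem contDiffAt_realFrame (hj : ContDiffAt ℝ m j z) (hA : ContDiffAt ℝ m A z) :
    ContDiffAt ℝ m (fun z => realFrame (j z) (A z)) z :=
  (hA.clm_comp contDiffAt_const).add (hj.clm_comp (hA.clm_comp contDiffAt_const))

/-- Inversion of operators is smooth at invertible ones, so the description of the splitting by
`inverse` yields its regularity at once. -/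
theorem contDiffAt_realCoframe (hj : ContDiffAt ℝ m j z) (hA : ContDiffAt ℝ m A z)
    (hi : (realFrame (j z) (A z)).IsInvertible) :
    ContDiffAt ℝ m (fun z => realCoframe (j z) (A z)) z :=
  ContDiffAt.comp z hi.contDiffAt_map_inverse (contDiffAt_realFrame hj hA)

omit [CompleteSpace F] in
theorem fderiv_realFrame (hj : DifferentiableAt ℝ j z) (hA : DifferentiableAt ℝ A z) (c : P) :
    fderiv ℝ (fun z => realFrame (j z) (A z)) z c = realFrame (j z) (fderiv ℝ A z c) +
      fderiv ℝ j z c ∘L A z ∘L ContinuousLinearMap.snd ℝ F F := by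
  have h1 : DifferentiableAt ℝ (fun z => A z ∘L ContinuousLinearMap.snd ℝ F F) z :=
    hA.clm_comp (differentiableAt_const _)
  have h2 : DifferentiableAt ℝ (fun z => A z ∘L ContinuousLinearMap.fst ℝ F F) z :=
    hA.clm_comp (differentiableAt_const _)
  unfold realFrame
  rw [fderiv_fun_add h2 (hj.clm_comp h1), add_apply, fderiv_clm_comp_apply' hj h1,
    fderiv_clm_comp_apply' hA (differentiableAt_const _),
    fderiv_clm_comp_apply' hA (differentiableAt_const _), fderiv_const_apply, fderiv_const_apply]
  refine ContinuousLinearMap.ext fun k => ?_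
  change A z (0 : F) + fderiv ℝ A z c k.1 +
    (j z (A z (0 : F) + fderiv ℝ A z c k.2) + fderiv ℝ j z c (A z k.2)) =
    fderiv ℝ A z c k.1 + j z (fderiv ℝ A z c k.2) + fderiv ℝ j z c (A z k.2)
  rw [map_zero, zero_add, zero_add, add_assoc]

end Frames

/-! ### The Maslov form of a frame along a map, and its exterior derivative -/

section LocalModel

variable {E F P : Type*} [NormedAddCommGroup E] [NormedSpace ℝ E] [FiniteDimensional ℝ E]
  [NormedAddCommGroup F] [NormedSpace ℝ F] [FiniteDimensional ℝ F]
  [NormedAddCommGroup P] [NormedSpace ℝ P]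

section Pullback

variable {E G P : Type*} [NormedAddCommGroup E] [NormedSpace ℝ E]
  [NormedAddCommGroup G] [NormedSpace ℝ G] [NormedAddCommGroup P] [NormedSpace ℝ P]

theorem fderiv_comp_apply {Γ : E → G} {f : P → E} {z : P} (hΓ : DifferentiableAt ℝ Γ (f z))
    (hf : DifferentiableAt ℝ f z) (a : P) :
    fderiv ℝ (fun z => Γ (f z)) z a = fderiv ℝ Γ (f z) (fderiv ℝ f z a) :=
  congrArg (fun l => l a) (fderiv_comp z hΓ hf)

theorem fderiv_pullback_form {Γ : E → E →L[ℝ] G} {f : P → E} {z : P}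
    (hΓ : DifferentiableAt ℝ Γ (f z)) (hf : DifferentiableAt ℝ f z)
    (hdf : DifferentiableAt ℝ (fderiv ℝ f) z) (a b : P) :
    fderiv ℝ (fun z => Γ (f z) ∘L fderiv ℝ f z) z a b =
      Γ (f z) (fderiv ℝ (fderiv ℝ f) z a b) + fderiv ℝ Γ (f z) (fderiv ℝ f z a) (fderiv ℝ f z b) := by
  have h : DifferentiableAt ℝ (fun z => Γ (f z)) z := hΓ.comp z hf
  rw [fderiv_clm_comp_apply' h hdf, fderiv_comp_apply hΓ hf]
  rfl

end Pullback

/-- `j` is an almost complex structure near `w₀`, parallel for the connection with Christoffel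
symbols `Γ`. -/
structure IsParallelComplexAt (j : E → E →L[ℝ] E) (Γ : E → E →L[ℝ] E →L[ℝ] E) (w₀ : E) : Prop where
  contDiffAt_end : ContDiffAt ℝ 3 j w₀
  contDiffAt_symbol : ContDiffAt ℝ 3 Γ w₀
  sq : ∀ᶠ w in nhds w₀, ∀ v, j w (j w v) = -v
  fderiv_end : ∀ᶠ w in nhds w₀, ∀ a, fderiv ℝ j w a = j w * Γ w a - Γ w a * j w

variable {j : E → E →L[ℝ] E} {Γ : E → E →L[ℝ] E →L[ℝ] E}

omit [FiniteDimensional ℝ E] in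
theorem IsParallelComplexAt.eventually {w₀ : E} (h : IsParallelComplexAt j Γ w₀) :
    ∀ᶠ w in nhds w₀, IsParallelComplexAt j Γ w := by
  filter_upwards [h.contDiffAt_end.eventually (by simp), h.contDiffAt_symbol.eventually (by simp),
    h.sq.eventually_nhds, h.fderiv_end.eventually_nhds] with w h1 h2 h3 h4
  exact ⟨h1, h2, h3, h4⟩

variable (j Γ) in
/-- The 1-form `c ↦ -tr Im (D_c A + Γ(Df c) A)` of a map `f` and a frame `A` along `f`. -/
def frameMaslov (f : P → E) (A : P → F →L[ℝ] E) (c z : P) : ℝ :=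
  -clmTrace F (imPart (j (f z)) (A z) ∘L
    (fderiv ℝ A z c + Γ (f z) (fderiv ℝ f z c) ∘L A z))

variable {f : P → E} {A : P → F →L[ℝ] E} {z : P}

/-- Because `j` is parallel, `∇(A, jA) = (∇A, j∇A)`, so the connection form is `realFrame j (∇A) ∘
S`. By `clmTrace_realFrame` its trace against `j` is `-2 tr Im (∇A)`, whence the factor `1 / 2`. -/
theorem connTrace_eq_frameMaslov (hw : IsParallelComplexAt j Γ (f z))
    (hf : DifferentiableAt ℝ f z) (hA : DifferentiableAt ℝ A z)
    (hi : (realFrame (j (f z)) (A z)).IsInvertible) (c : P) :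
    frameMaslov j Γ f A c z = 1 / 2 * connTrace (fun z => j (f z))
      (fun z => Γ (f z) ∘L fderiv ℝ f z) (fun z => realFrame (j (f z)) (A z))
      (fun z => realCoframe (j (f z)) (A z)) c z := by
  have hj : DifferentiableAt ℝ j (f z) := hw.contDiffAt_end.differentiableAt (by simp)
  have hjf : DifferentiableAt ℝ (fun z => j (f z)) z := hj.comp z hf
  have hjd : fderiv ℝ (fun z => j (f z)) z c = j (f z) * Γ (f z) (fderiv ℝ f z c) -
      Γ (f z) (fderiv ℝ f z c) * j (f z) := by
    rw [← hw.fderiv_end.self_of_nhds]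
    exact fderiv_comp_apply hj hf c
  have key : fderiv ℝ (fun z => realFrame (j (f z)) (A z)) z c ∘L realCoframe (j (f z)) (A z) +
      Γ (f z) (fderiv ℝ f z c) = realFrame (j (f z))
        (fderiv ℝ A z c + Γ (f z) (fderiv ℝ f z c) ∘L A z) ∘L realCoframe (j (f z)) (A z) := by
    refine ContinuousLinearMap.ext fun v => ?_
    rw [fderiv_realFrame hjf hA, hjd]
    conv_lhs => rw [add_apply]; arg 2; rw [← realFrame_realCoframe hi v]
    set k := realCoframe (j (f z)) (A z) v with hk
    set G := Γ (f z) (fderiv ℝ f z c)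
    change (fderiv ℝ A z c k.1 + j (f z) (fderiv ℝ A z c k.2)) +
      (j (f z) (G (A z k.2)) - G (j (f z) (A z k.2))) + G (A z k.1 + j (f z) (A z k.2)) =
      (fderiv ℝ A z c k.1 + G (A z k.1)) + j (f z) (fderiv ℝ A z c k.2 + G (A z k.2))
    rw [map_add, map_add]
    abel
  unfold connTrace frameMaslov
  rw [show (Γ (f z) ∘L fderiv ℝ f z) c = Γ (f z) (fderiv ℝ f z c) from rfl, key,
    clmTrace_realFrame hi hw.sq.self_of_nhds]
  ring

/-- The curvature of the connection with Christoffel symbols `Γ`. -/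
def symbolCurvature (Γ : E → E →L[ℝ] E →L[ℝ] E) (w a b : E) : E →L[ℝ] E :=
  fderiv ℝ Γ w a b - fderiv ℝ Γ w b a + (Γ w a * Γ w b - Γ w b * Γ w a)

theorem eventually_connTrace_eq (hw : IsParallelComplexAt j Γ (f z)) (hf : ContDiffAt ℝ 3 f z)
    (hA : ContDiffAt ℝ 2 A z) (hi : (realFrame (j (f z)) (A z)).IsInvertible) (c : P) :
    frameMaslov j Γ f A c =ᶠ[nhds z] fun z => 1 / 2 * connTrace (fun z => j (f z))
      (fun z => Γ (f z) ∘L fderiv ℝ f z) (fun z => realFrame (j (f z)) (A z))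
      (fun z => realCoframe (j (f z)) (A z)) c z := by
  have hjf : ContDiffAt ℝ 3 (fun z => j (f z)) z := hw.contDiffAt_end.comp z hf
  have hE := contDiffAt_realFrame (hjf.of_le (by norm_num)) hA
  filter_upwards [hf.continuousAt.eventually hw.eventually, hf.eventually (by simp),
    hA.eventually (by simp), eventually_isInvertible hE.continuousAt hi] with y h1 h2 h3 h4
  exact connTrace_eq_frameMaslov h1 (h2.differentiableAt (by simp)) (h3.differentiableAt (by simp))
    h4 c

omit [FiniteDimensional ℝ E] in
theorem differentiableAt_pullback_symbol (hw : IsParallelComplexAt j Γ (f z))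
    (hf : ContDiffAt ℝ 3 f z) : DifferentiableAt ℝ (fun z => Γ (f z) ∘L fderiv ℝ f z) z :=
  ((hw.contDiffAt_symbol.comp z hf).differentiableAt (by simp)).clm_comp
    ((hf.fderiv_right (m := 2) (by norm_num)).differentiableAt (by simp))

theorem differentiableAt_frameMaslov (hw : IsParallelComplexAt j Γ (f z)) (hf : ContDiffAt ℝ 3 f z)
    (hA : ContDiffAt ℝ 2 A z) (hi : (realFrame (j (f z)) (A z)).IsInvertible) (c : P) :
    DifferentiableAt ℝ (frameMaslov j Γ f A c) z := by
  have hjf : ContDiffAt ℝ 3 (fun z => j (f z)) z := hw.contDiffAt_end.comp z hf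
  have h2 : ContDiffAt ℝ 2 (fun z => j (f z)) z := hjf.of_le (by norm_num)
  refine (eventually_connTrace_eq hw hf hA hi c).differentiableAt_iff.2
    ((differentiableAt_connTrace (hjf.differentiableAt (by simp))
      (differentiableAt_pullback_symbol hw hf) (contDiffAt_realFrame h2 hA)
      ((contDiffAt_realCoframe h2 hA hi).differentiableAt (by simp)) c).const_mul _)

/-- The structure equation `curl_connTrace` for the pulled-back symbol `Γ(f) ∘ Df`: the term
`Γ(D²f)` cancels by symmetry of `D²f`, which leaves the pullback of the curvature. The frame `A`
does not enter the right-hand side. -/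
theorem curl_frameMaslov (hw : IsParallelComplexAt j Γ (f z)) (hf : ContDiffAt ℝ 3 f z)
    (hA : ContDiffAt ℝ 2 A z) (hi : (realFrame (j (f z)) (A z)).IsInvertible) (a b : P) :
    fderiv ℝ (frameMaslov j Γ f A b) z a - fderiv ℝ (frameMaslov j Γ f A a) z b =
      1 / 2 * clmTrace E (j (f z) * symbolCurvature Γ (f z) (fderiv ℝ f z a) (fderiv ℝ f z b)) := by
  have hjf : ContDiffAt ℝ 3 (fun z => j (f z)) z := hw.contDiffAt_end.comp z hf
  have h2 : ContDiffAt ℝ 2 (fun z => j (f z)) z := hjf.of_le (by norm_num)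
  have hE := contDiffAt_realFrame h2 hA
  have hS := contDiffAt_realCoframe h2 hA hi
  have hfd : DifferentiableAt ℝ f z := hf.differentiableAt (by simp)
  have hj : DifferentiableAt ℝ j (f z) := hw.contDiffAt_end.differentiableAt (by simp)
  have hΓ : DifferentiableAt ℝ Γ (f z) := hw.contDiffAt_symbol.differentiableAt (by simp)
  have hγ := differentiableAt_pullback_symbol hw hf
  have hdf : DifferentiableAt ℝ (fderiv ℝ f) z :=
    (hf.fderiv_right (m := 2) (by norm_num)).differentiableAt (by simp)
  have hd : ∀ c, DifferentiableAt ℝ (connTrace (fun z => j (f z))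
      (fun z => Γ (f z) ∘L fderiv ℝ f z) (fun z => realFrame (j (f z)) (A z))
      (fun z => realCoframe (j (f z)) (A z)) c) z := fun c =>
    differentiableAt_connTrace (hjf.differentiableAt (by simp)) hγ hE
      (hS.differentiableAt (by simp)) c
  have hinv := eventually_isInvertible hE.continuousAt hi
  have hcurl := curl_connTrace (j := fun z => j (f z)) (γ := fun z => Γ (f z) ∘L fderiv ℝ f z)
    (Eh := fun z => realFrame (j (f z)) (A z)) (S := fun z => realCoframe (j (f z)) (A z)) (z := z)
    (hjf.differentiableAt (by simp)) (fun a => by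
      change _ = j (f z) * Γ (f z) (fderiv ℝ f z a) - Γ (f z) (fderiv ℝ f z a) * j (f z)
      rw [← hw.fderiv_end.self_of_nhds]
      exact fderiv_comp_apply hj hfd a) hγ hE (hS.differentiableAt (by simp))
    (by filter_upwards [hinv] with y hy using hy.self_comp_inverse) hi.inverse_comp_self
    (by filter_upwards [hf.continuousAt.eventually hw.sq] with y hy using comp_realFrame hy) a b
  rw [(eventually_connTrace_eq hw hf hA hi a).fderiv_eq,
    (eventually_connTrace_eq hw hf hA hi b).fderiv_eq, fderiv_const_mul (hd a),
    fderiv_const_mul (hd b), smul_apply, smul_apply, smul_eq_mul, smul_eq_mul, ← mul_sub, hcurl]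
  have hsymm : fderiv ℝ (fderiv ℝ f) z a b = fderiv ℝ (fderiv ℝ f) z b a :=
    ((hf.of_le (by norm_num : (2 : WithTop ℕ∞) ≤ 3)).isSymmSndFDerivAt (by simp)).eq a b
  rw [fderiv_pullback_form hΓ hfd hdf, fderiv_pullback_form hΓ hfd hdf, hsymm, add_sub_add_left_eq_sub]
  rfl

end LocalModel

/-! ### Restriction to time slices -/

section Slices

variable {E F G : Type*} [NormedAddCommGroup E] [NormedSpace ℝ E]
  [NormedAddCommGroup F] [NormedSpace ℝ F] [NormedAddCommGroup G] [NormedSpace ℝ G]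

/-- The derivative of `f` in the second variable. -/
def spatialFrame (f : ℝ × F → E) (z : ℝ × F) : F →L[ℝ] E :=
  fderiv ℝ f z ∘L ContinuousLinearMap.inr ℝ ℝ F

theorem hasFDerivAt_slice (t : ℝ) (u : F) :
    HasFDerivAt (fun u : F => (t, u)) (ContinuousLinearMap.inr ℝ ℝ F) u :=
  hasFDerivAt_prodMk_right t u

theorem fderiv_slice {g : ℝ × F → G} {t : ℝ} {u : F} (hg : DifferentiableAt ℝ g (t, u)) :
    fderiv ℝ (fun u => g (t, u)) u = fderiv ℝ g (t, u) ∘L ContinuousLinearMap.inr ℝ ℝ F :=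
  (hg.hasFDerivAt.comp u (hasFDerivAt_slice t u)).fderiv

theorem differentiableAt_slice {g : ℝ × F → G} {t : ℝ} {u : F}
    (hg : DifferentiableAt ℝ g (t, u)) : DifferentiableAt ℝ (fun u => g (t, u)) u :=
  (hg.hasFDerivAt.comp u (hasFDerivAt_slice t u)).differentiableAt

variable {f : ℝ × F → E} {z : ℝ × F}

theorem contDiffAt_spatialFrame (hf : ContDiffAt ℝ 3 f z) : ContDiffAt ℝ 2 (spatialFrame f) z :=
  (hf.fderiv_right (m := 2) (by norm_num)).clm_comp contDiffAt_const

theorem fderiv_spatialFrame (hf : ContDiffAt ℝ 3 f z) (a : ℝ × F) :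
    fderiv ℝ (spatialFrame f) z a = fderiv ℝ (fderiv ℝ f) z a ∘L ContinuousLinearMap.inr ℝ ℝ F := by
  have hd : DifferentiableAt ℝ (fderiv ℝ f) z :=
    (hf.fderiv_right (m := 2) (by norm_num)).differentiableAt (by simp)
  unfold spatialFrame
  rw [fderiv_clm_comp_apply' hd (differentiableAt_const _), fderiv_const_apply]
  refine ContinuousLinearMap.ext fun k => ?_
  change fderiv ℝ f z (0 : ℝ × F) + _ = _
  rw [map_zero, zero_add]
  rfl

omit [NormedSpace ℝ F] in
theorem eventually_slice {Q : ℝ × F → Prop} {t : ℝ} {u : F} (h : ∀ᶠ z in nhds (t, u), Q z) :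
    ∀ᶠ u in nhds u, Q (t, u) :=
  (Continuous.prodMk_right t).continuousAt.eventually h

theorem fderiv_fderiv_slice {t : ℝ} {u : F} (hf : ContDiffAt ℝ 3 f (t, u)) (c : F) :
    fderiv ℝ (fderiv ℝ fun u => f (t, u)) u c = fderiv ℝ (spatialFrame f) (t, u) (0, c) := by
  have h : fderiv ℝ (fun u => f (t, u)) =ᶠ[nhds u] fun u => spatialFrame f (t, u) := by
    filter_upwards [eventually_slice (hf.eventually (by simp))] with u hu
    exact fderiv_slice (hu.differentiableAt (by simp))
  rw [h.fderiv_eq, fderiv_slice ((contDiffAt_spatialFrame hf).differentiableAt (by simp))]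
  rfl

end Slices

/-! ### The local variation formula -/

section Variation

variable {E F : Type*} [NormedAddCommGroup E] [NormedSpace ℝ E] [FiniteDimensional ℝ E]
  [NormedAddCommGroup F] [NormedSpace ℝ F] [FiniteDimensional ℝ F]
  {j : E → E →L[ℝ] E} {Γ : E → E →L[ℝ] E →L[ℝ] E}

omit [FiniteDimensional ℝ E] in
-- The form on `ℝ × F`, restricted to spatial directions, is the Maslov form of the map at time `t`.
-- The family of Maslov forms is thereby part of a single form whose curl is known.
theorem frameMaslov_slice {f : ℝ × F → E} {t : ℝ} {u : F} (hf : ContDiffAt ℝ 3 f (t, u)) (c : F) :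
    frameMaslov j Γ f (spatialFrame f) (0, c) (t, u) =
      frameMaslov j Γ (fun u => f (t, u)) (fderiv ℝ fun u => f (t, u)) c u := by
  unfold frameMaslov
  rw [fderiv_fderiv_slice hf, fderiv_slice (hf.differentiableAt (by simp))]
  rfl

variable (j Γ) in
/-- The local expression of `tr (v ↦ Re ∇_v (A y)) - tr (v ↦ Re T(A y, A v))` for `A = Df`. -/
def sliceDiv (f : F → E) (y : F → F) (u : F) : ℝ :=
  clmTrace F (rePart (j (f u)) (fderiv ℝ f u) ∘L (fderiv ℝ (fderiv ℝ f) u (y u) +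
    (2 : ℝ) • ((Γ (f u)).flip (fderiv ℝ f u (y u)) ∘L fderiv ℝ f u) -
    Γ (f u) (fderiv ℝ f u (y u)) ∘L fderiv ℝ f u)) + clmTrace F (fderiv ℝ y u)

omit [FiniteDimensional ℝ E] in
-- By symmetry of `D²f`, `∇_t (A c) = ∇_c Z + T(Z, A c)` for the velocity `Z = A x + j A y`. The
-- part `A x` reproduces the form on `x`, up to a tangential vector without imaginary part. In the
-- part `j A y`, parallelism of `j` and `T(jAy, ·) = -j T(Ay, ·)` turn the imaginary part into the
-- real part of `∇_c (A y) - T(A y, A c)`.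
theorem frameMaslov_velocity {f : ℝ × F → E} {x y : F → F} {u : F}
    (hw : IsParallelComplexAt j Γ (f (0, u)))
    (htor : ∀ a b, Γ (f (0, u)) (j (f (0, u)) a) b - Γ (f (0, u)) b (j (f (0, u)) a) =
      -j (f (0, u)) (Γ (f (0, u)) a b - Γ (f (0, u)) b a))
    (hf : ContDiffAt ℝ 3 f (0, u))
    (hi : (realFrame (j (f (0, u))) (spatialFrame f (0, u))).IsInvertible)
    (hx : DifferentiableAt ℝ x u) (hy : DifferentiableAt ℝ y u)
    (hv : ∀ᶠ u in nhds u, fderiv ℝ f (0, u) (1, 0) = spatialFrame f (0, u) (x u) +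
      j (f (0, u)) (spatialFrame f (0, u) (y u))) :
    frameMaslov j Γ f (spatialFrame f) (1, 0) (0, u) =
      -sliceDiv j Γ (fun u => f (0, u)) y u +
        frameMaslov j Γ f (spatialFrame f) (0, x u) (0, u) := by
  have hfd : DifferentiableAt ℝ f (0, u) := hf.differentiableAt (by simp)
  have hdf : DifferentiableAt ℝ (fderiv ℝ f) (0, u) :=
    (hf.fderiv_right (m := 2) (by norm_num)).differentiableAt (by simp)
  have hA := (contDiffAt_spatialFrame hf).differentiableAt (by simp)
  have hj : DifferentiableAt ℝ j (f (0, u)) := hw.contDiffAt_end.differentiableAt (by simp)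
  have hj0 : DifferentiableAt ℝ (fun u => j (f (0, u))) u :=
    differentiableAt_slice (g := fun z => j (f z)) (hj.comp (0, u) hfd)
  have hA0 := differentiableAt_slice hA
  have hsymm : ∀ a b, fderiv ℝ (fderiv ℝ f) (0, u) a b = fderiv ℝ (fderiv ℝ f) (0, u) b a :=
    ((hf.of_le (by norm_num : (2 : WithTop ℕ∞) ≤ 3)).isSymmSndFDerivAt (by simp)).eq
  have hAc : ∀ c, fderiv ℝ (fun u => spatialFrame f (0, u)) u c =
      fderiv ℝ (fderiv ℝ f) (0, u) (0, c) ∘L ContinuousLinearMap.inr ℝ ℝ F := by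
    intro c
    rw [fderiv_slice hA, ← fderiv_spatialFrame hf]
    rfl
  set w := f (0, u)
  set A := spatialFrame f (0, u) with hAdef
  have hjc : ∀ c, fderiv ℝ (fun u => j (f (0, u))) u c = j w * Γ w (A c) - Γ w (A c) * j w := by
    intro c
    rw [← hw.fderiv_end.self_of_nhds, fderiv_slice (g := fun z => j (f z)) (hj.comp (0, u) hfd)]
    exact fderiv_comp_apply hj hfd (0, c)
  -- The mixed second derivative of `f` is the spatial derivative of the velocity, and `dj` is
  -- replaced by `[j, Γ]`.
  have hder : ∀ c, fderiv ℝ (fderiv ℝ f) (0, u) (0, c) (1, 0) =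
      fderiv ℝ (fderiv ℝ f) (0, u) (0, c) (0, x u) + A (fderiv ℝ x u c) +
        (j w (fderiv ℝ (fderiv ℝ f) (0, u) (0, c) (0, y u) + A (fderiv ℝ y u c)) +
          (j w (Γ w (A c) (A (y u))) - Γ w (A c) (j w (A (y u))))) := by
    intro c
    have h1 : fderiv ℝ (fun u => fderiv ℝ f (0, u) (1, 0)) u c =
        fderiv ℝ (fderiv ℝ f) (0, u) (0, c) (1, 0) := by
      rw [fderiv_apply_const (differentiableAt_slice hdf), fderiv_slice hdf]
      rfl
    have hAx : ∀ x : F → F, DifferentiableAt ℝ x u →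
        fderiv ℝ (fun u => spatialFrame f (0, u) (x u)) u c =
        fderiv ℝ (fderiv ℝ f) (0, u) (0, c) (0, x u) + A (fderiv ℝ x u c) := by
      intro x hx
      rw [fderiv_clm_apply' hA0 hx, hAc, add_comm]
      rfl
    rw [← h1, Filter.EventuallyEq.fderiv_eq hv, fderiv_fun_add (hA0.clm_apply hx) (hj0.clm_apply (hA0.clm_apply hy)),
      add_apply, hAx x hx, fderiv_clm_apply' hj0 (hA0.clm_apply hy), hAx y hy, hjc]
    rfl
  have key : imPart (j w) A ∘L (fderiv ℝ (spatialFrame f) (0, u) (1, 0) +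
      Γ w (fderiv ℝ f (0, u) (1, 0)) ∘L A) =
      rePart (j w) A ∘L (fderiv ℝ (fderiv ℝ fun u => f (0, u)) u (y u) +
        (2 : ℝ) • ((Γ w).flip (A (y u)) ∘L A) - Γ w (A (y u)) ∘L A) + fderiv ℝ y u +
      imPart (j w) A ∘L (fderiv ℝ (spatialFrame f) (0, u) (0, x u) +
        Γ w (fderiv ℝ f (0, u) (0, x u)) ∘L A) := by
    refine ContinuousLinearMap.ext fun c => ?_
    rw [fderiv_fderiv_slice hf, fderiv_spatialFrame hf, fderiv_spatialFrame hf,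
      fderiv_spatialFrame hf, hv.self_of_nhds]
    change imPart (j w) A (fderiv ℝ (fderiv ℝ f) (0, u) (1, 0) (0, c) +
        Γ w (A (x u) + j w (A (y u))) (A c)) =
      rePart (j w) A (fderiv ℝ (fderiv ℝ f) (0, u) (0, y u) (0, c) +
        (2 : ℝ) • Γ w (A c) (A (y u)) - Γ w (A (y u)) (A c)) + fderiv ℝ y u c +
      imPart (j w) A (fderiv ℝ (fderiv ℝ f) (0, u) (0, x u) (0, c) + Γ w (A (x u)) (A c))
    have ht := htor (A (y u)) (A c)
    rw [sub_eq_iff_eq_add] at ht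
    rw [hsymm (1, 0), hder, map_add (Γ w), add_apply, ht, hsymm (0, y u), hsymm (0, x u)]
    have e : fderiv ℝ (fderiv ℝ f) (0, u) (0, c) (0, x u) + A (fderiv ℝ x u c) +
        (j w (fderiv ℝ (fderiv ℝ f) (0, u) (0, c) (0, y u) + A (fderiv ℝ y u c)) +
          (j w (Γ w (A c) (A (y u))) - Γ w (A c) (j w (A (y u))))) +
        (Γ w (A (x u)) (A c) + (-j w (Γ w (A (y u)) (A c) - Γ w (A c) (A (y u))) +
          Γ w (A c) (j w (A (y u))))) =
        (fderiv ℝ (fderiv ℝ f) (0, u) (0, c) (0, x u) + Γ w (A (x u)) (A c)) +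
        A (fderiv ℝ x u c) + j w (fderiv ℝ (fderiv ℝ f) (0, u) (0, c) (0, y u) +
        (2 : ℝ) • Γ w (A c) (A (y u)) - Γ w (A (y u)) (A c) + A (fderiv ℝ y u c)) := by
      simp only [map_add, map_sub, two_smul]
      abel
    rw [e, map_add (imPart (j w) A), map_add (imPart (j w) A) (_ + _), imPart_map hi,
      imPart_apply_map hi hw.sq.self_of_nhds, map_add (rePart (j w) A) _ (A _), rePart_map hi]
    abel
  unfold frameMaslov
  rw [key, map_add, map_add]
  unfold sliceDiv
  rw [fderiv_slice hfd]
  change _ = -(clmTrace F (rePart (j w) A ∘L (fderiv ℝ (fderiv ℝ fun u => f (0, u)) u (y u) +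
        (2 : ℝ) • ((Γ w).flip (A (y u)) ∘L A) - Γ w (A (y u)) ∘L A)) + clmTrace F (fderiv ℝ y u)) + _
  ring

set_option synthInstance.maxHeartbeats 200000 in
omit [FiniteDimensional ℝ E] in
theorem differentiableAt_sliceDiv {f : F → E} {y : F → F} {u : F}
    (hw : IsParallelComplexAt j Γ (f u)) (hf : ContDiffAt ℝ 3 f u) (hy : ContDiffAt ℝ 2 y u)
    (hi : (realFrame (j (f u)) (fderiv ℝ f u)).IsInvertible) :
    DifferentiableAt ℝ (sliceDiv j Γ f y) u := by
  have hA : ContDiffAt ℝ 2 (fderiv ℝ f) u := hf.fderiv_right (by norm_num)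
  have hfd : DifferentiableAt ℝ f u := hf.differentiableAt (by simp)
  have hAd : DifferentiableAt ℝ (fderiv ℝ f) u := hA.differentiableAt (by simp)
  have hAA : DifferentiableAt ℝ (fderiv ℝ (fderiv ℝ f)) u :=
    (hA.fderiv_right (m := 1) (by norm_num)).differentiableAt (by simp)
  have hyd : DifferentiableAt ℝ y u := hy.differentiableAt (by simp)
  have hdy : DifferentiableAt ℝ (fderiv ℝ y) u :=
    (hy.fderiv_right (m := 1) (by norm_num)).differentiableAt (by simp)
  have hj : ContDiffAt ℝ 2 (fun u => j (f u)) u :=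
    (hw.contDiffAt_end.comp u hf).of_le (by norm_num)
  have hΓ : DifferentiableAt ℝ (fun u => Γ (f u)) u :=
    (hw.contDiffAt_symbol.differentiableAt (by simp)).comp u hfd
  have hS : DifferentiableAt ℝ (fun u => rePart (j (f u)) (fderiv ℝ f u)) u :=
    (differentiableAt_const _).clm_comp
      ((contDiffAt_realCoframe hj hA hi).differentiableAt (by simp))
  have hAy := hAd.clm_apply hyd
  have hflip : DifferentiableAt ℝ (fun u => (Γ (f u)).flip (fderiv ℝ f u (y u))) u :=
    DifferentiableAt.clm_apply
      ((ContinuousLinearMap.flipₗᵢ ℝ E E E).toContinuousLinearEquiv.differentiableAt.comp u hΓ) hAy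
  have h := hS.clm_comp (((hAA.clm_apply hyd).add ((hflip.clm_comp hAd).const_smul (2 : ℝ))).sub
    ((hΓ.clm_apply hAy).clm_comp hAd))
  exact ((clmTrace F).differentiableAt.comp u h).add ((clmTrace F).differentiableAt.comp u hdy)

set_option synthInstance.maxHeartbeats 200000 in
omit [FiniteDimensional ℝ E] in
theorem symbolCurvature_zero_left (w b : E) : symbolCurvature Γ w 0 b = 0 := by
  simp [symbolCurvature]

set_option synthInstance.maxHeartbeats 200000 in
omit [FiniteDimensional ℝ E] in
theorem symbolCurvature_add_left (w a b d : E) :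
    symbolCurvature Γ w (a + b) d = symbolCurvature Γ w a d + symbolCurvature Γ w b d := by
  unfold symbolCurvature
  simp only [map_add, add_apply, add_mul, mul_add]
  abel

/-- The time derivative of the spatial component is the spatial derivative of the time component
plus the curl on `(∂_t, c)`. The former is given by `frameMaslov_velocity`, the latter by
`curl_frameMaslov`. -/
theorem hasDerivAt_frameMaslov {f : ℝ × F → E} {x y : F → F} {u : F}
    (hw : IsParallelComplexAt j Γ (f (0, u)))
    (htor : ∀ᶠ w in nhds (f (0, u)), ∀ a b, Γ w (j w a) b - Γ w b (j w a) =
      -j w (Γ w a b - Γ w b a))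
    (hf : ContDiffAt ℝ 3 f (0, u))
    (hi : (realFrame (j (f (0, u))) (spatialFrame f (0, u))).IsInvertible)
    (hx : ContDiffAt ℝ 2 x u) (hy : ContDiffAt ℝ 2 y u)
    (hv : ∀ᶠ u in nhds u, fderiv ℝ f (0, u) (1, 0) = spatialFrame f (0, u) (x u) +
      j (f (0, u)) (spatialFrame f (0, u) (y u)))
    (hx0 : (∀ᶠ u in nhds u, x u = 0) ∨ ∀ᶠ u in nhds u, ∀ c,
      frameMaslov j Γ (fun u => f (0, u)) (fderiv ℝ fun u => f (0, u)) c u = 0) (c : F) :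
    HasDerivAt (fun t => frameMaslov j Γ (fun u => f (t, u)) (fderiv ℝ fun u => f (t, u)) c u)
      (-fderiv ℝ (sliceDiv j Γ (fun u => f (0, u)) y) u c + 1 / 2 * clmTrace E (j (f (0, u)) *
        symbolCurvature Γ (f (0, u)) (j (f (0, u)) (spatialFrame f (0, u) (y u)))
          (spatialFrame f (0, u) c))) 0 := by
  have hA := contDiffAt_spatialFrame hf
  have hfd : DifferentiableAt ℝ f (0, u) := hf.differentiableAt (by simp)
  have hd := differentiableAt_frameMaslov hw hf hA hi
  have hjf : ContDiffAt ℝ 2 (fun z => j (f z)) (0, u) :=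
    (hw.contDiffAt_end.comp (0, u) hf).of_le (by norm_num)
  have hinv := eventually_isInvertible (contDiffAt_realFrame hjf hA).continuousAt hi
  -- the spatial derivative of the component in the direction of `t`
  have hev : (fun u => frameMaslov j Γ f (spatialFrame f) (1, 0) (0, u)) =ᶠ[nhds u] fun u =>
      -sliceDiv j Γ (fun u => f (0, u)) y u := by
    filter_upwards [eventually_slice (hf.continuousAt.eventually hw.eventually),
      eventually_slice (hf.continuousAt.eventually htor), eventually_slice (hf.eventually (by simp)),
      eventually_slice hinv, hx.eventually (by simp), hy.eventually (by simp), hv.eventually_nhds,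
      (show ∀ᶠ u in nhds u, x u = 0 ∨ ∀ c,
        frameMaslov j Γ (fun u => f (0, u)) (fderiv ℝ fun u => f (0, u)) c u = 0 from
        hx0.elim (fun h => h.mono fun _ => Or.inl) (fun h => h.mono fun _ => Or.inr))]
      with u h1 h2 h3 h4 h5 h6 h7 h8
    rw [frameMaslov_velocity h1 h2 h3 h4 (h5.differentiableAt (by simp))
      (h6.differentiableAt (by simp)) h7, frameMaslov_slice h3]
    rcases h8 with h8 | h8
    · rw [h8, frameMaslov]
      simp
    · rw [h8, add_zero]
  have hspace : fderiv ℝ (frameMaslov j Γ f (spatialFrame f) (1, 0)) (0, u) (0, c) =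
      -fderiv ℝ (sliceDiv j Γ (fun u => f (0, u)) y) u c := by
    have h := fderiv_slice (hd (1, 0))
    rw [hev.fderiv_eq, fderiv_fun_neg] at h
    exact congrArg (fun l => l c) h.symm
  -- the tangential part of the velocity does not contribute curvature
  have htan : clmTrace E (j (f (0, u)) * symbolCurvature Γ (f (0, u))
      (spatialFrame f (0, u) (x u)) (spatialFrame f (0, u) c)) = 0 := by
    rcases hx0 with h | h
    · rw [h.self_of_nhds, map_zero, symbolCurvature_zero_left, mul_zero, map_zero]
    -- The form vanishes on the slice `t = 0` near `u`, so its curl vanishes on spatial directions;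
    -- that curl is half the curvature trace at `A x` and `A c`.
    · have hc := curl_frameMaslov hw hf hA hi (0, x u) (0, c)
      have hz : ∀ a b : F, fderiv ℝ (frameMaslov j Γ f (spatialFrame f) (0, a)) (0, u) (0, b) = 0 := by
        intro a b
        have h1 : (fun u => frameMaslov j Γ f (spatialFrame f) (0, a) (0, u)) =ᶠ[nhds u]
            fun _ => 0 := by
          filter_upwards [h, eventually_slice (hf.eventually (by simp))] with u h1 h2
          rw [frameMaslov_slice h2, h1]
        have h2 := fderiv_slice (hd (0, a))
        rw [h1.fderiv_eq, fderiv_const_apply] at h2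
        exact congrArg (fun l => l b) h2.symm
      rw [hz, hz, sub_zero] at hc
      change 0 = 1 / 2 * clmTrace E (j (f (0, u)) * symbolCurvature Γ (f (0, u))
        (spatialFrame f (0, u) (x u)) (spatialFrame f (0, u) c)) at hc
      linarith
  have hcurl := curl_frameMaslov hw hf hA hi (1, 0) (0, c)
  change _ = 1 / 2 * clmTrace E (j (f (0, u)) * symbolCurvature Γ (f (0, u))
    (fderiv ℝ f (0, u) (1, 0)) (spatialFrame f (0, u) c)) at hcurl
  rw [hv.self_of_nhds, symbolCurvature_add_left, mul_add, map_add, htan, zero_add, hspace, sub_eq_iff_eq_add] at hcurl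
  have h1 : HasDerivAt (fun t : ℝ => (t, u)) ((1 : ℝ), (0 : F)) 0 :=
    (hasDerivAt_id (0 : ℝ)).prodMk (hasDerivAt_const (0 : ℝ) u)
  have h2 := (hd (0, c)).hasFDerivAt.comp_hasDerivAt 0 h1
  rw [hcurl, add_comm] at h2
  refine h2.congr_of_eventuallyEq ?_
  filter_upwards [(Continuous.prodMk_left u).continuousAt.eventually (hf.eventually (by simp))]
    with t ht
  exact (frameMaslov_slice ht c).symm

end Variation

/-! ### The splitting of a totally real subspace -/

section Splitting

variable {W V W' V' : Type*} [AddCommGroup W] [Module ℝ W] [AddCommGroup V] [Module ℝ V]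
  {J : V →ₗ[ℝ] V} {A : W →ₗ[ℝ] V}

theorem splitInv_splitMap (h : Function.Bijective (splitMap J A)) (k : W × W) :
    splitInv J A (splitMap J A k) = k := by
  unfold splitInv
  rw [dif_pos h]
  exact (LinearEquiv.ofBijective (splitMap J A) h).symm_apply_apply k

theorem splitMap_splitInv (h : Function.Bijective (splitMap J A)) (v : V) :
    splitMap J A (splitInv J A v) = v := by
  unfold splitInv
  rw [dif_pos h]
  exact (LinearEquiv.ofBijective (splitMap J A) h).apply_symm_apply v

theorem splitMap_apply (k : W × W) : splitMap J A k = A k.1 + J (A k.2) := rfl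

theorem tangentialPart_J_projJ (h : Function.Bijective (splitMap J A)) (hJ : ∀ v, J (J v) = -v)
    (v : V) : tangentialPart J A (J (projJ J A v)) = -(splitInv J A v).2 := by
  have h1 : J (projJ J A v) = splitMap J A (-(splitInv J A v).2, 0) := by
    rw [splitMap_apply, map_zero, map_zero, add_zero, map_neg]
    exact hJ _
  rw [h1]
  exact congrArg Prod.fst (splitInv_splitMap h _)

/-- If `A a + J A b = 0`, then `A a` lies in `S ∩ JS = 0`, and injectivity of `J` and `A` gives `a =
b = 0`. Surjectivity follows by counting dimensions. -/
theorem bijective_splitMap [FiniteDimensional ℝ W] [FiniteDimensional ℝ V]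
    (hJ : ∀ v, J (J v) = -v) (hA : Function.Injective A)
    (hS : IsTotallyRealSubspace J (LinearMap.range A))
    (hdim : Module.finrank ℝ V = 2 * Module.finrank ℝ W) :
    Function.Bijective (splitMap J A) := by
  have hJi : ∀ v, J v = 0 → v = 0 := by
    intro v hv
    have h := hJ v
    rw [hv, map_zero] at h
    exact neg_eq_zero.1 h.symm
  have hinj : Function.Injective (splitMap J A) := by
    refine (injective_iff_map_eq_zero _).2 fun k hk => ?_
    rw [splitMap_apply] at hk
    have h1 : A k.1 = 0 := by
      refine Submodule.disjoint_def.1 hS _ ⟨k.1, rfl⟩ ?_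
      rw [eq_neg_of_add_eq_zero_left hk, ← map_neg, ← map_neg]
      exact ⟨A (-k.2), ⟨-k.2, rfl⟩, rfl⟩
    rw [h1, zero_add] at hk
    exact Prod.ext (hA (h1.trans (map_zero A).symm)) (hA ((hJi _ hk).trans (map_zero A).symm))
  refine ⟨hinj, (LinearMap.injective_iff_surjective_of_finrank_eq_finrank ?_).1 hinj⟩
  rw [Module.finrank_prod, hdim, two_mul]

/-- Converts the coordinate sums of the definitions, taken in the basis of the chart at the point
itself, into traces on the model space of any other chart. -/
theorem sum_repr_eq_trace {κ : Type*} [Fintype κ] [AddCommGroup W'] [Module ℝ W']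
    (b : Module.Basis κ ℝ W) (Ψ : W ≃ₗ[ℝ] W') (T : W' →ₗ[ℝ] W') (m : κ → W)
    (h : ∀ i, Ψ (m i) = T (Ψ (b i))) : ∑ i, b.repr (m i) i = LinearMap.trace ℝ W' T := by
  classical
  rw [← LinearMap.trace_conj' T Ψ.symm, LinearMap.trace_eq_matrix_trace ℝ b, Matrix.trace]
  refine Finset.sum_congr rfl fun i _ => ?_
  rw [Matrix.diag_apply, LinearMap.toMatrix_apply]
  congr 2
  rw [LinearEquiv.conj_apply_apply, LinearEquiv.symm_symm, ← h, LinearEquiv.symm_apply_apply]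

end Splitting

/-! ### Vector fields in a chart -/

section TangentEquiv

variable {E : Type*} [NormedAddCommGroup E] [NormedSpace ℝ E]
  {M : Type*} [TopologicalSpace M] [ChartedSpace E M] [IsManifold 𝓘(ℝ, E) ∞ M] {x₀ y : M}

/-- `tcoord x₀ y` as a linear equivalence. -/
def tcoordEquiv (hy : y ∈ (chartAt E x₀).source) : TangentSpace 𝓘(ℝ, E) y ≃ₗ[ℝ] E :=
  LinearEquiv.ofBijective (tcoord (E := E) x₀ y).toLinearMap
    ⟨tcoord_injective hy, fun w => ⟨tfield x₀ w y, tcoord_tfield hy w⟩⟩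

theorem tcoordEquiv_apply (hy : y ∈ (chartAt E x₀).source) (v : TangentSpace 𝓘(ℝ, E) y) :
    tcoordEquiv hy v = tcoord x₀ y v := rfl

/-- A vector field in the chart at `x₀`. -/
def chartField (x₀ : M) (X : Π y : M, TangentSpace 𝓘(ℝ, E) y) (u : E) : E :=
  tcoord x₀ ((extChartAt 𝓘(ℝ, E) x₀).symm u) (X ((extChartAt 𝓘(ℝ, E) x₀).symm u))

theorem chartField_chart (hy : y ∈ (chartAt E x₀).source) (X : Π y : M, TangentSpace 𝓘(ℝ, E) y) :
    chartField x₀ X (extChartAt 𝓘(ℝ, E) x₀ y) = tcoord x₀ y (X y) := by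
  have h : ∀ y', y' = y → tcoord x₀ y' (X y') = tcoord x₀ y (X y) := by
    rintro y' rfl
    rfl
  exact h _ (chart_symm_chart hy)

theorem contDiffAt_chartField (hy : y ∈ (chartAt E x₀).source) {X : Π y : M, TangentSpace 𝓘(ℝ, E) y}
    (hX : ContMDiffAt 𝓘(ℝ, E) (𝓘(ℝ, E).prod 𝓘(ℝ, E)) ∞ (fun y => TotalSpace.mk' E y (X y)) y) :
    ContDiffAt ℝ ∞ (chartField x₀ X) (extChartAt 𝓘(ℝ, E) x₀ y) :=
  (contMDiffAt_iff_chart' hy).1 ((contMDiffAt_iff_tcoord hy _).1 hX)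

end TangentEquiv

/-! ### Immersions and their splittings in charts -/

section LocalExpressions

variable {n : ℕ} {L : Type*} [TopologicalSpace L] [ChartedSpace (EuclideanSpace ℝ (Fin n)) L]
  [IsManifold (𝓡 n) ∞ L]
  {M : Type*} [TopologicalSpace M] [ChartedSpace (EuclideanSpace ℝ (Fin (2 * n))) M]
  [IsManifold (𝓡 (2 * n)) ∞ M]

omit [IsManifold (𝓡 n) ∞ L] [IsManifold (𝓡 (2 * n)) ∞ M] in
variable (n) in
/-- A map `L → M` in the charts at `p` and `x₀`. -/
def chartMap (x₀ : M) (p : L) (ι : L → M) (u : EuclideanSpace ℝ (Fin n)) :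
    EuclideanSpace ℝ (Fin (2 * n)) :=
  extChartAt (𝓡 (2 * n)) x₀ (ι ((extChartAt (𝓡 n) p).symm u))

variable {x₀ : M} {p q : L} {ι : L → M}

omit [IsManifold (𝓡 n) ∞ L] [IsManifold (𝓡 (2 * n)) ∞ M] in
theorem chartMap_chart (hq : q ∈ (chartAt (EuclideanSpace ℝ (Fin n)) p).source) :
    chartMap n x₀ p ι (extChartAt (𝓡 n) p q) = extChartAt (𝓡 (2 * n)) x₀ (ι q) := by
  unfold chartMap
  rw [chart_symm_chart hq]

theorem contDiffAt_chartMap (hq : q ∈ (chartAt (EuclideanSpace ℝ (Fin n)) p).source)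
    (hιq : ι q ∈ (chartAt (EuclideanSpace ℝ (Fin (2 * n))) x₀).source)
    (hι : ContMDiffAt (𝓡 n) (𝓡 (2 * n)) ∞ ι q) :
    ContDiffAt ℝ ∞ (chartMap n x₀ p ι) (extChartAt (𝓡 n) p q) :=
  (contMDiffAt_iff_chart' hq).1 ((contMDiffAt_extChartAt' hιq).comp q hι)

theorem tcoord_pushforward (hq : q ∈ (chartAt (EuclideanSpace ℝ (Fin n)) p).source)
    (hιq : ι q ∈ (chartAt (EuclideanSpace ℝ (Fin (2 * n))) x₀).source)
    (hι : ContMDiffAt (𝓡 n) (𝓡 (2 * n)) ∞ ι q) (v : TangentSpace (𝓡 n) q) :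
    tcoord x₀ (ι q) (pushforward (n := n) ι q v) =
      fderiv ℝ (chartMap n x₀ p ι) (extChartAt (𝓡 n) p q) (tcoord p q v) := by
  have hd := hι.mdifferentiableAt (by simp)
  have h : MDifferentiableAt (𝓡 n) 𝓘(ℝ, EuclideanSpace ℝ (Fin (2 * n)))
      (fun q => extChartAt (𝓡 (2 * n)) x₀ (ι q)) q :=
    (mdifferentiableAt_extChartAt' hιq).comp q hd
  exact (tcoord_mfderiv hd hιq v).trans (mvfderiv_eq_fderiv_chart hq h v)

variable {J : Π x : M, TangentSpace (𝓡 (2 * n)) x →L[ℝ] TangentSpace (𝓡 (2 * n)) x}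

omit [IsManifold (𝓡 n) ∞ L] [IsManifold (𝓡 (2 * n)) ∞ M] in
theorem IsTotallyRealImmersion.bijective_splitMap (hι : IsTotallyRealImmersion J ι)
    (hJ : ∀ x v, J x (J x v) = -v) (q : L) :
    Function.Bijective (splitMap (J (ι q)).toLinearMap (pushforward (n := n) ι q)) := by
  have : FiniteDimensional ℝ (TangentSpace (𝓡 (2 * n)) (ι q)) :=
    inferInstanceAs (FiniteDimensional ℝ (EuclideanSpace ℝ (Fin (2 * n))))
  have : FiniteDimensional ℝ (TangentSpace (𝓡 n) q) :=
    inferInstanceAs (FiniteDimensional ℝ (EuclideanSpace ℝ (Fin n)))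
  refine _root_.bijective_splitMap (hJ (ι q)) (hι.immersion q) (hι.totallyReal q) ?_
  change Module.finrank ℝ (EuclideanSpace ℝ (Fin (2 * n))) =
    2 * Module.finrank ℝ (EuclideanSpace ℝ (Fin n))
  rw [finrank_euclideanSpace_fin, finrank_euclideanSpace_fin]

section Point

variable (hq : q ∈ (chartAt (EuclideanSpace ℝ (Fin n)) p).source)
  (hιq : ι q ∈ (chartAt (EuclideanSpace ℝ (Fin (2 * n))) x₀).source)
  (hι : IsTotallyRealImmersion J ι) (hJ : ∀ x v, J x (J x v) = -v)
include hq hιq hι hJ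

omit hJ in
theorem realFrame_tcoord (k : TangentSpace (𝓡 n) q × TangentSpace (𝓡 n) q) :
    realFrame (chartEnd J x₀ (chartMap n x₀ p ι (extChartAt (𝓡 n) p q)))
      (fderiv ℝ (chartMap n x₀ p ι) (extChartAt (𝓡 n) p q)) (tcoord p q k.1, tcoord p q k.2) =
    tcoord x₀ (ι q) (splitMap (J (ι q)).toLinearMap (pushforward (n := n) ι q) k) := by
  rw [realFrame_apply, ← tcoord_pushforward hq hιq (hι.contMDiff q),
    ← tcoord_pushforward hq hιq (hι.contMDiff q), chartMap_chart hq, chartEnd_tcoord J hιq,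
    splitMap_apply, map_add]
  rfl

/-- The local frame is `splitMap` conjugated by the coordinate isomorphisms, so it inherits
bijectivity; in finite dimension this gives a continuous inverse. -/
theorem isInvertible_realFrame :
    (realFrame (chartEnd J x₀ (chartMap n x₀ p ι (extChartAt (𝓡 n) p q)))
      (fderiv ℝ (chartMap n x₀ p ι) (extChartAt (𝓡 n) p q))).IsInvertible := by
  have hb := hι.bijective_splitMap hJ q
  have hbij : Function.Bijective
      (realFrame (chartEnd J x₀ (chartMap n x₀ p ι (extChartAt (𝓡 n) p q)))
      (fderiv ℝ (chartMap n x₀ p ι) (extChartAt (𝓡 n) p q))) := by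
    have h : ⇑(realFrame (chartEnd J x₀ (chartMap n x₀ p ι (extChartAt (𝓡 n) p q)))
        (fderiv ℝ (chartMap n x₀ p ι) (extChartAt (𝓡 n) p q))) =
        tcoordEquiv hιq ∘ splitMap (J (ι q)).toLinearMap (pushforward (n := n) ι q) ∘
          ((tcoordEquiv hq).prodCongr (tcoordEquiv hq)).symm := by
      funext k
      have h := realFrame_tcoord hq hιq hι
        (((tcoordEquiv hq).prodCongr (tcoordEquiv hq)).symm k)
      refine Eq.trans ?_ h
      congr 1
      exact (((tcoordEquiv hq).prodCongr (tcoordEquiv hq)).apply_symm_apply k).symm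
    rw [h]
    exact (tcoordEquiv hιq).bijective.comp
      (hb.comp ((tcoordEquiv hq).prodCongr (tcoordEquiv hq)).symm.bijective)
  exact ⟨(LinearEquiv.ofBijective _ hbij).toContinuousLinearEquiv, rfl⟩

theorem realCoframe_tcoord (v : TangentSpace (𝓡 (2 * n)) (ι q)) :
    realCoframe (chartEnd J x₀ (chartMap n x₀ p ι (extChartAt (𝓡 n) p q)))
      (fderiv ℝ (chartMap n x₀ p ι) (extChartAt (𝓡 n) p q)) (tcoord x₀ (ι q) v) =
      (tcoord p q (splitInv (J (ι q)).toLinearMap (pushforward (n := n) ι q) v).1,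
        tcoord p q (splitInv (J (ι q)).toLinearMap (pushforward (n := n) ι q) v).2) := by
  have hb := hι.bijective_splitMap hJ q
  conv_lhs => rw [← splitMap_splitInv hb v, ← realFrame_tcoord hq hιq hι]
  exact realCoframe_realFrame (isInvertible_realFrame hq hιq hι hJ) _

end Point

variable (cov : CovariantDerivative (𝓡 (2 * n)) (EuclideanSpace ℝ (Fin (2 * n)))
      (TangentSpace (𝓡 (2 * n)) : M → Type _))

omit [IsManifold (𝓡 n) ∞ L] in
theorem chartChristoffel_chartMap (hq : q ∈ (chartAt (EuclideanSpace ℝ (Fin n)) p).source)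
    (hιq : ι q ∈ (chartAt (EuclideanSpace ℝ (Fin (2 * n))) x₀).source) :
    chartChristoffel cov x₀ (chartMap n x₀ p ι (extChartAt (𝓡 n) p q)) =
      christoffel cov x₀ (ι q) := by
  rw [chartMap_chart hq, chartChristoffel, chart_symm_chart hιq]

theorem tcoord_covAlong_pushforward (hq : q ∈ (chartAt (EuclideanSpace ℝ (Fin n)) p).source)
    (hιq : ι q ∈ (chartAt (EuclideanSpace ℝ (Fin (2 * n))) x₀).source)
    (hι : ContMDiff (𝓡 n) (𝓡 (2 * n)) ∞ ι) {W : Π q : L, TangentSpace (𝓡 n) q}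
    (hW : ContMDiffAt (𝓡 n) ((𝓡 n).prod 𝓘(ℝ, EuclideanSpace ℝ (Fin n))) ∞
      (fun p => TotalSpace.mk' (EuclideanSpace ℝ (Fin n)) p (W p)) q)
    (X : TangentSpace (𝓡 n) q) :
    tcoord x₀ (ι q) (covAlong cov ι (fun q => pushforward (n := n) ι q (W q)) q X) =
      fderiv ℝ (fderiv ℝ (chartMap n x₀ p ι)) (extChartAt (𝓡 n) p q) (tcoord p q X)
        (tcoord p q (W q)) +
      fderiv ℝ (chartMap n x₀ p ι) (extChartAt (𝓡 n) p q)
        (fderiv ℝ (chartField p W) (extChartAt (𝓡 n) p q) (tcoord p q X)) +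
      chartChristoffel cov x₀ (chartMap n x₀ p ι (extChartAt (𝓡 n) p q))
        (fderiv ℝ (chartMap n x₀ p ι) (extChartAt (𝓡 n) p q) (tcoord p q X))
        (fderiv ℝ (chartMap n x₀ p ι) (extChartAt (𝓡 n) p q) (tcoord p q (W q))) := by
  have hf := contDiffAt_chartMap hq hιq (hι q)
  have hA : DifferentiableAt ℝ (fderiv ℝ (chartMap n x₀ p ι)) (extChartAt (𝓡 n) p q) :=
    ((hf.of_le (ENat.LEInfty.out : (2 : WithTop ℕ∞) ≤ ∞)).fderiv_right (m := 1) (by norm_num)).differentiableAt (by simp)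
  have hw : DifferentiableAt ℝ (chartField p W) (extChartAt (𝓡 n) p q) :=
    (contDiffAt_chartField hq hW).differentiableAt (by simp)
  have hev : (fun q => tcoord x₀ (ι q) (pushforward (n := n) ι q (W q))) =ᶠ[nhds q]
      fun q => fderiv ℝ (chartMap n x₀ p ι) (extChartAt (𝓡 n) p q)
        (chartField p W (extChartAt (𝓡 n) p q)) := by
    filter_upwards [(chartAt (EuclideanSpace ℝ (Fin n)) p).open_source.mem_nhds hq,
      (hι q).continuousAt.preimage_mem_nhds
        ((chartAt (EuclideanSpace ℝ (Fin (2 * n))) x₀).open_source.mem_nhds hιq)] with q h1 h2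
    rw [tcoord_pushforward h1 h2 (hι q), chartField_chart h1]
  have hcomp := (hA.clm_apply hw)
  have hev2 : (fun u => fderiv ℝ (chartMap n x₀ p ι)
      (extChartAt (𝓡 n) p ((extChartAt (𝓡 n) p).symm u))
        (chartField p W (extChartAt (𝓡 n) p ((extChartAt (𝓡 n) p).symm u))))
      =ᶠ[nhds (extChartAt (𝓡 n) p q)]
      fun u => fderiv ℝ (chartMap n x₀ p ι) u (chartField p W u) := by
    filter_upwards [(isOpen_extChartAt_target p).mem_nhds (chart_mem_target hq)] with u hu
    rw [(extChartAt (𝓡 n) p).right_inv hu]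
  have hM : MDifferentiableAt (𝓡 n) 𝓘(ℝ, EuclideanSpace ℝ (Fin (2 * n)))
      (fun q => fderiv ℝ (chartMap n x₀ p ι) (extChartAt (𝓡 n) p q)
        (chartField p W (extChartAt (𝓡 n) p q))) q :=
    (mdifferentiableAt_iff_chart hq).2 (hcomp.congr_of_eventuallyEq hev2)
  rw [tcoord_covAlong cov ((hι q).mdifferentiableAt (by simp)) hιq
    (hM.congr_of_eventuallyEq hev), mvfderiv_congr_eventually hev, mvfderiv_eq_fderiv_chart hq hM,
    hev2.fderiv_eq, fderiv_clm_apply' hA hw, chartField_chart hq, chartChristoffel_chartMap cov hq hιq,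
    tcoord_pushforward hq hιq (hι q)]
  rw [show mfderiv (𝓡 n) (𝓡 (2 * n)) ι q X = pushforward (n := n) ι q X from rfl,
    tcoord_pushforward hq hιq (hι q), add_comm (fderiv ℝ (chartMap n x₀ p ι) _ _)]

end LocalExpressions

/-! ### The Maslov form, torsion trace and tangential divergence in charts -/

section LocalTraces

theorem trace_eq_of_intertwines {W W' : Type*} [AddCommGroup W] [Module ℝ W] [AddCommGroup W']
    [Module ℝ W'] (Ψ : W ≃ₗ[ℝ] W') {N : W →ₗ[ℝ] W} {T : W' →ₗ[ℝ] W'}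
    (h : ∀ v, Ψ (N v) = T (Ψ v)) : LinearMap.trace ℝ W N = LinearMap.trace ℝ W' T := by
  rw [← LinearMap.trace_conj' N Ψ]
  congr 1
  ext w
  rw [LinearEquiv.conj_apply_apply, h, LinearEquiv.apply_symm_apply]

theorem contMDiffAt_extend {E M : Type*} [NormedAddCommGroup E] [NormedSpace ℝ E]
    [TopologicalSpace M] [ChartedSpace E M] [IsManifold 𝓘(ℝ, E) ∞ M] {x : M}
    (v : TangentSpace 𝓘(ℝ, E) x) : ContMDiffAt 𝓘(ℝ, E) (𝓘(ℝ, E).prod 𝓘(ℝ, E)) ∞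
      (fun y => TotalSpace.mk' E y (FiberBundle.extend E v y)) x := by
  rw [extend_eq_tfield]
  exact contMDiffAt_tfield (mem_chart_source E x) _

theorem extend_self {E M : Type*} [NormedAddCommGroup E] [NormedSpace ℝ E]
    [TopologicalSpace M] [ChartedSpace E M] [IsManifold 𝓘(ℝ, E) ∞ M] {x : M}
    (v : TangentSpace 𝓘(ℝ, E) x) : (FiberBundle.extend E v : Π _ : M, _) x = v := by
  rw [extend_eq_tfield, tfield_tcoord (mem_chart_source E x)]

variable {n : ℕ} {L : Type*} [TopologicalSpace L] [ChartedSpace (EuclideanSpace ℝ (Fin n)) L]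
  [IsManifold (𝓡 n) ∞ L]
  {M : Type*} [TopologicalSpace M] [ChartedSpace (EuclideanSpace ℝ (Fin (2 * n))) M]
  [IsManifold (𝓡 (2 * n)) ∞ M]
  {J : Π x : M, TangentSpace (𝓡 (2 * n)) x →L[ℝ] TangentSpace (𝓡 (2 * n)) x}
  {cov : CovariantDerivative (𝓡 (2 * n)) (EuclideanSpace ℝ (Fin (2 * n)))
      (TangentSpace (𝓡 (2 * n)) : M → Type _)} {x₀ : M} {p q : L} {ι : L → M}

section Point

variable (hq : q ∈ (chartAt (EuclideanSpace ℝ (Fin n)) p).source)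
  (hιq : ι q ∈ (chartAt (EuclideanSpace ℝ (Fin (2 * n))) x₀).source)
  (hι : IsTotallyRealImmersion J ι) (hJ : ∀ x v, J x (J x v) = -v)
include hq hιq hι hJ

theorem tcoord_tangentialPart (v : TangentSpace (𝓡 (2 * n)) (ι q)) :
    tcoord p q (tangentialPart (J (ι q)).toLinearMap (pushforward (n := n) ι q) v) =
      rePart (chartEnd J x₀ (chartMap n x₀ p ι (extChartAt (𝓡 n) p q)))
        (fderiv ℝ (chartMap n x₀ p ι) (extChartAt (𝓡 n) p q)) (tcoord x₀ (ι q) v) :=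
  (congrArg Prod.fst (realCoframe_tcoord hq hιq hι hJ v)).symm

/-- The definition differentiates the frame of the chart at `q`, the right-hand side that of a fixed
chart at `p`. The two derivatives differ by `A` applied to the derivative of the components. This
vector is tangential, has no imaginary part, and so drops out of the trace. -/
theorem maslovForm_eq_frameMaslov (X : TangentSpace (𝓡 n) q) :
    maslovForm J cov ι q X = frameMaslov (chartEnd J x₀) (chartChristoffel cov x₀)
      (chartMap n x₀ p ι) (fderiv ℝ (chartMap n x₀ p ι)) (tcoord p q X) (extChartAt (𝓡 n) p q) := by
  have hi := isInvertible_realFrame hq hιq hι hJ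
  have hc := fun v => realCoframe_tcoord hq hιq hι hJ v
  have hcov := fun i => tcoord_covAlong_pushforward cov hq hιq hι.contMDiff (W := coordField q i)
    (contMDiffAt_extend _) X
  unfold maslovForm frameMaslov
  set f := chartMap n x₀ p ι
  set A := fderiv ℝ f (extChartAt (𝓡 n) p q)
  set w := f (extChartAt (𝓡 n) p q)
  set S := imPart (chartEnd J x₀ w) A
  rw [← map_neg, clmTrace_apply]
  refine sum_repr_eq_trace (coordBasis q) (tcoordEquiv hq) _ _ fun i => ?_
  have h := congrArg Prod.snd (hc (covAlong cov ι
    (fun q' => pushforward (n := n) ι q' (coordField q i q')) q X))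
  have h2 : coordField q i q = coordBasis q i := extend_self _
  rw [hcov i, h2] at h
  refine (congrArg (tcoordEquiv hq)
    (tangentialPart_J_projJ (hι.bijective_splitMap hJ q) (hJ (ι q)) _)).trans ?_
  rw [map_neg]
  refine (congrArg Neg.neg h.symm).trans ?_
  set b := tcoord p q (coordBasis q i)
  set D := fderiv ℝ (fderiv ℝ f) (extChartAt (𝓡 n) p q) (tcoord p q X)
  have h3 : S (D b + A (fderiv ℝ (chartField p (coordField q i)) (extChartAt (𝓡 n) p q)
      (tcoord p q X)) + chartChristoffel cov x₀ w (A (tcoord p q X)) (A b)) =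
      S (D b + chartChristoffel cov x₀ w (A (tcoord p q X)) (A b)) := by
    rw [map_add, map_add S, imPart_map hi, add_zero, ← map_add]
  exact congrArg Neg.neg h3

end Point

theorem torsionTrace_eq_clmTrace (hq : q ∈ (chartAt (EuclideanSpace ℝ (Fin n)) p).source)
    (hιq : ι q ∈ (chartAt (EuclideanSpace ℝ (Fin (2 * n))) x₀).source)
    (hι : IsTotallyRealImmersion J ι) (hJ : ∀ x v, J x (J x v) = -v) (Y : TangentSpace (𝓡 n) q) :
    torsionTrace J cov ι q Y =
      clmTrace _ (rePart (chartEnd J x₀ (chartMap n x₀ p ι (extChartAt (𝓡 n) p q)))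
        (fderiv ℝ (chartMap n x₀ p ι) (extChartAt (𝓡 n) p q)) ∘L
        (chartChristoffel cov x₀ (chartMap n x₀ p ι (extChartAt (𝓡 n) p q))
          (fderiv ℝ (chartMap n x₀ p ι) (extChartAt (𝓡 n) p q) (tcoord p q Y)) ∘L
            fderiv ℝ (chartMap n x₀ p ι) (extChartAt (𝓡 n) p q) -
          (chartChristoffel cov x₀ (chartMap n x₀ p ι (extChartAt (𝓡 n) p q))).flip
            (fderiv ℝ (chartMap n x₀ p ι) (extChartAt (𝓡 n) p q) (tcoord p q Y)) ∘L
            fderiv ℝ (chartMap n x₀ p ι) (extChartAt (𝓡 n) p q))) := by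
  unfold torsionTrace
  rw [clmTrace_apply]
  refine trace_eq_of_intertwines (tcoordEquiv hq) fun v => ?_
  refine (tcoord_tangentialPart hq hιq hι hJ _).trans ?_
  change rePart _ _ (tcoord x₀ (ι q) (cov.torsion (ι q) (pushforward (n := n) ι q Y)
    (pushforward (n := n) ι q v))) = _
  rw [tcoord_torsion cov hιq, tcoord_pushforward hq hιq (hι.contMDiff q),
    tcoord_pushforward hq hιq (hι.contMDiff q), ← chartChristoffel_chartMap cov hq hιq]
  rfl

variable (J cov) in
/-- `tr (v ↦ π_L ∇_v Y) - tr (v ↦ π_L T(Y, v))` for a vector field `Y` on `L`. -/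
def tangentialDiv (ι : L → M) (Y : Π q : L, TangentSpace (𝓡 n) q) (q : L) : ℝ :=
  ∑ i, (coordBasis q).repr (tangentialPart (J (ι q)).toLinearMap (pushforward (n := n) ι q)
    (covAlong cov ι (fun q' => pushforward (n := n) ι q' (Y q')) q (coordBasis q i))) i -
  torsionTrace J cov ι q (Y q)

/-- Subtracting the torsion `Γ(Ay)(Ac) - Γ(Ac)(Ay)` from the Christoffel term `Γ(Ac)(Ay)` of `∇_c Y`
produces the combination with coefficients `2` and `-1` in `sliceDiv`. The derivative of the
components of `Y` is tangential and gives `tr Dy`. -/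
theorem tangentialDiv_eq_sliceDiv (hq : q ∈ (chartAt (EuclideanSpace ℝ (Fin n)) p).source)
    (hιq : ι q ∈ (chartAt (EuclideanSpace ℝ (Fin (2 * n))) x₀).source)
    (hι : IsTotallyRealImmersion J ι) (hJ : ∀ x v, J x (J x v) = -v)
    {Y : Π q : L, TangentSpace (𝓡 n) q}
    (hY : ContMDiffAt (𝓡 n) ((𝓡 n).prod 𝓘(ℝ, EuclideanSpace ℝ (Fin n))) ∞
      (fun p => TotalSpace.mk' (EuclideanSpace ℝ (Fin n)) p (Y p)) q) :
    tangentialDiv J cov ι Y q = sliceDiv (chartEnd J x₀) (chartChristoffel cov x₀)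
      (chartMap n x₀ p ι) (chartField p Y) (extChartAt (𝓡 n) p q) := by
  have hi := isInvertible_realFrame hq hιq hι hJ
  have hf := contDiffAt_chartMap hq hιq (hι.contMDiff q)
  have hsymm : ∀ a b, fderiv ℝ (fderiv ℝ (chartMap n x₀ p ι)) (extChartAt (𝓡 n) p q) a b =
      fderiv ℝ (fderiv ℝ (chartMap n x₀ p ι)) (extChartAt (𝓡 n) p q) b a :=
    ((hf.of_le (ENat.LEInfty.out : (2 : WithTop ℕ∞) ≤ ∞)).isSymmSndFDerivAt (by simp)).eq
  set A := fderiv ℝ (chartMap n x₀ p ι) (extChartAt (𝓡 n) p q) with hA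
  set w := chartMap n x₀ p ι (extChartAt (𝓡 n) p q) with hw
  set Γ := chartChristoffel cov x₀ w with hΓ
  set y := tcoord p q (Y q) with hy
  set S := rePart (chartEnd J x₀ w) A with hS
  have h1 : ∑ i, (coordBasis q).repr (tangentialPart (J (ι q)).toLinearMap
      (pushforward (n := n) ι q) (covAlong cov ι (fun q' => pushforward (n := n) ι q' (Y q')) q
        (coordBasis q i))) i =
      clmTrace _ (S ∘L (fderiv ℝ (fderiv ℝ (chartMap n x₀ p ι)) (extChartAt (𝓡 n) p q) y +
        Γ.flip (A y) ∘L A) + fderiv ℝ (chartField p Y) (extChartAt (𝓡 n) p q)) := by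
    rw [clmTrace_apply]
    refine sum_repr_eq_trace (coordBasis q) (tcoordEquiv hq) _ _ fun i => ?_
    refine (tcoord_tangentialPart hq hιq hι hJ _).trans ?_
    rw [tcoord_covAlong_pushforward cov hq hιq hι.contMDiff hY, hsymm, map_add, map_add,
      rePart_map hi, add_right_comm, ← map_add]
    rfl
  have h2 : torsionTrace J cov ι q (Y q) = clmTrace _ (S ∘L (Γ (A y) ∘L A - Γ.flip (A y) ∘L A)) :=
    torsionTrace_eq_clmTrace hq hιq hι hJ (Y q)
  unfold tangentialDiv sliceDiv
  rw [h1, h2, chartField_chart hq, ← map_sub, ← map_add]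
  congr 1
  refine ContinuousLinearMap.ext fun c => ?_
  change S (fderiv ℝ (fderiv ℝ (chartMap n x₀ p ι)) (extChartAt (𝓡 n) p q) y c + Γ (A c) (A y)) +
    fderiv ℝ (chartField p Y) (extChartAt (𝓡 n) p q) c - S (Γ (A y) (A c) - Γ (A c) (A y)) =
    S (fderiv ℝ (fderiv ℝ (chartMap n x₀ p ι)) (extChartAt (𝓡 n) p q) y c +
      (2 : ℝ) • Γ (A c) (A y) - Γ (A y) (A c)) +
    fderiv ℝ (chartField p Y) (extChartAt (𝓡 n) p q) c
  simp only [map_add, map_sub, two_smul]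
  abel

end LocalTraces

/-! ### Chart form of the hypotheses and of the Ricci form -/

section ChartStructures

variable {E : Type*} [NormedAddCommGroup E] [NormedSpace ℝ E] [FiniteDimensional ℝ E]
  {M : Type*} [TopologicalSpace M] [ChartedSpace E M] [IsManifold 𝓘(ℝ, E) ∞ M]
  {J : Π x : M, TangentSpace 𝓘(ℝ, E) x →L[ℝ] TangentSpace 𝓘(ℝ, E) x}
  {cov : CovariantDerivative 𝓘(ℝ, E) E (TangentSpace 𝓘(ℝ, E) : M → Type _)}

omit [FiniteDimensional ℝ E] in
theorem chartEnd_sq (hJ : ∀ x v, J x (J x v) = -v) {x₀ : M} {u : E}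
    (hu : u ∈ (extChartAt 𝓘(ℝ, E) x₀).target) (w : E) :
    chartEnd J x₀ u (chartEnd J x₀ u w) = -w := by
  have hy := mem_source_of_mem_target hu
  have hr := (extChartAt 𝓘(ℝ, E) x₀).right_inv hu
  have h := fun v => chartEnd_tcoord J hy v
  rw [hr] at h
  rw [← tcoord_tfield hy w, h, h, hJ, map_neg]

theorem isParallelComplexAt_chart [T2Space M] (hJ : ∀ x v, J x (J x v) = -v)
    (hJs : ContMDiff 𝓘(ℝ, E) (𝓘(ℝ, E).prod 𝓘(ℝ, E →L[ℝ] E)) ∞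
    (fun x => TotalSpace.mk' (E →L[ℝ] E)
      (E := fun x : M => TangentSpace 𝓘(ℝ, E) x →L[ℝ] TangentSpace 𝓘(ℝ, E) x) x (J x)))
    (hcov : CovariantDerivative.ContMDiffCovariantDerivative cov ∞)
    (hp : ∀ (σ : Π x : M, TangentSpace 𝓘(ℝ, E) x) (x : M),
    MDifferentiableAt 𝓘(ℝ, E) (𝓘(ℝ, E).prod 𝓘(ℝ, E)) (fun y => TotalSpace.mk' E y (σ y)) x →
      ∀ v : TangentSpace 𝓘(ℝ, E) x, cov (fun y => J y (σ y)) x v = J x (cov σ x v)) (x₀ : M) :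
    IsParallelComplexAt (chartEnd J x₀) (chartChristoffel cov x₀) (extChartAt 𝓘(ℝ, E) x₀ x₀) := by
  have ht := (isOpen_extChartAt_target (I := 𝓘(ℝ, E)) x₀).mem_nhds
    (chart_mem_target (mem_chart_source E x₀))
  refine ⟨((contDiffOn_chartEnd J hJs).contDiffAt ht).of_le ENat.LEInfty.out,
    (contDiffAt_chartChristoffel cov hcov).of_le ENat.LEInfty.out, ?_, ?_⟩
  · filter_upwards [ht] with u hu using chartEnd_sq hJ hu
  · filter_upwards [ht] with u hu using fderiv_chartEnd J cov hJs hp hu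

theorem chartChristoffel_antilinear (ht : ∀ x u v, cov.torsion x (J x u) v = -J x (cov.torsion x u v))
    {x₀ : M} {u : E} (hu : u ∈ (extChartAt 𝓘(ℝ, E) x₀).target) (a b : E) :
    chartChristoffel cov x₀ u (chartEnd J x₀ u a) b - chartChristoffel cov x₀ u b (chartEnd J x₀ u a)
      = -chartEnd J x₀ u (chartChristoffel cov x₀ u a b - chartChristoffel cov x₀ u b a) := by
  have hy := mem_source_of_mem_target hu
  have hr := (extChartAt 𝓘(ℝ, E) x₀).right_inv hu
  have h := fun v => chartEnd_tcoord J hy v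
  rw [hr] at h
  have h2 := congrArg (tcoord x₀ ((extChartAt 𝓘(ℝ, E) x₀).symm u))
    (ht _ (tfield x₀ a ((extChartAt 𝓘(ℝ, E) x₀).symm u))
      (tfield x₀ b ((extChartAt 𝓘(ℝ, E) x₀).symm u)))
  rw [tcoord_torsion cov hy, map_neg, ← h, ← h, tcoord_torsion cov hy, tcoord_tfield hy,
    tcoord_tfield hy] at h2
  exact h2

theorem sum_inner_eq_trace {κ V W : Type*} [Fintype κ] [NormedAddCommGroup V]
    [InnerProductSpace ℝ V] [AddCommGroup W] [Module ℝ W] (b : OrthonormalBasis κ ℝ V)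
    (Ψ : V ≃ₗ[ℝ] W) (T : W →ₗ[ℝ] W) (m : κ → V) (h : ∀ i, Ψ (m i) = T (Ψ (b i))) :
    ∑ i, (inner ℝ (m i) (b i) : ℝ) = LinearMap.trace ℝ W T := by
  rw [← sum_repr_eq_trace b.toBasis Ψ T m (by simpa using h)]
  refine Finset.sum_congr rfl fun i _ => ?_
  rw [OrthonormalBasis.coe_toBasis_repr_apply, OrthonormalBasis.repr_apply_apply, real_inner_comm]

/-- Since `ω(R e, e) = g(J R e, e)`, the sum over an orthonormal basis is the trace of `J R`, which
does not involve the metric. -/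
theorem chernRicciForm_eq_clmTrace [T2Space M] [RiemannianBundle (fun x : M => TangentSpace 𝓘(ℝ, E) x)]
    (hcov : CovariantDerivative.ContMDiffCovariantDerivative cov ∞) (x : M)
    (u v : TangentSpace 𝓘(ℝ, E) x) :
    chernRicciForm 𝓘(ℝ, E) J cov x u v = clmTrace E (chartEnd J x (extChartAt 𝓘(ℝ, E) x x) *
      symbolCurvature (chartChristoffel cov x) (extChartAt 𝓘(ℝ, E) x x)
        (tcoord x x u) (tcoord x x v)) := by
  have hx := mem_chart_source E x
  have : FiniteDimensional ℝ (TangentSpace 𝓘(ℝ, E) x) := inferInstanceAs (FiniteDimensional ℝ E)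
  rw [clmTrace_apply]
  refine sum_inner_eq_trace (stdOrthonormalBasis ℝ (TangentSpace 𝓘(ℝ, E) x)) (tcoordEquiv hx) _ _
    fun i => ?_
  refine (chartEnd_tcoord J hx _).symm.trans ?_
  exact congrArg (chartEnd J x (extChartAt 𝓘(ℝ, E) x x)) (curvature_eq cov hcov u v _)

end ChartStructures

/-! ### Families of maps in charts -/

section Variation

variable {n : ℕ} {L : Type*} [TopologicalSpace L] [ChartedSpace (EuclideanSpace ℝ (Fin n)) L]
  [IsManifold (𝓡 n) ∞ L]
  {M : Type*} [TopologicalSpace M] [ChartedSpace (EuclideanSpace ℝ (Fin (2 * n))) M]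
  [IsManifold (𝓡 (2 * n)) ∞ M]

/-- A family of maps `L → M` in the charts at `p` and `x₀`. -/
def chartFamily (x₀ : M) (p : L) (φ : ℝ → L → M) (z : ℝ × EuclideanSpace ℝ (Fin n)) :
    EuclideanSpace ℝ (Fin (2 * n)) :=
  chartMap n x₀ p (φ z.1) z.2

variable {φ : ℝ → L → M} {x₀ : M} {p q : L}

theorem contDiffAt_chartFamily (hq : q ∈ (chartAt (EuclideanSpace ℝ (Fin n)) p).source) {t : ℝ}
    (hφq : φ t q ∈ (chartAt (EuclideanSpace ℝ (Fin (2 * n))) x₀).source)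
    (hφ : ContMDiffAt (𝓘(ℝ, ℝ).prod (𝓡 n)) (𝓡 (2 * n)) ∞ (fun z : ℝ × L => φ z.1 z.2) (t, q)) :
    ContDiffAt ℝ ∞ (chartFamily x₀ p φ) (t, extChartAt (𝓡 n) p q) := by
  rw [← contMDiffAt_iff_contDiffAt]
  have h1 : ContMDiffAt 𝓘(ℝ, ℝ × EuclideanSpace ℝ (Fin n)) (𝓘(ℝ, ℝ).prod (𝓡 n)) ∞
      (fun z : ℝ × EuclideanSpace ℝ (Fin n) => (z.1, (extChartAt (𝓡 n) p).symm z.2))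
      (t, extChartAt (𝓡 n) p q) :=
    contDiff_fst.contMDiff.contMDiffAt.prodMk
      (ContMDiffAt.comp _ (contMDiffAt_chart_symm hq) contDiff_snd.contMDiff.contMDiffAt)
  have h2 : (extChartAt (𝓡 n) p).symm (extChartAt (𝓡 n) p q) = q := chart_symm_chart hq
  have h3 : ContMDiffAt 𝓘(ℝ, ℝ × EuclideanSpace ℝ (Fin n)) (𝓡 (2 * n)) ∞
      (fun z : ℝ × EuclideanSpace ℝ (Fin n) => φ z.1 ((extChartAt (𝓡 n) p).symm z.2))
      (t, extChartAt (𝓡 n) p q) :=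
    ContMDiffAt.comp_of_eq hφ h1 (by rw [h2])
  exact ContMDiffAt.comp_of_eq (contMDiffAt_extChartAt' hφq) h3 (by simp only [h2])

theorem fderiv_chartFamily_time (hq : q ∈ (chartAt (EuclideanSpace ℝ (Fin n)) p).source) {t : ℝ}
    (hφq : φ t q ∈ (chartAt (EuclideanSpace ℝ (Fin (2 * n))) x₀).source)
    (hφ : ContMDiffAt (𝓘(ℝ, ℝ).prod (𝓡 n)) (𝓡 (2 * n)) ∞ (fun z : ℝ × L => φ z.1 z.2) (t, q)) :
    fderiv ℝ (chartFamily x₀ p φ) (t, extChartAt (𝓡 n) p q) (1, 0) =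
      tcoord x₀ (φ t q) (mfderiv 𝓘(ℝ, ℝ) (𝓡 (2 * n)) (fun t => φ t q) t (1 : ℝ)) := by
  have hd : MDifferentiableAt 𝓘(ℝ, ℝ) (𝓡 (2 * n)) (fun t => φ t q) t :=
    (ContMDiffAt.comp (f := fun t : ℝ => (t, q)) t hφ
      (contMDiffAt_id.prodMk contMDiffAt_const)).mdifferentiableAt (by simp)
  have hf := (contDiffAt_chartFamily hq hφq hφ).differentiableAt (by simp)
  have h1 : HasDerivAt (fun t : ℝ => (t, extChartAt (𝓡 n) p q))
      ((1 : ℝ), (0 : EuclideanSpace ℝ (Fin n))) t :=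
    (hasDerivAt_id t).prodMk (hasDerivAt_const t _)
  have h2 := hf.hasFDerivAt.comp_hasDerivAt t h1
  have h3 := tcoord_mfderiv (x₀ := x₀) hd hφq (1 : ℝ)
  rw [h3, ← h2.deriv]
  have h4 : (chartFamily x₀ p φ ∘ fun t => (t, extChartAt (𝓡 n) p q)) =
      fun t => extChartAt (𝓡 (2 * n)) x₀ (φ t q) := by
    funext t
    exact chartMap_chart hq
  rw [h4]
  exact congrArg (fun l : ℝ →L[ℝ] EuclideanSpace ℝ (Fin (2 * n)) => l 1)
    (mfderiv_eq_fderiv (f := fun t => extChartAt (𝓡 (2 * n)) x₀ (φ t q)) (x := t)).symm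

end Variation

/-! ### The variation formula on the manifold -/

section GeneralVariation

variable {n : ℕ} {L : Type*} [TopologicalSpace L] [ChartedSpace (EuclideanSpace ℝ (Fin n)) L]
  [IsManifold (𝓡 n) ∞ L]
  {M : Type*} [TopologicalSpace M] [T2Space M] [ChartedSpace (EuclideanSpace ℝ (Fin (2 * n))) M]
  [IsManifold (𝓡 (2 * n)) ∞ M] [RiemannianBundle (fun x : M => TangentSpace (𝓡 (2 * n)) x)]
  {J : Π x : M, TangentSpace (𝓡 (2 * n)) x →L[ℝ] TangentSpace (𝓡 (2 * n)) x}
  {cov : CovariantDerivative (𝓡 (2 * n)) (EuclideanSpace ℝ (Fin (2 * n)))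
      (TangentSpace (𝓡 (2 * n)) : M → Type _)}

omit [IsManifold (𝓡 n) ∞ L] [T2Space M] [IsManifold (𝓡 (2 * n)) ∞ M]
  [RiemannianBundle (fun x : M => TangentSpace (𝓡 (2 * n)) x)] in
theorem eventually_chart_source {ι : L → M} (hι : ContMDiff (𝓡 n) (𝓡 (2 * n)) ∞ ι) {x₀ : M} {p : L}
    (hp : ι p ∈ (chartAt (EuclideanSpace ℝ (Fin (2 * n))) x₀).source) :
    ∀ᶠ q in nhds p, q ∈ (chartAt (EuclideanSpace ℝ (Fin n)) p).source ∧
      ι q ∈ (chartAt (EuclideanSpace ℝ (Fin (2 * n))) x₀).source :=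
  Filter.Eventually.and
    ((chartAt (EuclideanSpace ℝ (Fin n)) p).open_source.mem_nhds (mem_chart_source _ p))
    ((hι p).continuousAt.preimage_mem_nhds
      ((chartAt (EuclideanSpace ℝ (Fin (2 * n))) x₀).open_source.mem_nhds hp))

/-- Transports identities proved at points of the manifold to identities on a neighbourhood in
coordinates, which is what derivatives there require. -/
theorem eventually_of_chart {E N : Type*} [NormedAddCommGroup E] [NormedSpace ℝ E]
    [TopologicalSpace N] [ChartedSpace E N] {p : N} {Q : N → Prop} (h : ∀ᶠ q in nhds p, Q q) :
    ∀ᶠ u in nhds (extChartAt 𝓘(ℝ, E) p p), ∃ q, Q q ∧ extChartAt 𝓘(ℝ, E) p q = u := by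
  have hc : ContinuousAt (extChartAt 𝓘(ℝ, E) p).symm (extChartAt 𝓘(ℝ, E) p p) :=
    continuousAt_extChartAt_symm p
  have h' : ∀ᶠ q in nhds ((extChartAt 𝓘(ℝ, E) p).symm (extChartAt 𝓘(ℝ, E) p p)), Q q := by
    rwa [chart_symm_chart (mem_chart_source E p)]
  filter_upwards [hc.eventually h', (isOpen_extChartAt_target (I := 𝓘(ℝ, E)) p).mem_nhds
    (chart_mem_target (mem_chart_source E p))] with u h1 h2
  exact ⟨_, h1, (extChartAt 𝓘(ℝ, E) p).right_inv h2⟩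

variable (hJ : IsAlmostHermitian (𝓡 (2 * n)) J) (hcov : IsChernConnection (𝓡 (2 * n)) J cov)
include hJ hcov

omit [T2Space M] hcov in
theorem tangentialDiv_eventuallyEq {ι : L → M} (hι : IsTotallyRealImmersion J ι)
    {Y : Π q : L, TangentSpace (𝓡 n) q}
    (hY : ContMDiff (𝓡 n) ((𝓡 n).prod 𝓘(ℝ, EuclideanSpace ℝ (Fin n))) ∞
      (fun p => TotalSpace.mk' (EuclideanSpace ℝ (Fin n)) p (Y p))) (p : L) :
    (fun u => tangentialDiv J cov ι Y ((extChartAt (𝓡 n) p).symm u))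
      =ᶠ[nhds (extChartAt (𝓡 n) p p)] sliceDiv (chartEnd J (ι p)) (chartChristoffel cov (ι p))
        (chartMap n (ι p) p ι) (chartField p Y) := by
  filter_upwards [eventually_of_chart (eventually_chart_source hι.contMDiff (mem_chart_source _ (ι p)))]
    with u ⟨q, ⟨h1, h2⟩, hu⟩
  rw [← hu, chart_symm_chart h1, tangentialDiv_eq_sliceDiv h1 h2 hι hJ.sq (hY q)]

theorem differentiableAt_sliceDiv_chart {ι : L → M} (hι : IsTotallyRealImmersion J ι)
    {Y : Π q : L, TangentSpace (𝓡 n) q}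
    (hY : ContMDiff (𝓡 n) ((𝓡 n).prod 𝓘(ℝ, EuclideanSpace ℝ (Fin n))) ∞
      (fun p => TotalSpace.mk' (EuclideanSpace ℝ (Fin n)) p (Y p))) (p : L) :
    DifferentiableAt ℝ (sliceDiv (chartEnd J (ι p)) (chartChristoffel cov (ι p))
        (chartMap n (ι p) p ι) (chartField p Y)) (extChartAt (𝓡 n) p p) := by
  have hp := mem_chart_source (EuclideanSpace ℝ (Fin n)) p
  have hx := mem_chart_source (EuclideanSpace ℝ (Fin (2 * n))) (ι p)
  have hw := isParallelComplexAt_chart hJ.sq hJ.contMDiff hcov.smooth hcov.parallel (ι p)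
  rw [← chartMap_chart (n := n) (p := p) (ι := ι) hp] at hw
  exact differentiableAt_sliceDiv hw
    ((contDiffAt_chartMap hp hx (hι.contMDiff p)).of_le ENat.LEInfty.out)
    ((contDiffAt_chartField hp (hY p)).of_le ENat.LEInfty.out)
    (isInvertible_realFrame hp hx hι hJ.sq)

theorem mdifferentiable_tangentialDiv {ι : L → M} (hι : IsTotallyRealImmersion J ι)
    {Y : Π q : L, TangentSpace (𝓡 n) q}
    (hY : ContMDiff (𝓡 n) ((𝓡 n).prod 𝓘(ℝ, EuclideanSpace ℝ (Fin n))) ∞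
      (fun p => TotalSpace.mk' (EuclideanSpace ℝ (Fin n)) p (Y p))) :
    MDifferentiable (𝓡 n) 𝓘(ℝ, ℝ) (tangentialDiv J cov ι Y) := fun p =>
  (mdifferentiableAt_iff_chart (mem_chart_source _ p)).2
    ((differentiableAt_sliceDiv_chart hJ hcov hι hY p).congr_of_eventuallyEq
      (tangentialDiv_eventuallyEq hJ hι hY p))

/-- The derivative of the Maslov form along a variation with velocity `X + J Y`, provided that `X`
vanishes or the Maslov form does. -/
theorem hasMaslovDifferential_tangentialDiv
    (htor : ∀ x u v, cov.torsion x (J x u) v = -J x (cov.torsion x u v))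
    {ι : L → M} (hι : IsTotallyRealImmersion J ι) {X Y : Π q : L, TangentSpace (𝓡 n) q}
    (hX : ContMDiff (𝓡 n) ((𝓡 n).prod 𝓘(ℝ, EuclideanSpace ℝ (Fin n))) ∞
      (fun p => TotalSpace.mk' (EuclideanSpace ℝ (Fin n)) p (X p)))
    (hY : ContMDiff (𝓡 n) ((𝓡 n).prod 𝓘(ℝ, EuclideanSpace ℝ (Fin n))) ∞
      (fun p => TotalSpace.mk' (EuclideanSpace ℝ (Fin n)) p (Y p)))
    (hX0 : (∀ q, X q = 0) ∨ ∀ q V, maslovForm J cov ι q V = 0) :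
    HasMaslovDifferential J cov ι
      (fun p => pushforward (n := n) ι p (X p) + J (ι p) (pushforward (n := n) ι p (Y p)))
      (fun p V => -mvfderiv (𝓡 n) (tangentialDiv J cov ι Y) p V +
        1 / 2 * chernRicciForm (𝓡 (2 * n)) J cov (ι p) (J (ι p) (pushforward (n := n) ι p (Y p)))
          (pushforward (n := n) ι p V)) := by
  intro ε φ hφ p V
  -- Once `ι` is replaced by `φ 0`, both sides of `hφ.velocity` lie in the same tangent space.
  obtain rfl := hφ.initial
  have hp := mem_chart_source (EuclideanSpace ℝ (Fin n)) p
  have hx := mem_chart_source (EuclideanSpace ℝ (Fin (2 * n))) (φ 0 p)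
  have h0 : (0 : ℝ) ∈ Set.Ioo (-ε) ε := ⟨by linarith [hφ.pos], hφ.pos⟩
  have hφs : ∀ t ∈ Set.Ioo (-ε) ε, ∀ q, ContMDiffAt (𝓘(ℝ, ℝ).prod (𝓡 n)) (𝓡 (2 * n)) ∞
      (fun z : ℝ × L => φ z.1 z.2) (t, q) := fun t ht q =>
    hφ.contMDiffOn.contMDiffAt ((isOpen_Ioo.prod isOpen_univ).mem_nhds ⟨ht, trivial⟩)
  set x₀ := φ 0 p with hx₀
  set u₀ := extChartAt (𝓡 n) p p with hu₀
  set f := chartFamily (n := n) x₀ p φ with hf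
  have hf0 : f (0, u₀) = extChartAt (𝓡 (2 * n)) x₀ x₀ := chartMap_chart (n := n) (ι := φ 0) hp
  have hw : IsParallelComplexAt (chartEnd J x₀) (chartChristoffel cov x₀) (f (0, u₀)) := by
    rw [hf0]
    exact isParallelComplexAt_chart hJ.sq hJ.contMDiff hcov.smooth hcov.parallel x₀
  have hfs : ContDiffAt ℝ 3 f (0, u₀) :=
    (contDiffAt_chartFamily hp hx (hφs 0 h0 p)).of_le ENat.LEInfty.out
  have hA : spatialFrame f (0, u₀) = fderiv ℝ (chartMap n x₀ p (φ 0)) u₀ :=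
    (fderiv_slice (hfs.differentiableAt (by simp))).symm
  have hi : (realFrame (chartEnd J x₀ (f (0, u₀))) (spatialFrame f (0, u₀))).IsInvertible := by
    rw [hA]
    exact isInvertible_realFrame hp hx hι hJ.sq
  have hsrc : ∀ᶠ u in nhds u₀, ∃ q : L, (q ∈ (chartAt (EuclideanSpace ℝ (Fin n)) p).source ∧
      φ 0 q ∈ (chartAt (EuclideanSpace ℝ (Fin (2 * n))) x₀).source) ∧ extChartAt (𝓡 n) p q = u :=
    eventually_of_chart (eventually_chart_source hι.contMDiff hx)
  have hv : ∀ᶠ u in nhds u₀, fderiv ℝ f (0, u) (1, 0) = spatialFrame f (0, u) (chartField p X u) +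
      chartEnd J x₀ (f (0, u)) (spatialFrame f (0, u) (chartField p Y u)) := by
    filter_upwards [hsrc] with u ⟨q, ⟨h1, h2⟩, hu⟩
    have h3 := contDiffAt_chartFamily h1 h2 (hφs 0 h0 q)
    have h4 : spatialFrame f (0, u) = fderiv ℝ (chartMap n x₀ p (φ 0)) u := by
      rw [← hu]
      exact (fderiv_slice (h3.differentiableAt (by simp))).symm
    have h5 : f (0, u) = extChartAt (𝓡 (2 * n)) x₀ (φ 0 q) := by
      rw [← hu]
      exact chartMap_chart (n := n) (ι := φ 0) h1
    rw [h4, h5, ← hu, hf, fderiv_chartFamily_time h1 h2 (hφs 0 h0 q), hφ.velocity, map_add,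
      tcoord_pushforward h1 h2 (hι.contMDiff q), chartField_chart h1, chartField_chart h1,
      ← tcoord_pushforward h1 h2 (hι.contMDiff q) (Y q), chartEnd_tcoord J h2]
  -- Every model vector `c` is the coordinate vector of some tangent vector at `q`, so vanishing of
  -- the Maslov form gives vanishing of its local expression in all directions.
  have hX0' : (∀ᶠ u in nhds u₀, chartField p X u = 0) ∨ ∀ᶠ u in nhds u₀, ∀ c,
      frameMaslov (chartEnd J x₀) (chartChristoffel cov x₀) (fun u => f (0, u))
        (fderiv ℝ fun u => f (0, u)) c u = 0 := by
    refine hX0.imp (fun h => ?_) (fun h => ?_)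
    · filter_upwards [hsrc] with u ⟨q, ⟨h1, h2⟩, hu⟩
      rw [← hu, chartField_chart h1, h, map_zero]
    · filter_upwards [hsrc] with u ⟨q, ⟨h1, h2⟩, hu⟩ c
      have h3 := maslovForm_eq_frameMaslov (cov := cov) h1 h2 hι hJ.sq
        (tfield (E := EuclideanSpace ℝ (Fin n)) p c q)
      rw [h, tcoord_tfield h1, hu] at h3
      exact h3.symm
  have htorsion : ∀ᶠ w in nhds (f (0, u₀)), ∀ a b, chartChristoffel cov x₀ w (chartEnd J x₀ w a) b -
      chartChristoffel cov x₀ w b (chartEnd J x₀ w a) =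
      -chartEnd J x₀ w (chartChristoffel cov x₀ w a b - chartChristoffel cov x₀ w b a) := by
    rw [hf0]
    filter_upwards [(isOpen_extChartAt_target x₀).mem_nhds (chart_mem_target hx)] with w h
      using chartChristoffel_antilinear htor h
  have main := hasDerivAt_frameMaslov hw htorsion hfs hi
    ((contDiffAt_chartField hp (hX p)).of_le ENat.LEInfty.out)
    ((contDiffAt_chartField hp (hY p)).of_le ENat.LEInfty.out) hv hX0' (tcoord p p V)
  have hval : -fderiv ℝ (sliceDiv (chartEnd J x₀) (chartChristoffel cov x₀) (fun u => f (0, u))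
      (chartField p Y)) u₀ (tcoord p p V) + 1 / 2 * clmTrace _ (chartEnd J x₀ (f (0, u₀)) *
        symbolCurvature (chartChristoffel cov x₀) (f (0, u₀))
          (chartEnd J x₀ (f (0, u₀)) (spatialFrame f (0, u₀) (chartField p Y u₀)))
          (spatialFrame f (0, u₀) (tcoord p p V))) =
      -mvfderiv (𝓡 n) (tangentialDiv J cov (φ 0) Y) p V +
        1 / 2 * chernRicciForm (𝓡 (2 * n)) J cov (φ 0 p)
          (J (φ 0 p) (pushforward (n := n) (φ 0) p (Y p))) (pushforward (n := n) (φ 0) p V) := by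
    rw [mvfderiv_eq_fderiv_chart hp (mdifferentiable_tangentialDiv hJ hcov hι hY p),
      (tangentialDiv_eventuallyEq hJ hι hY p).fderiv_eq,
      chernRicciForm_eq_clmTrace hcov.smooth, ← chartEnd_tcoord J hx,
      tcoord_pushforward hp hx (hι.contMDiff p), tcoord_pushforward hp hx (hι.contMDiff p), hA, hf0,
      chartField_chart hp]
    rfl
  rw [hval] at main
  refine main.congr_of_eventuallyEq ?_
  -- For small `t` the point `φ t p` stays in the chart at `x₀`, where the local expression of the
  -- Maslov form of `φ t` is valid.
  have hc : ContinuousAt (fun t => φ t p) 0 :=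
    ContinuousAt.comp (f := fun t : ℝ => (t, p)) (hφs 0 h0 p).continuousAt
      (Continuous.prodMk_left p).continuousAt
  filter_upwards [isOpen_Ioo.mem_nhds h0, hc.preimage_mem_nhds
    ((chartAt (EuclideanSpace ℝ (Fin (2 * n))) x₀).open_source.mem_nhds hx)] with t h1 h2
  exact maslovForm_eq_frameMaslov hp h2 (hφ.totallyReal t h1) hJ.sq V

end GeneralVariation

/-! ### Derivatives of determinants -/

section Determinants

variable {κ : Type*} [Fintype κ] [DecidableEq κ]

theorem hasDerivAt_det_one_add_smul (M : Matrix κ κ ℂ) :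
    HasDerivAt (fun t : ℝ => (1 + (t : ℂ) • M).det) M.trace 0 := by
  have h := (Polynomial.hasDerivAt (Matrix.det (1 + (Polynomial.X : Polynomial ℂ) • M.map Polynomial.C))
    (0 : ℂ))
  rw [Matrix.derivative_det_one_add_X_smul] at h
  have h2 := HasDerivAt.comp_ofReal (z := 0) (by simpa using h)
  have e : ∀ z : ℂ, (1 + z • M).det =
      Polynomial.eval z (1 + (Polynomial.X : Polynomial ℂ) • M.map Polynomial.C).det := fun z => by
    simp [eval_det, ← Matrix.smul_eq_mul_diagonal]
  exact h2.congr_of_eventuallyEq (Filter.Eventually.of_forall fun t => e t)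

theorem differentiable_det : Differentiable ℝ fun M : κ → κ → ℂ => (Matrix.of M).det := by
  simp only [Matrix.det_apply]
  refine Differentiable.fun_sum fun σ _ => ?_
  have h : Differentiable ℝ fun M : κ → κ → ℂ => ∏ i, M (σ i) i := by
    fun_prop
  exact h.const_smul (Equiv.Perm.sign σ : ℤ)

/-- If `H' = M H + H N` then `(det H)' = (tr M + tr N) det H`. -/
theorem hasDerivAt_det {H : ℝ → Matrix κ κ ℂ} {M N : Matrix κ κ ℂ}
    (h : ∀ i j, HasDerivAt (fun t => H t i j) ((M * H 0 + H 0 * N) i j) 0) :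
    HasDerivAt (fun t => (H t).det) ((M.trace + N.trace) * (H 0).det) 0 := by
  -- The comparison curve has the same value and derivative at `0` as `H`, and its determinant
  -- factors. No inverse of `H 0` is needed.
  set K : ℝ → Matrix κ κ ℂ := fun t => (1 + (t : ℂ) • M) * H 0 * (1 + (t : ℂ) • N) with hK
  have hK0 : K 0 = H 0 := by simp [hK]
  have h1 : HasDerivAt (fun t i j => H t i j) (fun i j => (M * H 0 + H 0 * N) i j) 0 :=
    hasDerivAt_pi.2 fun i => hasDerivAt_pi.2 fun j => h i j
  have h2 : HasDerivAt (fun t i j => K t i j) (fun i j => (M * H 0 + H 0 * N) i j) 0 := by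
    refine hasDerivAt_pi.2 fun i => hasDerivAt_pi.2 fun j => ?_
    have e : (fun t => K t i j) = fun t : ℝ => H 0 i j + (t : ℂ) * (M * H 0 + H 0 * N) i j +
        (t : ℂ) ^ 2 * (M * H 0 * N) i j := by
      funext t
      have : K t = H 0 + (t : ℂ) • (M * H 0 + H 0 * N) + ((t : ℂ) ^ 2) • (M * H 0 * N) := by
        simp only [hK, add_mul, mul_add, one_mul, mul_one, smul_mul_assoc, mul_smul_comm, smul_add,
          smul_smul, pow_two]
        abel
      rw [this]
      rfl
    rw [e]
    have ht : HasDerivAt (fun t : ℝ => (t : ℂ)) 1 0 := (hasDerivAt_id (0 : ℂ)).comp_ofReal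
    have := ((hasDerivAt_const (0 : ℝ) (H 0 i j)).add
      (ht.mul_const ((M * H 0 + H 0 * N) i j))).add ((ht.pow 2).mul_const ((M * H 0 * N) i j))
    exact this.congr_deriv (by simp)
  have hd1 := (differentiable_det (κ := κ) (fun i j => H 0 i j)).hasFDerivAt.comp_hasDerivAt 0 h1
  have hd2 := (differentiable_det (κ := κ) (fun i j => K 0 i j)).hasFDerivAt.comp_hasDerivAt 0 h2
  have hd3 : HasDerivAt (fun t => (K t).det) ((M.trace + N.trace) * (H 0).det) 0 := by
    simp only [hK, Matrix.det_mul]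
    have := ((hasDerivAt_det_one_add_smul M).mul_const (H 0).det).mul (hasDerivAt_det_one_add_smul N)
    exact this.congr_deriv (by
      simp only [Complex.ofReal_zero, zero_smul, add_zero, Matrix.det_one, one_mul, mul_one]
      ring)
  rw [hK0] at hd2
  have := hd2.unique hd3
  rw [← this]
  exact hd1

end Determinants

/-! ### Hermitian Gram matrices and the density `ρ_J` -/

section HermitianGram

variable {κ V : Type*} [Fintype κ] [DecidableEq κ] [NormedAddCommGroup V] [InnerProductSpace ℝ V]

omit [Fintype κ] [DecidableEq κ] in
/-- The matrix `h(vᵢ, vⱼ)` for `h = g - i g(J·, ·)`. -/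
def hermGram (J : V →ₗ[ℝ] V) (v : κ → V) : Matrix κ κ ℂ :=
  Matrix.of fun i j => ((inner ℝ (v i) (v j) : ℝ) : ℂ) -
    Complex.I * ((inner ℝ (J (v i)) (v j) : ℝ) : ℂ)

variable {J : V →ₗ[ℝ] V}

open scoped ComplexOrder in
omit [DecidableEq κ] in
-- For a real orthonormal basis `ε` of `V`, the sum over `k` of `h(u, ε_k)` times the conjugate of
-- `h(w, ε_k)` is `2 h(u, w)`. So twice the Gram matrix is `B Bᴴ`, and `B` is injective on rows
-- because the vectors `vᵢ`, `J vᵢ` are independent over `ℝ`. Positivity of the determinant later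
-- makes its square root differentiable and nonzero.
theorem posDef_hermGram [FiniteDimensional ℝ V] (hJ : ∀ v, J (J v) = -v)
    (hJi : ∀ u v, inner ℝ (J u) (J v) = (inner ℝ u v : ℝ)) {v : κ → V}
    (hv : ∀ a b : κ → ℝ, ∑ i, a i • v i + J (∑ i, b i • v i) = 0 → a = 0 ∧ b = 0) :
    (hermGram J v).PosDef := by
  set ε := stdOrthonormalBasis ℝ V
  set B : Matrix κ (Fin (Module.finrank ℝ V)) ℂ := Matrix.of fun i k =>
    ((inner ℝ (v i) (ε k) : ℝ) : ℂ) - Complex.I * ((inner ℝ (J (v i)) (ε k) : ℝ) : ℂ) with hB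
  have hskew : ∀ u w : V, (inner ℝ u (J w) : ℝ) = -inner ℝ (J u) w := by
    intro u w
    rw [← hJi u, hJ, inner_neg_right]
  have hsum : ∀ u w : V, ∑ k, ((inner ℝ u (ε k) : ℝ) : ℂ) * ((inner ℝ w (ε k) : ℝ) : ℂ) =
      ((inner ℝ u w : ℝ) : ℂ) := by
    intro u w
    rw [← ε.sum_inner_mul_inner u w]
    push_cast
    refine Finset.sum_congr rfl fun k _ => ?_
    rw [real_inner_comm w]
  have hH : (2 : ℂ) • hermGram J v = B * B.conjTranspose := by
    ext i j
    rw [Matrix.mul_apply]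
    simp only [hB, Matrix.conjTranspose_apply, Matrix.of_apply, star_sub, star_mul', RCLike.star_def,
      Complex.conj_ofReal, Complex.conj_I, Matrix.smul_apply, hermGram, smul_eq_mul]
    have : ∀ k, (((inner ℝ (v i) (ε k) : ℝ) : ℂ) - Complex.I * ((inner ℝ (J (v i)) (ε k) : ℝ) : ℂ)) *
        (((inner ℝ (v j) (ε k) : ℝ) : ℂ) - -Complex.I * ((inner ℝ (J (v j)) (ε k) : ℝ) : ℂ)) =
        ((inner ℝ (v i) (ε k) : ℝ) : ℂ) * ((inner ℝ (v j) (ε k) : ℝ) : ℂ) +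
        ((inner ℝ (J (v i)) (ε k) : ℝ) : ℂ) * ((inner ℝ (J (v j)) (ε k) : ℝ) : ℂ) +
        Complex.I * (((inner ℝ (v i) (ε k) : ℝ) : ℂ) * ((inner ℝ (J (v j)) (ε k) : ℝ) : ℂ)) -
        Complex.I * (((inner ℝ (J (v i)) (ε k) : ℝ) : ℂ) * ((inner ℝ (v j) (ε k) : ℝ) : ℂ)) := by
      intro k
      linear_combination (-((inner ℝ (J (v i)) (ε k) : ℝ) : ℂ) *
        ((inner ℝ (J (v j)) (ε k) : ℝ) : ℂ)) * Complex.I_mul_I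
    rw [Finset.sum_congr rfl fun k _ => this k, Finset.sum_sub_distrib, Finset.sum_add_distrib,
      Finset.sum_add_distrib, ← Finset.mul_sum, ← Finset.mul_sum, hsum, hsum, hsum, hsum, hJi, hskew]
    push_cast
    ring
  have hinj : Function.Injective B.vecMul := by
    refine (injective_iff_map_eq_zero (Matrix.vecMulLinear B)).2 fun x hx => ?_
    have hx' : ∀ k, ∑ i, x i * B i k = 0 := fun k => congrFun hx k
    -- The real part of `x B = 0` says that this vector is orthogonal to every `ε k`.
    have hre : ∑ i, (x i).re • v i + J (∑ i, (x i).im • v i) = 0 := by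
      refine InnerProductSpace.ext_inner_right_basis ε.toBasis fun k => ?_
      rw [OrthonormalBasis.coe_toBasis]
      have := congrArg Complex.re (hx' k)
      rw [Complex.re_sum] at this
      rw [inner_zero_left, ← Complex.zero_re, ← this, map_sum, inner_add_left, sum_inner, sum_inner,
        ← Finset.sum_add_distrib]
      refine Finset.sum_congr rfl fun i _ => ?_
      rw [map_smul, real_inner_smul_left, real_inner_smul_left]
      simp [hB, Complex.mul_re]
    obtain ⟨h1, h2⟩ := hv _ _ hre
    exact funext fun i => Complex.ext (congrFun h1 i) (congrFun h2 i)
  have h2 : hermGram J v = ((1 / 2 : ℝ) : ℂ) • (B * B.conjTranspose) := by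
    rw [← hH, smul_smul]
    norm_num
  rw [h2]
  exact (Matrix.PosDef.mul_conjTranspose_self B hinj).smul (by norm_num)

omit [DecidableEq κ] in
theorem hermGram_sum_smul (e : κ → V) (P : Matrix κ κ ℝ) :
    hermGram J (fun i => ∑ k, P k i • e k) =
      (P.map Complex.ofReal).transpose * hermGram J e * P.map Complex.ofReal := by
  ext i j
  simp only [hermGram, Matrix.of_apply, Matrix.mul_apply, Matrix.transpose_apply, Matrix.map_apply,
    map_sum, map_smul, sum_inner, inner_sum, real_inner_smul_left, real_inner_smul_right,
    Complex.ofReal_sum, Complex.ofReal_mul, Finset.mul_sum, Finset.sum_mul, ← Finset.sum_sub_distrib]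
  refine Finset.sum_congr rfl fun k _ => Finset.sum_congr rfl fun l _ => ?_
  ring

omit [DecidableEq κ] in
theorem gram_sum_smul {e : κ → V} (he : Orthonormal ℝ e) (P : Matrix κ κ ℝ) :
    (Matrix.of fun i j => (inner ℝ (∑ k, P k i • e k) (∑ k, P k j • e k) : ℝ)) =
      P.transpose * P := by
  ext i j
  simp only [Matrix.of_apply, Matrix.mul_apply, Matrix.transpose_apply]
  rw [he.inner_sum]
  simp

/-- If `P` is the real matrix of `v` in the orthonormal basis, then `det g(v) = (det P)²` and `det
h(v) = (det P)² det h(e)`. Thus `ρ_J √det g` can be computed in a coordinate frame. -/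
theorem rhoSubspace_mul_sqrt_gram [FiniteDimensional ℝ V] {n : ℕ} {S : Submodule ℝ V}
    (hS : Module.finrank ℝ S = n) {v : Fin n → V} (hv : ∀ i, v i ∈ S) :
    rhoSubspace J S * Real.sqrt (Matrix.of fun i j => (inner ℝ (v i) (v j) : ℝ)).det =
      Real.sqrt (hermGram J v).det.re := by
  subst hS
  set b := stdOrthonormalBasis ℝ S
  set e : Fin (Module.finrank ℝ S) → V := fun i => (b i : V)
  have he : Orthonormal ℝ e := b.orthonormal.comp_linearIsometry S.subtypeₗᵢ
  set P : Matrix (Fin (Module.finrank ℝ S)) (Fin (Module.finrank ℝ S)) ℝ :=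
    Matrix.of fun k i => (inner ℝ (e k) (v i) : ℝ) with hP
  have hvP : v = fun i => ∑ k, P k i • e k := by
    funext i
    have := congrArg (Subtype.val) (b.sum_repr' ⟨v i, hv i⟩)
    rw [Submodule.coe_sum] at this
    exact this.symm
  have hrho : rhoSubspace J S = Real.sqrt (hermGram J e).det.re := rfl
  rw [hrho, hvP, hermGram_sum_smul, gram_sum_smul he, Matrix.det_mul, Matrix.det_mul, Matrix.det_mul,
    Matrix.det_transpose, Matrix.det_transpose]
  have hdet : (P.map Complex.ofReal).det = (P.det : ℂ) := (RingHom.map_det Complex.ofRealHom P).symm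
  rw [hdet, mul_comm (Real.sqrt _), ← Real.sqrt_mul (mul_self_nonneg _)]
  congr 1
  rw [mul_right_comm (P.det : ℂ), ← Complex.ofReal_mul, Complex.re_ofReal_mul]

end HermitianGram

/-! ### The Leibniz rule for the Hermitian form on a totally real frame -/

section HermitianForm

variable {E F : Type*} [NormedAddCommGroup E] [NormedSpace ℝ E]
  [NormedAddCommGroup F] [NormedSpace ℝ F]

/-- The Hermitian form `h = G - i G(j·, ·)`. -/
def hermForm (G : E →L[ℝ] E →L[ℝ] ℝ) (j : E →L[ℝ] E) (x y : E) : ℂ :=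
  (G x y : ℂ) - Complex.I * (G (j x) y : ℂ)

variable {G : E →L[ℝ] E →L[ℝ] ℝ} {j : E →L[ℝ] E}

theorem hermForm_add_left (x y z : E) :
    hermForm G j (x + y) z = hermForm G j x z + hermForm G j y z := by
  simp only [hermForm, map_add, add_apply, Complex.ofReal_add]
  ring

theorem hermForm_add_right (x y z : E) :
    hermForm G j x (y + z) = hermForm G j x y + hermForm G j x z := by
  simp only [hermForm, map_add, Complex.ofReal_add]
  ring

theorem hermForm_sum_left {κ : Type*} (s : Finset κ) (r : κ → ℝ) (x : κ → E) (y : E) :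
    hermForm G j (∑ k ∈ s, r k • x k) y = ∑ k ∈ s, (r k : ℂ) * hermForm G j (x k) y := by
  simp only [hermForm, map_sum, map_smul, sum_apply, smul_apply, smul_eq_mul, Complex.ofReal_sum,
    Complex.ofReal_mul, Finset.mul_sum, ← Finset.sum_sub_distrib]
  refine Finset.sum_congr rfl fun k _ => ?_
  ring

theorem hermForm_sum_right {κ : Type*} (s : Finset κ) (r : κ → ℝ) (x : κ → E) (y : E) :
    hermForm G j y (∑ k ∈ s, r k • x k) = ∑ k ∈ s, (r k : ℂ) * hermForm G j y (x k) := by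
  simp only [hermForm, map_sum, map_smul, smul_eq_mul, Complex.ofReal_sum,
    Complex.ofReal_mul, Finset.mul_sum, ← Finset.sum_sub_distrib]
  refine Finset.sum_congr rfl fun k _ => ?_
  ring

theorem hermForm_map_left (hj : ∀ v, j (j v) = -v) (x y : E) :
    hermForm G j (j x) y = Complex.I * hermForm G j x y := by
  simp only [hermForm, hj, map_neg, neg_apply, Complex.ofReal_neg]
  linear_combination (G (j x) y : ℂ) * Complex.I_mul_I

theorem hermForm_map_right (hj : ∀ v, j (j v) = -v) (hG : ∀ x y, G (j x) (j y) = G x y) (x y : E) :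
    hermForm G j x (j y) = -Complex.I * hermForm G j x y := by
  have h : G x (j y) = -G (j x) y := by
    rw [← hG x, hj, map_neg]
  simp only [hermForm, hG, h, Complex.ofReal_neg]
  linear_combination (-(G (j x) y : ℂ)) * Complex.I_mul_I

variable {κ : Type*} [Fintype κ] {A : F →L[ℝ] E}

/-- Leibniz matrices: if `ν = A α + j A β` and `θ = α + i β`, then
`h(ν bᵢ, A bⱼ) + h(A bᵢ, ν bⱼ) = (θᵀ H + H θ̄)ᵢⱼ`. -/
theorem hermForm_leibniz (hj : ∀ v, j (j v) = -v) (hG : ∀ x y, G (j x) (j y) = G x y)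
    (hi : (realFrame j A).IsInvertible) (b : Module.Basis κ ℝ F) (ν : F →L[ℝ] E) (i l : κ) :
    hermForm G j (ν (b i)) (A (b l)) + hermForm G j (A (b i)) (ν (b l)) =
      ((Matrix.of fun i k => ((b.repr (rePart j A (ν (b i))) k : ℂ) +
          Complex.I * (b.repr (imPart j A (ν (b i))) k : ℂ))) *
        (Matrix.of fun i l => hermForm G j (A (b i)) (A (b l))) +
      (Matrix.of fun i l => hermForm G j (A (b i)) (A (b l))) *
        (Matrix.of fun k l => ((b.repr (rePart j A (ν (b l))) k : ℂ) -
          Complex.I * (b.repr (imPart j A (ν (b l))) k : ℂ)))) i l := by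
  have hν : ∀ i, ν (b i) = ∑ k, b.repr (rePart j A (ν (b i))) k • A (b k) +
      j (∑ k, b.repr (imPart j A (ν (b i))) k • A (b k)) := by
    intro i
    have h := (realFrame_realCoframe hi (ν (b i))).symm
    rw [realFrame_apply] at h
    conv_lhs => rw [h]
    congr 1
    · conv_lhs => rw [← b.sum_repr (realCoframe j A (ν (b i))).1]
      simp only [map_sum, map_smul]
      rfl
    · conv_lhs => rw [← b.sum_repr (realCoframe j A (ν (b i))).2]
      simp only [map_sum, map_smul]
      rfl
  have h1 : hermForm G j (ν (b i)) (A (b l)) = ∑ k, ((b.repr (rePart j A (ν (b i))) k : ℂ) +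
      Complex.I * (b.repr (imPart j A (ν (b i))) k : ℂ)) * hermForm G j (A (b k)) (A (b l)) := by
    conv_lhs => rw [hν i]
    rw [hermForm_add_left, hermForm_map_left hj, hermForm_sum_left, hermForm_sum_left,
      Finset.mul_sum, ← Finset.sum_add_distrib]
    refine Finset.sum_congr rfl fun k _ => ?_
    ring
  have h2 : hermForm G j (A (b i)) (ν (b l)) = ∑ k, hermForm G j (A (b i)) (A (b k)) *
      ((b.repr (rePart j A (ν (b l))) k : ℂ) -
        Complex.I * (b.repr (imPart j A (ν (b l))) k : ℂ)) := by
    conv_lhs => rw [hν l]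
    rw [hermForm_add_right, hermForm_map_right hj hG, hermForm_sum_right, hermForm_sum_right,
      Finset.mul_sum, ← Finset.sum_add_distrib]
    refine Finset.sum_congr rfl fun k _ => ?_
    ring
  rw [h1, h2]
  rfl

/-- The two matrices of `hermForm_leibniz` have conjugate traces, so the imaginary parts cancel and
only the real part of `ν` affects `det h`. -/
theorem trace_leibniz [FiniteDimensional ℝ F] (b : Module.Basis κ ℝ F) (ν : F →L[ℝ] E) :
    (Matrix.of fun i k => ((b.repr (rePart j A (ν (b i))) k : ℂ) +
          Complex.I * (b.repr (imPart j A (ν (b i))) k : ℂ))).trace +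
      (Matrix.of fun k l => ((b.repr (rePart j A (ν (b l))) k : ℂ) -
          Complex.I * (b.repr (imPart j A (ν (b l))) k : ℂ))).trace =
      ((2 * clmTrace F (rePart j A ∘L ν) : ℝ) : ℂ) := by
  rw [clmTrace_apply, ← sum_repr_eq_trace b (LinearEquiv.refl ℝ F) _
    (fun i => rePart j A (ν (b i))) (fun i => rfl)]
  simp only [Matrix.trace, Matrix.diag_apply, Matrix.of_apply]
  rw [← Finset.sum_add_distrib, Complex.ofReal_mul, Complex.ofReal_sum, Finset.mul_sum]
  refine Finset.sum_congr rfl fun k _ => ?_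
  push_cast
  ring

end HermitianForm

/-! ### The logarithmic derivative of `√det h` -/

section GramDeterminant

theorem differentiableAt_comp_fun {E G P : Type*} [NormedAddCommGroup E] [NormedSpace ℝ E]
    [NormedAddCommGroup G] [NormedSpace ℝ G] [NormedAddCommGroup P] [NormedSpace ℝ P]
    {Γ : E → G} {f : P → E} {z : P} (hΓ : DifferentiableAt ℝ Γ (f z))
    (hf : DifferentiableAt ℝ f z) : DifferentiableAt ℝ (fun z => Γ (f z)) z :=
  hΓ.comp z hf

variable {E F : Type*} [NormedAddCommGroup E] [NormedSpace ℝ E]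
  [NormedAddCommGroup F] [NormedSpace ℝ F]
  {j : E → E →L[ℝ] E} {Γ : E → E →L[ℝ] E →L[ℝ] E} {G : E → E →L[ℝ] E →L[ℝ] ℝ} {f : F → E} {u : F}

set_option synthInstance.maxHeartbeats 200000 in
theorem fderiv_metric_apply (hGd : DifferentiableAt ℝ G (f u)) (hf : DifferentiableAt ℝ f u)
    (hG : ∀ a b c, fderiv ℝ G (f u) a b c = G (f u) (Γ (f u) a b) c + G (f u) b (Γ (f u) a c))
    {p q : F → E} (hp : DifferentiableAt ℝ p u) (hq : DifferentiableAt ℝ q u) (c : F) :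
    fderiv ℝ (fun u => G (f u) (p u) (q u)) u c =
      G (f u) (fderiv ℝ p u c + Γ (f u) (fderiv ℝ f u c) (p u)) (q u) +
      G (f u) (p u) (fderiv ℝ q u c + Γ (f u) (fderiv ℝ f u c) (q u)) := by
  have hGf : DifferentiableAt ℝ (fun u => G (f u)) u := differentiableAt_comp_fun (G := E →L[ℝ] E →L[ℝ] ℝ) (Γ := G) hGd hf
  rw [fderiv_clm_apply' (hGf.clm_apply hp) hq, fderiv_clm_apply' hGf hp, fderiv_comp_apply hGd hf,
    add_apply, hG, map_add (G (f u)), add_apply, map_add (G (f u) (p u))]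
  ring

theorem cov_end_apply (hw : IsParallelComplexAt j Γ (f u)) (hf : DifferentiableAt ℝ f u)
    {p : F → E} (hp : DifferentiableAt ℝ p u) (c : F) :
    fderiv ℝ (fun u => j (f u) (p u)) u c + Γ (f u) (fderiv ℝ f u c) (j (f u) (p u)) =
      j (f u) (fderiv ℝ p u c + Γ (f u) (fderiv ℝ f u c) (p u)) := by
  have hj : DifferentiableAt ℝ j (f u) := hw.contDiffAt_end.differentiableAt (by simp)
  have hjf : DifferentiableAt ℝ (fun u => j (f u)) u := hj.comp u hf
  rw [fderiv_clm_apply' hjf hp, fderiv_comp_apply hj hf, hw.fderiv_end.self_of_nhds, map_add]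
  change _ + (j (f u) (Γ (f u) (fderiv ℝ f u c) (p u)) - Γ (f u) (fderiv ℝ f u c) (j (f u) (p u))) +
    _ = _
  abel

variable {κ : Type*} [Fintype κ] [DecidableEq κ]

variable (G j f) in
omit [Fintype κ] [DecidableEq κ] in
/-- The matrix `h(∂ᵢ f, ∂ⱼ f)`. -/
def chartHermGram (b : κ → F) (u : F) : Matrix κ κ ℂ :=
  Matrix.of fun i l => hermForm (G (f u)) (j (f u)) (fderiv ℝ f u (b i)) (fderiv ℝ f u (b l))

set_option synthInstance.maxHeartbeats 200000 in
omit [Fintype κ] [DecidableEq κ] in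
theorem differentiableAt_chartHermGram (hw : IsParallelComplexAt j Γ (f u))
    (hGd : DifferentiableAt ℝ G (f u)) (hf : ContDiffAt ℝ 3 f u) (b : κ → F) (i l : κ) :
    DifferentiableAt ℝ (fun u => chartHermGram j G f b u i l) u := by
  have hfd : DifferentiableAt ℝ f u := hf.differentiableAt (by simp)
  have hA : DifferentiableAt ℝ (fderiv ℝ f) u :=
    (hf.fderiv_right (m := 2) (by norm_num)).differentiableAt (by simp)
  have hGf : DifferentiableAt ℝ (fun u => G (f u)) u := differentiableAt_comp_fun (G := E →L[ℝ] E →L[ℝ] ℝ) (Γ := G) hGd hfd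
  have hjf : DifferentiableAt ℝ (fun u => j (f u)) u :=
    (hw.contDiffAt_end.differentiableAt (by simp)).comp u hfd
  have hAb : ∀ i, DifferentiableAt ℝ (fun u => fderiv ℝ f u (b i)) u := fun i =>
    hA.clm_apply (differentiableAt_const _)
  have h1 : DifferentiableAt ℝ (fun u => G (f u) (fderiv ℝ f u (b i)) (fderiv ℝ f u (b l))) u :=
    (hGf.clm_apply (hAb i)).clm_apply (hAb l)
  have h2 : DifferentiableAt ℝ
      (fun u => G (f u) (j (f u) (fderiv ℝ f u (b i))) (fderiv ℝ f u (b l))) u :=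
    (hGf.clm_apply (hjf.clm_apply (hAb i))).clm_apply (hAb l)
  exact (Complex.ofRealCLM.differentiableAt.comp u h1).sub
    ((Complex.ofRealCLM.differentiableAt.comp u h2).const_mul Complex.I)

set_option synthInstance.maxHeartbeats 200000 in
omit [Fintype κ] [DecidableEq κ] in
-- Metric and complex structure are parallel, so `h` is differentiated by the Leibniz rule with `∇_c
-- A`. Restricting to the line `u + t c` gives the one-variable form required by `hasDerivAt_det`.
theorem hasDerivAt_chartHermGram (hw : IsParallelComplexAt j Γ (f u))
    (hGd : DifferentiableAt ℝ G (f u)) (hf : ContDiffAt ℝ 3 f u)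
    (hG : ∀ a b c, fderiv ℝ G (f u) a b c = G (f u) (Γ (f u) a b) c + G (f u) b (Γ (f u) a c))
    (b : κ → F) (c : F) (i l : κ) :
    HasDerivAt (fun t : ℝ => chartHermGram j G f b (u + t • c) i l)
      (hermForm (G (f u)) (j (f u))
        ((fderiv ℝ (fderiv ℝ f) u c + Γ (f u) (fderiv ℝ f u c) ∘L fderiv ℝ f u) (b i))
        (fderiv ℝ f u (b l)) +
      hermForm (G (f u)) (j (f u)) (fderiv ℝ f u (b i))
        ((fderiv ℝ (fderiv ℝ f) u c + Γ (f u) (fderiv ℝ f u c) ∘L fderiv ℝ f u) (b l))) 0 := by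
  have hfd : DifferentiableAt ℝ f u := hf.differentiableAt (by simp)
  have hA : DifferentiableAt ℝ (fderiv ℝ f) u :=
    (hf.fderiv_right (m := 2) (by norm_num)).differentiableAt (by simp)
  have hGf : DifferentiableAt ℝ (fun u => G (f u)) u := differentiableAt_comp_fun (G := E →L[ℝ] E →L[ℝ] ℝ) (Γ := G) hGd hfd
  have hjf : DifferentiableAt ℝ (fun u => j (f u)) u :=
    (hw.contDiffAt_end.differentiableAt (by simp)).comp u hfd
  have hAb : ∀ i, DifferentiableAt ℝ (fun u => fderiv ℝ f u (b i)) u := fun i =>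
    hA.clm_apply (differentiableAt_const _)
  have hline : HasDerivAt (fun t : ℝ => u + t • c) c 0 := by
    simpa using ((hasDerivAt_id (0 : ℝ)).smul_const c).const_add u
  have hlift : ∀ {g : F → ℝ}, DifferentiableAt ℝ g u →
      HasDerivAt (fun t : ℝ => ((g (u + t • c) : ℝ) : ℂ)) ((fderiv ℝ g u c : ℝ) : ℂ) 0 := by
    intro g hg
    have h0 : u + (0 : ℝ) • c = u := by simp
    have := HasFDerivAt.comp_hasDerivAt_of_eq (0 : ℝ) hg.hasFDerivAt hline h0.symm
    exact this.ofReal_comp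
  have h1 : DifferentiableAt ℝ (fun u => G (f u) (fderiv ℝ f u (b i)) (fderiv ℝ f u (b l))) u :=
    (hGf.clm_apply (hAb i)).clm_apply (hAb l)
  have h2 : DifferentiableAt ℝ
      (fun u => G (f u) (j (f u) (fderiv ℝ f u (b i))) (fderiv ℝ f u (b l))) u :=
    (hGf.clm_apply (hjf.clm_apply (hAb i))).clm_apply (hAb l)
  refine ((hlift h1).sub ((hlift h2).const_mul Complex.I)).congr_deriv ?_
  rw [fderiv_metric_apply hGd hfd hG (hAb i) (hAb l),
    fderiv_metric_apply hGd hfd hG (hjf.clm_apply (hAb i)) (hAb l),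
    cov_end_apply hw hfd (hAb i), fderiv_apply_const hA, fderiv_apply_const hA]
  simp only [hermForm, Complex.ofReal_add, add_apply, ContinuousLinearMap.comp_apply]
  ring

/-- The derivative of `det h` is `2 tr Re (∇_c A) · det h`; the square root absorbs the factor `2`.
-/
theorem fderiv_sqrt_det_chartHermGram [FiniteDimensional ℝ F] (hw : IsParallelComplexAt j Γ (f u))
    (hGd : DifferentiableAt ℝ G (f u)) (hf : ContDiffAt ℝ 3 f u)
    (hG : ∀ a b c, fderiv ℝ G (f u) a b c = G (f u) (Γ (f u) a b) c + G (f u) b (Γ (f u) a c))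
    (hGj : ∀ x y, G (f u) (j (f u) x) (j (f u) y) = G (f u) x y)
    (hi : (realFrame (j (f u)) (fderiv ℝ f u)).IsInvertible) (b : Module.Basis κ ℝ F)
    (hpos : 0 < (chartHermGram j G f b u).det.re) :
    DifferentiableAt ℝ (fun u => Real.sqrt (chartHermGram j G f b u).det.re) u ∧
    ∀ c, fderiv ℝ (fun u => Real.sqrt (chartHermGram j G f b u).det.re) u c =
      Real.sqrt (chartHermGram j G f b u).det.re * clmTrace F (rePart (j (f u)) (fderiv ℝ f u) ∘L
        (fderiv ℝ (fderiv ℝ f) u c + Γ (f u) (fderiv ℝ f u c) ∘L fderiv ℝ f u)) := by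
  have hd : DifferentiableAt ℝ (fun u i l => chartHermGram j G f b u i l) u :=
    differentiableAt_pi.2 fun i => differentiableAt_pi.2 fun l =>
      differentiableAt_chartHermGram hw hGd hf b i l
  have hdet : DifferentiableAt ℝ (fun u => (chartHermGram j G f b u).det.re) u :=
    Complex.reCLM.differentiableAt.comp u (DifferentiableAt.comp
      (g := fun M : κ → κ → ℂ => (Matrix.of M).det)
      (f := fun u i l => chartHermGram j G f b u i l) u (differentiable_det _) hd)
  have hD := hdet.sqrt hpos.ne'
  refine ⟨hD, fun c => ?_⟩
  have h0 : u + (0 : ℝ) • c = u := by simp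
  have hline : HasDerivAt (fun t : ℝ => u + t • c) c 0 := by
    simpa using ((hasDerivAt_id (0 : ℝ)).smul_const c).const_add u
  have h1 := HasFDerivAt.comp_hasDerivAt_of_eq (0 : ℝ) hD.hasFDerivAt hline h0.symm
  set ν := fderiv ℝ (fderiv ℝ f) u c + Γ (f u) (fderiv ℝ f u c) ∘L fderiv ℝ f u with hν
  have h2 := hasDerivAt_det (H := fun t : ℝ => chartHermGram j G f b (u + t • c)) fun i l =>
    (hasDerivAt_chartHermGram hw hGd hf hG b c i l).congr_deriv (by
      rw [hermForm_leibniz hw.sq.self_of_nhds hGj hi b ν i l, h0]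
      rfl)
  rw [trace_leibniz] at h2
  have h3 : HasDerivAt (fun t : ℝ => (chartHermGram j G f b (u + t • c)).det.re)
      (((2 * clmTrace F (rePart (j (f u)) (fderiv ℝ f u) ∘L ν) : ℝ) : ℂ) *
        (chartHermGram j G f b u).det).re 0 := by
    have := Complex.reCLM.hasFDerivAt.comp_hasDerivAt (0 : ℝ) h2
    rw [h0] at this
    exact this
  have h4 := h3.sqrt (by rw [h0]; exact hpos.ne')
  rw [h0, Complex.re_ofReal_mul] at h4
  rw [h1.unique h4]
  have hs := Real.sq_sqrt hpos.le
  have hsp := (Real.sqrt_pos.2 hpos).ne'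
  field_simp
  rw [hs]

end GramDeterminant

/-! ### The divergence of `ρ_J Y` -/

section Divergence

theorem mdifferentiableAt_comp_chart {E V N : Type*} [NormedAddCommGroup E] [NormedSpace ℝ E]
    [TopologicalSpace N] [ChartedSpace E N] [IsManifold 𝓘(ℝ, E) ∞ N]
    [NormedAddCommGroup V] [NormedSpace ℝ V] {g : E → V} {p q : N}
    (hq : q ∈ (chartAt E p).source) (hg : DifferentiableAt ℝ g (extChartAt 𝓘(ℝ, E) p q)) :
    MDifferentiableAt 𝓘(ℝ, E) 𝓘(ℝ, V) (fun q => g (extChartAt 𝓘(ℝ, E) p q)) q :=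
  hg.mdifferentiableAt.comp q (mdifferentiableAt_extChartAt' hq)

theorem mvfderiv_comp_chart {E V N : Type*} [NormedAddCommGroup E] [NormedSpace ℝ E]
    [TopologicalSpace N] [ChartedSpace E N] [IsManifold 𝓘(ℝ, E) ∞ N]
    [NormedAddCommGroup V] [NormedSpace ℝ V] {g : E → V} {p q : N}
    (hq : q ∈ (chartAt E p).source) (hg : DifferentiableAt ℝ g (extChartAt 𝓘(ℝ, E) p q))
    (X : TangentSpace 𝓘(ℝ, E) q) :
    mvfderiv 𝓘(ℝ, E) (fun q => g (extChartAt 𝓘(ℝ, E) p q)) q X =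
      fderiv ℝ g (extChartAt 𝓘(ℝ, E) p q) (tcoord p q X) := by
  have hev : (fun u => g (extChartAt 𝓘(ℝ, E) p ((extChartAt 𝓘(ℝ, E) p).symm u)))
      =ᶠ[nhds (extChartAt 𝓘(ℝ, E) p q)] g := by
    filter_upwards [(isOpen_extChartAt_target p).mem_nhds (chart_mem_target hq)] with u hu
    rw [(extChartAt 𝓘(ℝ, E) p).right_inv hu]
  rw [mvfderiv_eq_fderiv_chart hq (mdifferentiableAt_comp_chart hq hg), hev.fderiv_eq]

variable {n : ℕ} {L : Type*} [TopologicalSpace L] [ChartedSpace (EuclideanSpace ℝ (Fin n)) L]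
  [IsManifold (𝓡 n) ∞ L]
  {M : Type*} [TopologicalSpace M] [ChartedSpace (EuclideanSpace ℝ (Fin (2 * n))) M]
  [IsManifold (𝓡 (2 * n)) ∞ M] [RiemannianBundle (fun x : M => TangentSpace (𝓡 (2 * n)) x)]
  {J : Π x : M, TangentSpace (𝓡 (2 * n)) x →L[ℝ] TangentSpace (𝓡 (2 * n)) x}
  {cov : CovariantDerivative (𝓡 (2 * n)) (EuclideanSpace ℝ (Fin (2 * n)))
      (TangentSpace (𝓡 (2 * n)) : M → Type _)} {ι : L → M}

omit [IsManifold (𝓡 n) ∞ L] [RiemannianBundle (fun x : M => TangentSpace (𝓡 (2 * n)) x)]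
  [IsManifold (𝓡 (2 * n)) ∞ M] in
theorem finrank_range_pushforward (hι : IsTotallyRealImmersion J ι) (q : L) :
    Module.finrank ℝ (LinearMap.range (pushforward (n := n) ι q)) = n := by
  have : FiniteDimensional ℝ (TangentSpace (𝓡 n) q) :=
    inferInstanceAs (FiniteDimensional ℝ (EuclideanSpace ℝ (Fin n)))
  rw [LinearMap.finrank_range_of_inj (hι.immersion q)]
  exact finrank_euclideanSpace_fin (𝕜 := ℝ) (n := n)

theorem tcoord_coordField {p q : L} (hq : q ∈ (chartAt (EuclideanSpace ℝ (Fin n)) p).source)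
    (i : Fin n) : tcoord p q (coordField p i q) = EuclideanSpace.basisFun (Fin n) ℝ i := by
  unfold coordField
  rw [extend_eq_tfield, tcoord_tfield hq]
  exact (tcoord_self _).trans (congrFun (OrthonormalBasis.coe_toBasis _) i)

/-- The frame `ι_* ∂ᵢ` in the chart at `p`. -/
def pushFrame (ι : L → M) (p q : L) (i : Fin n) : TangentSpace (𝓡 (2 * n)) (ι q) :=
  pushforward (n := n) ι q (coordField p i q)

theorem hermGram_pushFrame {p q : L} {x₀ : M}
    (hq : q ∈ (chartAt (EuclideanSpace ℝ (Fin n)) p).source)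
    (hιq : ι q ∈ (chartAt (EuclideanSpace ℝ (Fin (2 * n))) x₀).source)
    (hι : IsTotallyRealImmersion J ι) :
    hermGram (J (ι q)).toLinearMap (pushFrame ι p q) =
      chartHermGram (chartEnd J x₀) (chartMetric x₀) (chartMap n x₀ p ι)
        (EuclideanSpace.basisFun (Fin n) ℝ).toBasis (extChartAt (𝓡 n) p q) := by
  have hv : ∀ i, tcoord x₀ (ι q) (pushFrame ι p q i) = fderiv ℝ (chartMap n x₀ p ι)
      (extChartAt (𝓡 n) p q) ((EuclideanSpace.basisFun (Fin n) ℝ).toBasis i) := by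
    intro i
    rw [pushFrame, tcoord_pushforward hq hιq (hι.contMDiff q), tcoord_coordField hq,
      OrthonormalBasis.coe_toBasis]
  ext i l
  change _ = hermForm _ _ _ _
  rw [← hv, ← hv, chartMap_chart hq, hermForm, chartEnd_tcoord J hιq, chartMetric_tcoord hιq,
    chartMetric_tcoord hιq]
  rfl

theorem volDensity_mul_rho {p q : L} {x₀ : M}
    (hq : q ∈ (chartAt (EuclideanSpace ℝ (Fin n)) p).source)
    (hιq : ι q ∈ (chartAt (EuclideanSpace ℝ (Fin (2 * n))) x₀).source)
    (hι : IsTotallyRealImmersion J ι) :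
    volDensity (inducedMetric (n := n) ι) p q * rho (n := n) J ι q =
      Real.sqrt (chartHermGram (chartEnd J x₀) (chartMetric x₀) (chartMap n x₀ p ι)
        (EuclideanSpace.basisFun (Fin n) ℝ).toBasis (extChartAt (𝓡 n) p q)).det.re := by
  have : FiniteDimensional ℝ (TangentSpace (𝓡 (2 * n)) (ι q)) :=
    inferInstanceAs (FiniteDimensional ℝ (EuclideanSpace ℝ (Fin (2 * n))))
  rw [← hermGram_pushFrame hq hιq hι, mul_comm]
  exact rhoSubspace_mul_sqrt_gram (finrank_range_pushforward hι q)
    (v := pushFrame (n := n) ι p q) fun i => ⟨_, rfl⟩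

/-- Total reality is exactly the independence hypothesis of `posDef_hermGram`. As the determinant is
the square of `ρ_J √det g`, neither factor vanishes. -/
theorem chartHermGram_det_pos (hJ : IsAlmostHermitian (𝓡 (2 * n)) J)
    (hι : IsTotallyRealImmersion J ι) (q : L) :
    0 < (chartHermGram (chartEnd J (ι q)) (chartMetric (ι q)) (chartMap n (ι q) q ι)
        (EuclideanSpace.basisFun (Fin n) ℝ).toBasis (extChartAt (𝓡 n) q q)).det.re := by
  have : FiniteDimensional ℝ (TangentSpace (𝓡 (2 * n)) (ι q)) :=
    inferInstanceAs (FiniteDimensional ℝ (EuclideanSpace ℝ (Fin (2 * n))))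
  have hq := mem_chart_source (EuclideanSpace ℝ (Fin n)) q
  rw [← hermGram_pushFrame hq (mem_chart_source _ (ι q)) hι]
  have hcb : ∀ i, coordField (n := n) q i q = coordBasis q i := fun i => extend_self _
  have hb := hι.bijective_splitMap hJ.sq q
  have hpos := posDef_hermGram (J := (J (ι q)).toLinearMap) (v := pushFrame (n := n) ι q q)
    (hJ.sq (ι q)) (hJ.inner_map (ι q)) (fun a b hab => by
      have hs : ∀ a : Fin n → ℝ, ∑ i, a i • pushFrame (n := n) ι q q i =
          pushforward (n := n) ι q (∑ i, a i • coordBasis q i) := by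
        intro a
        rw [map_sum]
        refine Finset.sum_congr rfl fun i _ => ?_
        rw [map_smul, pushFrame, hcb]
      rw [hs, hs] at hab
      have h0 := hb.1 (a₁ := (∑ i, a i • coordBasis (n := n) q i, ∑ i, b i • coordBasis (n := n) q i)) (a₂ := 0)
        (hab.trans (map_zero _).symm)
      have hli := Fintype.linearIndependent_iff.1 (coordBasis (n := n) q).linearIndependent
      exact ⟨funext (hli a (congrArg Prod.fst h0)), funext (hli b (congrArg Prod.snd h0))⟩)
  open ComplexOrder in
  exact (Complex.pos_iff.1 hpos.det_pos).1

theorem chartMetric_chartEnd (hJ : IsAlmostHermitian (𝓡 (2 * n)) J) {x₀ x : M}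
    (hx : x ∈ (chartAt (EuclideanSpace ℝ (Fin (2 * n))) x₀).source)
    (a b : EuclideanSpace ℝ (Fin (2 * n))) :
    chartMetric x₀ (extChartAt (𝓡 (2 * n)) x₀ x) (chartEnd J x₀ (extChartAt (𝓡 (2 * n)) x₀ x) a)
      (chartEnd J x₀ (extChartAt (𝓡 (2 * n)) x₀ x) b) =
    chartMetric x₀ (extChartAt (𝓡 (2 * n)) x₀ x) a b := by
  obtain ⟨v, rfl⟩ := (tcoordEquiv hx).surjective a
  obtain ⟨w, rfl⟩ := (tcoordEquiv hx).surjective b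
  rw [tcoordEquiv_apply, tcoordEquiv_apply, chartEnd_tcoord J hx, chartEnd_tcoord J hx,
    chartMetric_tcoord hx, chartMetric_tcoord hx]
  exact hJ.inner_map _ _ _

theorem coordComp_smul {p q : L} (r : L → ℝ) (Y : Π q : L, TangentSpace (𝓡 n) q) (i : Fin n)
    (hq : q ∈ (chartAt (EuclideanSpace ℝ (Fin n)) p).source) :
    coordComp p i (fun q => r q • Y q) q =
      r q * (chartField p Y (extChartAt (𝓡 n) p q)) i := by
  rw [chartField_chart hq]
  have h : coordComp p i (fun q => r q • Y q) q = (tcoord p q (r q • Y q)) i := by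
    rw [tcoord_apply hq]
    rfl
  rw [h, map_smul]
  rfl

theorem sum_fderiv_mul {D : EuclideanSpace ℝ (Fin n) → ℝ}
    {y : EuclideanSpace ℝ (Fin n) → EuclideanSpace ℝ (Fin n)} {u : EuclideanSpace ℝ (Fin n)}
    (hD : DifferentiableAt ℝ D u) (hy : DifferentiableAt ℝ y u) :
    ∑ i, fderiv ℝ (fun u => D u * y u i) u (EuclideanSpace.basisFun (Fin n) ℝ i) =
      fderiv ℝ D u (y u) + D u * clmTrace _ (fderiv ℝ y u) := by
  have hyi : ∀ i, HasFDerivAt (fun u => y u i) ((EuclideanSpace.proj i : _ →L[ℝ] ℝ) ∘L fderiv ℝ y u) u :=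
    fun i => (EuclideanSpace.proj i : EuclideanSpace ℝ (Fin n) →L[ℝ] ℝ).hasFDerivAt.comp u hy.hasFDerivAt
  have h1 : ∀ i, fderiv ℝ (fun u => D u * y u i) u (EuclideanSpace.basisFun (Fin n) ℝ i) =
      y u i * fderiv ℝ D u (EuclideanSpace.basisFun (Fin n) ℝ i) +
      D u * (fderiv ℝ y u (EuclideanSpace.basisFun (Fin n) ℝ i)) i := by
    intro i
    have hm : HasFDerivAt (fun u => D u * y u i) _ u := hD.hasFDerivAt.mul (hyi i)
    rw [hm.fderiv, add_comm]
    rfl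
  rw [Finset.sum_congr rfl fun i _ => h1 i, Finset.sum_add_distrib, ← Finset.mul_sum]
  congr 1
  · conv_rhs => rw [← (EuclideanSpace.basisFun (Fin n) ℝ).sum_repr (y u), map_sum]
    refine Finset.sum_congr rfl fun i _ => ?_
    rw [map_smul]
    rfl
  · rw [clmTrace_apply, ← sum_repr_eq_trace (EuclideanSpace.basisFun (Fin n) ℝ).toBasis
      (LinearEquiv.refl ℝ _) _
      (fun i => fderiv ℝ y u (EuclideanSpace.basisFun (Fin n) ℝ i)) (fun i => by
        rw [OrthonormalBasis.coe_toBasis]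
        rfl)]
    rfl

/-- With `D = ρ_J √det g = √det h`, the left side is `D⁻¹ ∑ ∂ᵢ(D Yⁱ) = Y(log D) + tr Dy`, and `Y(log
D) = tr Re (∇_Y A)`. Exchanging `∇_Y A` for `∇_v Y` costs one torsion trace, and undoing the
subtraction in `tangentialDiv` costs another, hence the factor `2`. -/
theorem divergence_eq_tangentialDiv [T2Space M]
    [IsContMDiffRiemannianBundle (𝓡 (2 * n)) ∞ (EuclideanSpace ℝ (Fin (2 * n)))
      (fun x : M => TangentSpace (𝓡 (2 * n)) x)]
    (hJ : IsAlmostHermitian (𝓡 (2 * n)) J) (hcov : IsChernConnection (𝓡 (2 * n)) J cov)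
    (hι : IsTotallyRealImmersion J ι) {Y : Π q : L, TangentSpace (𝓡 n) q}
    (hY : ContMDiff (𝓡 n) ((𝓡 n).prod 𝓘(ℝ, EuclideanSpace ℝ (Fin n))) ∞
      (fun p => TotalSpace.mk' (EuclideanSpace ℝ (Fin n)) p (Y p))) (q : L) :
    divergence (inducedMetric (n := n) ι) (fun r => rho (n := n) J ι r • Y r) q /
        rho (n := n) J ι q =
      tangentialDiv J cov ι Y q + 2 * torsionTrace J cov ι q (Y q) := by
  have hq := mem_chart_source (EuclideanSpace ℝ (Fin n)) q
  have hιq := mem_chart_source (EuclideanSpace ℝ (Fin (2 * n))) (ι q)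
  have hi := isInvertible_realFrame hq hιq hι hJ.sq
  have hf := contDiffAt_chartMap hq hιq (hι.contMDiff q)
  have hfw : chartMap n (ι q) q ι (extChartAt (𝓡 n) q q) = extChartAt (𝓡 (2 * n)) (ι q) (ι q) :=
    chartMap_chart hq
  have ht := chart_mem_target hιq
  have hw := isParallelComplexAt_chart hJ.sq hJ.contMDiff hcov.smooth hcov.parallel (ι q)
  rw [← hfw] at hw ht
  have hGd : DifferentiableAt ℝ (chartMetric (M := M) (ι q))
      (chartMap n (ι q) q ι (extChartAt (𝓡 n) q q)) :=
    ((contDiffOn_chartMetric (M := M) (x₀ := ι q)).contDiffAt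
      ((isOpen_extChartAt_target (ι q)).mem_nhds ht)).differentiableAt (by simp)
  have hpos := chartHermGram_det_pos hJ hι q
  obtain ⟨hDd, hDf⟩ := fderiv_sqrt_det_chartHermGram hw hGd (hf.of_le ENat.LEInfty.out)
    (fun a b c => fderiv_chartMetric hcov.metric ht a b c)
    (by rw [hfw]; exact chartMetric_chartEnd hJ hιq) hi
    (EuclideanSpace.basisFun (Fin n) ℝ).toBasis hpos
  have hyd : DifferentiableAt ℝ (chartField q Y) (extChartAt (𝓡 n) q q) :=
    (contDiffAt_chartField hq (hY q)).differentiableAt (by simp)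
  have hD0 := volDensity_mul_rho hq hιq hι
  have hDpos := Real.sqrt_pos.2 hpos
  rw [tangentialDiv_eq_sliceDiv hq hιq hι hJ.sq (hY q), torsionTrace_eq_clmTrace hq hιq hι hJ.sq]
  have hev : ∀ i, (fun q' => volDensity (inducedMetric (n := n) ι) q q' *
      coordComp q i (fun r => rho (n := n) J ι r • Y r) q') =ᶠ[nhds q]
      fun q' => (fun u => Real.sqrt (chartHermGram (chartEnd J (ι q)) (chartMetric (ι q))
        (chartMap n (ι q) q ι) (EuclideanSpace.basisFun (Fin n) ℝ).toBasis u).det.re *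
        chartField q Y u i) (extChartAt (𝓡 n) q q') := by
    intro i
    filter_upwards [(chartAt (EuclideanSpace ℝ (Fin n)) q).open_source.mem_nhds hq,
      (hι.contMDiff q).continuousAt.preimage_mem_nhds
        ((chartAt (EuclideanSpace ℝ (Fin (2 * n))) (ι q)).open_source.mem_nhds hιq)] with q' h1 h2
    rw [coordComp_smul _ _ _ h1, ← mul_assoc, volDensity_mul_rho h1 h2 hι]
  set D : EuclideanSpace ℝ (Fin n) → ℝ := fun u => Real.sqrt (chartHermGram (chartEnd J (ι q))
    (chartMetric (ι q)) (chartMap n (ι q) q ι) (EuclideanSpace.basisFun (Fin n) ℝ).toBasis u).det.re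
    with hD
  have hyi : ∀ i, DifferentiableAt ℝ (fun u => D u * chartField q Y u i) (extChartAt (𝓡 n) q q) :=
    fun i => hDd.mul
      ((EuclideanSpace.proj i : EuclideanSpace ℝ (Fin n) →L[ℝ] ℝ).differentiableAt.comp _ hyd)
  have hsum : ∑ i, mvfderiv (𝓡 n) (fun q' => volDensity (inducedMetric (n := n) ι) q q' *
      coordComp q i (fun r => rho (n := n) J ι r • Y r) q') q (coordBasis q i) =
      fderiv ℝ D (extChartAt (𝓡 n) q q) (chartField q Y (extChartAt (𝓡 n) q q)) +
      D (extChartAt (𝓡 n) q q) * clmTrace _ (fderiv ℝ (chartField q Y) (extChartAt (𝓡 n) q q)) := by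
    rw [← sum_fderiv_mul hDd hyd]
    refine Finset.sum_congr rfl fun i _ => ?_
    rw [mvfderiv_congr_eventually (hev i), mvfderiv_comp_chart hq (hyi i),
      ← tcoord_coordField hq, coordField, extend_self]
  unfold divergence
  rw [hsum, hDf]
  unfold sliceDiv
  set f := chartMap n (ι q) q ι
  set u := extChartAt (𝓡 n) q q
  set A := fderiv ℝ f u
  set S := rePart (chartEnd J (ι q) (f u)) A
  set Γ := chartChristoffel cov (ι q) (f u)
  rw [← chartField_chart hq]
  set y := chartField q Y u
  have hv0 : volDensity (inducedMetric (n := n) ι) q q ≠ 0 := by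
    rintro h
    rw [h, zero_mul] at hD0
    exact hDpos.ne hD0
  have hr0 : rho (n := n) J ι q ≠ 0 := by
    rintro h
    rw [h, mul_zero] at hD0
    exact hDpos.ne hD0
  have hD1 : D u = volDensity (inducedMetric (n := n) ι) q q * rho (n := n) J ι q := hD0.symm
  change (_⁻¹ * (D u * _ + D u * _)) / _ = _
  rw [hD1]
  have hL : ∀ a b v r : ℝ, v ≠ 0 → r ≠ 0 → v⁻¹ * (v * r * a + v * r * b) / r = a + b := by
    intro a b v r hv hr
    field_simp
  have h2 : ∀ T : EuclideanSpace ℝ (Fin n) →L[ℝ] EuclideanSpace ℝ (Fin n),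
      2 * clmTrace _ T = clmTrace _ ((2 : ℝ) • T) := fun T => by rw [map_smul, smul_eq_mul]
  rw [hL _ _ _ _ hv0 hr0, h2, ← map_add, ← map_add, ← map_add]
  congr 1
  refine ContinuousLinearMap.ext fun c => ?_
  change S (fderiv ℝ (fderiv ℝ f) u y c + Γ (A y) (A c)) + fderiv ℝ (chartField q Y) u c =
    (S (fderiv ℝ (fderiv ℝ f) u y c + (2 : ℝ) • Γ (A c) (A y) - Γ (A y) (A c)) +
      fderiv ℝ (chartField q Y) u c) + (2 : ℝ) • S (Γ (A y) (A c) - Γ (A c) (A y))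
  simp only [map_add, map_sub, two_smul]
  abel

end Divergence

/-! ### Symmetries of the curvature of Christoffel symbols -/

section SymbolSymmetries

variable {E : Type*} [NormedAddCommGroup E] [NormedSpace ℝ E]
  {j : E → E →L[ℝ] E} {Γ : E → E →L[ℝ] E →L[ℝ] E} {w : E}

theorem fderiv_fderiv_apply_comm {V : Type*} [NormedAddCommGroup V] [NormedSpace ℝ V] {g : E → V}
    (hg : ContDiffAt ℝ 2 g w) (a b : E) :
    fderiv ℝ (fun u => fderiv ℝ g u a) w b = fderiv ℝ (fun u => fderiv ℝ g u b) w a := by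
  have h : DifferentiableAt ℝ (fderiv ℝ g) w :=
    (hg.fderiv_right (m := 1) (by norm_num)).differentiableAt (by simp)
  rw [fderiv_apply_const h, fderiv_apply_const h]
  exact (hg.isSymmSndFDerivAt (by simp)).eq b a

theorem symbolCurvature_apply (a b c : E) : symbolCurvature Γ w a b c =
    fderiv ℝ Γ w a b c - fderiv ℝ Γ w b a c + (Γ w a (Γ w b c) - Γ w b (Γ w a c)) := rfl

theorem symbolCurvature_skew (a b c : E) :
    symbolCurvature Γ w a b c = -symbolCurvature Γ w b a c := by
  rw [symbolCurvature_apply, symbolCurvature_apply]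
  abel

set_option synthInstance.maxHeartbeats 200000 in
theorem symbolCurvature_smul_left (r : ℝ) (a b : E) :
    symbolCurvature Γ w (r • a) b = r • symbolCurvature Γ w a b := by
  unfold symbolCurvature
  simp only [map_smul, smul_apply, smul_mul_assoc, mul_smul_comm, smul_add, smul_sub]

theorem fderiv_symbol_apply (hΓ : DifferentiableAt ℝ Γ w) (a b c : E) :
    fderiv ℝ (fun u => Γ u b c) w a = fderiv ℝ Γ w a b c := by
  rw [fderiv_apply_const (f := fun u => Γ u b) (hΓ.clm_apply (differentiableAt_const b)),
    fderiv_apply_const hΓ]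

/-- Symmetry of `Γ` near `w` passes to its derivative, and both kinds of terms then cancel in the
cyclic sum. -/
theorem symbolCurvature_bianchi (hΓ : DifferentiableAt ℝ Γ w)
    (hsymm : ∀ᶠ u in nhds w, ∀ a b, Γ u a b = Γ u b a) (a b c : E) :
    symbolCurvature Γ w a b c + symbolCurvature Γ w b c a + symbolCurvature Γ w c a b = 0 := by
  have h : ∀ a b c, fderiv ℝ Γ w a b c = fderiv ℝ Γ w a c b := by
    intro a b c
    rw [← fderiv_symbol_apply hΓ, ← fderiv_symbol_apply hΓ]
    have hev : (fun u => Γ u b c) =ᶠ[nhds w] fun u => Γ u c b := by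
      filter_upwards [hsymm] with u hu using hu b c
    rw [hev.fderiv_eq]
  have h0 := hsymm.self_of_nhds
  simp only [symbolCurvature_apply]
  rw [h a c b, h b a c, h c b a, h0 b c, h0 a c, h0 a b]
  abel

/-- The second derivatives of `j v` commute. Computed from `dj = [j, Γ]`, their difference is the
commutator of `j` with the curvature. -/
theorem symbolCurvature_comm_end (hw : IsParallelComplexAt j Γ w) (a b v : E) :
    symbolCurvature Γ w a b (j w v) = j w (symbolCurvature Γ w a b v) := by
  have hj : DifferentiableAt ℝ j w := hw.contDiffAt_end.differentiableAt (by simp)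
  have hΓ : DifferentiableAt ℝ Γ w := hw.contDiffAt_symbol.differentiableAt (by simp)
  have hΓa : ∀ a v, DifferentiableAt ℝ (fun u => Γ u a v) w := fun a v =>
    (hΓ.clm_apply (differentiableAt_const a)).clm_apply (differentiableAt_const v)
  have hjv : DifferentiableAt ℝ (fun u => j u v) w := hj.clm_apply (differentiableAt_const v)
  have hg : ContDiffAt ℝ 2 (fun u => j u v) w :=
    (hw.contDiffAt_end.of_le (by norm_num)).clm_apply contDiffAt_const
  have hd : ∀ a, (fun u => fderiv ℝ (fun u => j u v) u a) =ᶠ[nhds w]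
      fun u => j u (Γ u a v) - Γ u a (j u v) := by
    intro a
    filter_upwards [hw.eventually] with u hu
    rw [fderiv_apply_const (hu.contDiffAt_end.differentiableAt (by simp)),
      hu.fderiv_end.self_of_nhds]
    rfl
  have hd0 : ∀ a v, fderiv ℝ j w a v = j w (Γ w a v) - Γ w a (j w v) := fun a v => by
    rw [hw.fderiv_end.self_of_nhds]
    rfl
  have hd2 : ∀ a b, fderiv ℝ (fun u => fderiv ℝ (fun u => j u v) u a) w b =
      (j w (Γ w b (Γ w a v)) - Γ w b (j w (Γ w a v)) + j w (fderiv ℝ Γ w b a v)) -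
      (fderiv ℝ Γ w b a (j w v) + Γ w a (j w (Γ w b v) - Γ w b (j w v))) := by
    intro a b
    rw [(hd a).fderiv_eq, fderiv_fun_sub (hj.clm_apply (hΓa a v))
      ((hΓ.clm_apply (differentiableAt_const a)).clm_apply hjv), sub_apply,
      fderiv_clm_apply' hj (hΓa a v), fderiv_symbol_apply hΓ, hd0,
      fderiv_clm_apply' (f := fun u => Γ u a) (hΓ.clm_apply (differentiableAt_const a)) hjv,
      fderiv_apply_const hΓ, fderiv_apply_const hj, hd0]
    abel
  have h := fderiv_fderiv_apply_comm hg a b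
  rw [hd2, hd2] at h
  rw [← sub_eq_zero] at h ⊢
  rw [← h]
  simp only [symbolCurvature_apply, map_sub, map_add]
  abel

set_option synthInstance.maxHeartbeats 200000 in
-- The same argument for the metric: the second derivatives of `G c d`, computed from `∇G = 0`,
-- commute.
theorem symbolCurvature_metric {G : E → E →L[ℝ] E →L[ℝ] ℝ} (hΓ : DifferentiableAt ℝ Γ w)
    (hGd : ContDiffAt ℝ 2 G w) (hG : ∀ᶠ u in nhds w, ∀ a b c,
      fderiv ℝ G u a b c = G u (Γ u a b) c + G u b (Γ u a c)) (a b c d : E) :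
    G w (symbolCurvature Γ w a b c) d + G w c (symbolCurvature Γ w a b d) = 0 := by
  have hGw : DifferentiableAt ℝ G w := hGd.differentiableAt (by simp)
  have hΓa : ∀ a v, DifferentiableAt ℝ (fun u => Γ u a v) w := fun a v =>
    (hΓ.clm_apply (differentiableAt_const a)).clm_apply (differentiableAt_const v)
  have hg : ContDiffAt ℝ 2 (fun u => G u c d) w :=
    (hGd.clm_apply contDiffAt_const).clm_apply contDiffAt_const
  have hGev : ∀ᶠ u in nhds w, DifferentiableAt ℝ G u := by
    filter_upwards [hGd.eventually (by simp)] with u hu using hu.differentiableAt (by simp)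
  have hd : ∀ a, (fun u => fderiv ℝ (fun u => G u c d) u a) =ᶠ[nhds w]
      fun u => G u (Γ u a c) d + G u c (Γ u a d) := by
    intro a
    filter_upwards [hG, hGev] with u hu hGu
    rw [fderiv_apply_const (f := fun u => G u c) (hGu.clm_apply (differentiableAt_const c)),
      fderiv_apply_const hGu, hu]
  have hG' := hG.self_of_nhds
  have hI : ∀ p q : E → E, DifferentiableAt ℝ p w → DifferentiableAt ℝ q w → ∀ b,
      fderiv ℝ (fun u => G u (p u) (q u)) w b =
      G w (fderiv ℝ p w b + Γ w b (p w)) (q w) + G w (p w) (fderiv ℝ q w b + Γ w b (q w)) := by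
    intro p q hp hq b
    have := fderiv_metric_apply (Γ := Γ) (f := fun u : E => u) (u := w) hGw differentiableAt_fun_id
      hG' hp hq b
    rwa [fderiv_fun_id] at this
  have hm : ∀ p q : E → E, DifferentiableAt ℝ p w → DifferentiableAt ℝ q w →
      DifferentiableAt ℝ (fun u => G u (p u) (q u)) w := fun p q hp hq =>
    (hGw.clm_apply hp).clm_apply hq
  have hd2 : ∀ a b, fderiv ℝ (fun u => fderiv ℝ (fun u => G u c d) u a) w b =
      (G w (fderiv ℝ Γ w b a c + Γ w b (Γ w a c)) d + G w (Γ w a c) (0 + Γ w b d)) +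
      (G w (0 + Γ w b c) (Γ w a d) + G w c (fderiv ℝ Γ w b a d + Γ w b (Γ w a d))) := by
    intro a b
    rw [(hd a).fderiv_eq, fderiv_fun_add (hm _ (fun _ => d) (hΓa a c) (differentiableAt_const d))
      (hm (fun _ => c) _ (differentiableAt_const c) (hΓa a d)), add_apply,
      hI _ (fun _ => d) (hΓa a c) (differentiableAt_const d),
      hI (fun _ => c) _ (differentiableAt_const c) (hΓa a d), fderiv_symbol_apply hΓ,
      fderiv_symbol_apply hΓ, fderiv_fun_const, fderiv_fun_const]
    rfl
  have h := fderiv_fderiv_apply_comm hg b a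
  rw [hd2, hd2] at h
  simp only [symbolCurvature_apply, zero_add, map_add, map_sub, add_apply, sub_apply] at h ⊢
  linarith

end SymbolSymmetries

/-! ### Algebra of Kähler curvature tensors -/

section CurvatureAlgebra

/-- The symmetries of a Kähler curvature tensor. -/
structure IsKahlerCurvature {V : Type*} [NormedAddCommGroup V] [InnerProductSpace ℝ V]
    (J : V →ₗ[ℝ] V) (R : V → V → V → V) : Prop where
  sq : ∀ v, J (J v) = -v
  inner_map : ∀ u v, inner ℝ (J u) (J v) = (inner ℝ u v : ℝ)
  linear : ∀ u v, IsLinearMap ℝ fun e => R e u v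
  skew : ∀ u v w, R u v w = -R v u w
  bianchi : ∀ u v w, R u v w + R v w u + R w u v = 0
  metric : ∀ u v w z, (inner ℝ (R u v w) z : ℝ) = -inner ℝ w (R u v z)
  comm : ∀ u v w, R u v (J w) = J (R u v w)

namespace IsKahlerCurvature

variable {V : Type*} [NormedAddCommGroup V] [InnerProductSpace ℝ V]
  {J : V →ₗ[ℝ] V} {R : V → V → V → V} (h : IsKahlerCurvature J R)
include h

/-- The classical argument: four instances of the Bianchi identity combine with skewness in each
pair. -/
theorem inner_pair (a b c d : V) : (inner ℝ (R a b c) d : ℝ) = inner ℝ (R c d a) b := by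
  have e : ∀ a b c d, (inner ℝ (R a b c) d : ℝ) + inner ℝ (R b c a) d + inner ℝ (R c a b) d = 0 := by
    intro a b c d
    rw [← inner_add_left, ← inner_add_left, h.bianchi, inner_zero_left]
  have s : ∀ a b c d, (inner ℝ (R a b c) d : ℝ) = -inner ℝ (R b a c) d := by
    intro a b c d
    rw [h.skew, inner_neg_left]
  have m : ∀ a b c d, (inner ℝ (R a b c) d : ℝ) = -inner ℝ (R a b d) c := by
    intro a b c d
    rw [h.metric, real_inner_comm]
  have e1 := e a b c d
  have e2 := e b c d a
  have e3 := e c d a b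
  have e4 := e d a b c
  have := m b c a d
  have := m c a b d
  have := m c d b a
  have := m d b c a
  have := m d a c b
  have := m a c d b
  have := m a b d c
  have := m b d a c
  have := s c a b d
  have := s d b c a
  have := s a c d b
  have := s b d a c
  have := m c d a b
  have := m a c b d
  have := m b d c a
  linarith [m b c d a, m d a b c, s a c b d, s d b a c, s b d c a]

/-- Pair symmetry moves the two `J` to the other pair, where `R` commutes with `J` and `J` is an
isometry. -/
theorem map_map (a b c : V) : R (J a) (J b) c = R a b c := by
  refine ext_inner_right ℝ fun d => ?_
  rw [h.inner_pair, h.comm, h.inner_map, ← h.inner_pair]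

theorem ricci_symm {κ : Type*} [Fintype κ] (e : OrthonormalBasis κ ℝ V) (u v : V) :
    ∑ i, (inner ℝ (R (e i) u v) (e i) : ℝ) = ∑ i, inner ℝ (R (e i) v u) (e i) := by
  refine Finset.sum_congr rfl fun i _ => ?_
  rw [h.inner_pair, h.skew, inner_neg_left, h.metric, neg_neg, real_inner_comm]

/-- The trace of `J R(Ju, v)` in terms of the Ricci tensor. -/
theorem sum_inner_end {κ : Type*} [Fintype κ] (e : OrthonormalBasis κ ℝ V) (u v : V) :
    ∑ i, (inner ℝ (J (R (J u) v (e i))) (e i) : ℝ) = -2 * ∑ i, inner ℝ (R (e i) v u) (e i) := by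
  classical
  set T : V →ₗ[ℝ] V := (h.linear u v).mk' _ with hT
  -- `J`-invariance of the Ricci tensor: with `T e = R(e, u) v`, the map `e ↦ R(e, Ju) Jv` is `-J T
  -- J`, and `tr (J T J) = -tr T`.
  have htr : ∑ i, (inner ℝ (R (e i) (J u) (J v)) (e i) : ℝ) = ∑ i, inner ℝ (R (e i) u v) (e i) := by
    have h1 : ∀ i, R (e i) (J u) (J v) = -(J ∘ₗ T ∘ₗ J) (e i) := by
      intro i
      rw [h.comm, ← h.map_map (e i), h.sq, h.skew, ← neg_one_smul ℝ u, (h.linear _ _).map_smul,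
        h.skew u, neg_one_smul, neg_neg, map_neg]
      rfl
    have h2 : J ∘ₗ J = -LinearMap.id := LinearMap.ext h.sq
    have : Module.Finite ℝ V := Module.Finite.of_basis e.toBasis
    have h3 : LinearMap.trace ℝ V (J ∘ₗ T ∘ₗ J) = -LinearMap.trace ℝ V T := by
      rw [LinearMap.trace_comp_comm', LinearMap.comp_assoc, h2, LinearMap.comp_neg,
        LinearMap.comp_id, map_neg]
    have h4 := sum_inner_eq_trace e (LinearEquiv.refl ℝ V) (J ∘ₗ T ∘ₗ J) _ fun i => rfl
    have h5 := sum_inner_eq_trace e (LinearEquiv.refl ℝ V) T _ fun i => rfl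
    rw [h3, ← h5] at h4
    rw [Finset.sum_congr rfl fun i _ => by rw [h1 i, inner_neg_left], Finset.sum_neg_distrib]
    exact neg_eq_iff_eq_neg.2 h4
  -- The Bianchi identity splits `R(Ju, v) e` into two terms, each a Ricci integrand once `J` is
  -- moved through `R`.
  have hterm : ∀ i, (inner ℝ (J (R (J u) v (e i))) (e i) : ℝ) =
      -inner ℝ (R (e i) v u) (e i) - inner ℝ (R (e i) (J u) (J v)) (e i) := by
    intro i
    have hb : R (J u) v (e i) = -R v (e i) (J u) - R (e i) (J u) v := by
      have := h.bianchi (J u) v (e i)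
      rw [add_assoc] at this
      rw [eq_neg_of_add_eq_zero_left this]
      abel
    rw [hb, map_sub, map_neg, h.comm, h.sq, neg_neg, inner_sub_left, h.skew v, inner_neg_left, h.comm]
  rw [Finset.sum_congr rfl fun i _ => hterm i, Finset.sum_sub_distrib, htr,
    h.ricci_symm e u v, Finset.sum_neg_distrib]
  ring

end IsKahlerCurvature

end CurvatureAlgebra

/-! ### Integrability, torsion and Ricci curvature -/

section Kahler

variable {E : Type*} [NormedAddCommGroup E] [NormedSpace ℝ E] [FiniteDimensional ℝ E]
  {M : Type*} [TopologicalSpace M] [ChartedSpace E M] [IsManifold 𝓘(ℝ, E) ∞ M]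
  [RiemannianBundle (fun x : M => TangentSpace 𝓘(ℝ, E) x)]
  {J : Π x : M, TangentSpace 𝓘(ℝ, E) x →L[ℝ] TangentSpace 𝓘(ℝ, E) x}
  {cov lc : CovariantDerivative 𝓘(ℝ, E) E (TangentSpace 𝓘(ℝ, E) : M → Type _)}

/-- Each bracket is a difference of covariant derivatives minus a torsion term. The derivatives
cancel since `J` is parallel, and by antilinearity of `T` in both arguments each of the four torsion
terms equals `-T(u, v)`. -/
theorem nijenhuis_eq_torsion (hJ : IsAlmostKahler 𝓘(ℝ, E) J)
    (hcov : IsChernConnection 𝓘(ℝ, E) J cov) (x : M) (u v : TangentSpace 𝓘(ℝ, E) x) :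
    nijenhuis 𝓘(ℝ, E) J x u v = (-4 : ℝ) • cov.torsion x u v := by
  have hx := mem_chart_source E x
  have hd : ∀ v : TangentSpace 𝓘(ℝ, E) x, MDifferentiableAt 𝓘(ℝ, E) (𝓘(ℝ, E).prod 𝓘(ℝ, E))
      (fun y => TotalSpace.mk' E y (FiberBundle.extend E v y)) x := fun v =>
    (contMDiffAt_extend v).mdifferentiableAt (by simp)
  have hJd : ∀ v : TangentSpace 𝓘(ℝ, E) x, MDifferentiableAt 𝓘(ℝ, E) (𝓘(ℝ, E).prod 𝓘(ℝ, E))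
      (fun y => TotalSpace.mk' E y (J y (FiberBundle.extend E v y))) x := fun v => by
    rw [extend_eq_tfield]
    exact (contMDiffAt_end_tfield J hJ.contMDiff hx _).mdifferentiableAt (by simp)
  have hbr : ∀ {σ τ : Π y : M, TangentSpace 𝓘(ℝ, E) y},
      MDifferentiableAt 𝓘(ℝ, E) (𝓘(ℝ, E).prod 𝓘(ℝ, E)) (fun y => TotalSpace.mk' E y (σ y)) x →
      MDifferentiableAt 𝓘(ℝ, E) (𝓘(ℝ, E).prod 𝓘(ℝ, E)) (fun y => TotalSpace.mk' E y (τ y)) x →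
      VectorField.mlieBracket 𝓘(ℝ, E) σ τ x =
        cov τ x (σ x) - cov σ x (τ x) - cov.torsion x (σ x) (τ x) := by
    intro σ τ hσ hτ
    rw [cov.torsion_apply hσ hτ]
    abel
  have h1 : ∀ u v, cov.torsion x (J x u) v = -J x (cov.torsion x u v) := torsion_antilinear hJ hcov x
  have h2 : ∀ u v, cov.torsion x u (J x v) = -J x (cov.torsion x u v) := fun u v => by
    rw [torsion_skew, h1, torsion_skew x v u, map_neg, neg_neg]
  rw [nijenhuis, hbr (hd u) (hd v), hbr (hJd u) (hd v), hbr (hd u) (hJd v), hbr (hJd u) (hJd v)]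
  simp only [extend_self, hcov.parallel _ x (hd u), hcov.parallel _ x (hd v)]
  rw [hcov.torsion_type, h1, h2]
  simp only [map_sub, map_neg, hJ.sq]
  module

theorem torsion_eq_zero (hJ : IsKahler 𝓘(ℝ, E) J) (hcov : IsChernConnection 𝓘(ℝ, E) J cov) (x : M)
    (u v : TangentSpace 𝓘(ℝ, E) x) : cov.torsion x u v = 0 := by
  have h := nijenhuis_eq_torsion hJ.toIsAlmostKahler hcov x u v
  rw [hJ.integrable, eq_comm, smul_eq_zero] at h
  exact h.resolve_left (by norm_num)

variable {x₀ : M} {u : E}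

omit [RiemannianBundle (fun x : M => TangentSpace 𝓘(ℝ, E) x)] in
theorem chartChristoffel_symm (ht : ∀ x u v, cov.torsion x u v = 0)
    (hu : u ∈ (extChartAt 𝓘(ℝ, E) x₀).target) (a b : E) :
    chartChristoffel cov x₀ u a b = chartChristoffel cov x₀ u b a := by
  have hy := mem_source_of_mem_target hu
  have h := tcoord_torsion cov hy (tfield x₀ a _) (tfield x₀ b _)
  rw [ht, map_zero, tcoord_tfield hy, tcoord_tfield hy] at h
  exact (sub_eq_zero.1 h.symm)

theorem chartMetric_symm (hu : u ∈ (extChartAt 𝓘(ℝ, E) x₀).target) (a b : E) :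
    chartMetric (M := M) x₀ u a b = chartMetric (M := M) x₀ u b a := by
  rw [chartMetric_apply hu, chartMetric_apply hu]
  exact real_inner_comm _ _

theorem eq_zero_of_chartMetric (hu : u ∈ (extChartAt 𝓘(ℝ, E) x₀).target) {a : E}
    (h : chartMetric (M := M) x₀ u a a = 0) : a = 0 := by
  rw [chartMetric_apply hu] at h
  have h0 := inner_self_eq_zero.1 h
  rw [← tcoord_tfield (mem_source_of_mem_target hu) a, h0, map_zero]

/-- Uniqueness of the Levi-Civita connection: the difference of the symbols is symmetric in its two
arguments and skew with respect to the metric, hence zero. -/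
theorem chartChristoffel_unique
    [IsContMDiffRiemannianBundle 𝓘(ℝ, E) ∞ E (fun x : M => TangentSpace 𝓘(ℝ, E) x)]
    (hm : IsMetricConnection 𝓘(ℝ, E) cov) (ht : ∀ x u v, cov.torsion x u v = 0)
    (hm' : IsMetricConnection 𝓘(ℝ, E) lc) (ht' : ∀ x u v, lc.torsion x u v = 0)
    (hu : u ∈ (extChartAt 𝓘(ℝ, E) x₀).target) :
    chartChristoffel cov x₀ u = chartChristoffel lc x₀ u := by
  set G := chartMetric (M := M) x₀ u with hG
  set D : E → E → E := fun a b => chartChristoffel cov x₀ u a b - chartChristoffel lc x₀ u a b with hD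
  have hs : ∀ a b, D a b = D b a := fun a b => by
    simp only [hD]
    rw [chartChristoffel_symm ht hu, chartChristoffel_symm ht' hu]
  have hskew : ∀ a b c, G (D a b) c = -G (D a c) b := by
    intro a b c
    have h := (fderiv_chartMetric hm hu a b c).symm.trans (fderiv_chartMetric hm' hu a b c)
    rw [chartMetric_symm hu b, chartMetric_symm hu b] at h
    simp only [hD, map_sub, sub_apply]
    linarith
  have hz : ∀ a b, D a b = 0 := by
    intro a b
    refine eq_zero_of_chartMetric hu ?_
    change G (D a b) (D a b) = 0
    have h3 : ∀ c, G (D a b) c = -G (D a b) c := by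
      intro c
      -- Three skew exchanges alternating with three symmetric ones return to the same expression
      -- with the opposite sign.
      conv_lhs => rw [hskew, hs a c, hskew, hs c b, hskew, hs b a, neg_neg]
    linarith [h3 (D a b)]
  ext a b
  exact sub_eq_zero.1 (hz a b)

variable [T2Space M]
  [IsContMDiffRiemannianBundle 𝓘(ℝ, E) ∞ E (fun x : M => TangentSpace 𝓘(ℝ, E) x)]

theorem curvature_unique
    (hs : CovariantDerivative.ContMDiffCovariantDerivative cov ∞)
    (hm : IsMetricConnection 𝓘(ℝ, E) cov) (ht : ∀ x u v, cov.torsion x u v = 0)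
    (hs' : CovariantDerivative.ContMDiffCovariantDerivative lc ∞)
    (hm' : IsMetricConnection 𝓘(ℝ, E) lc) (ht' : ∀ x u v, lc.torsion x u v = 0) (x : M)
    (u v w : TangentSpace 𝓘(ℝ, E) x) :
    curvature 𝓘(ℝ, E) cov x u v w = curvature 𝓘(ℝ, E) lc x u v w := by
  have hx := mem_chart_source E x
  have hev : chartChristoffel cov x =ᶠ[nhds (extChartAt 𝓘(ℝ, E) x x)] chartChristoffel lc x := by
    filter_upwards [(isOpen_extChartAt_target x).mem_nhds (chart_mem_target hx)] with u hu
    exact chartChristoffel_unique hm ht hm' ht' hu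
  refine tcoord_injective hx ?_
  rw [curvature_eq cov hs, curvature_eq lc hs']
  dsimp only
  rw [hev.fderiv_eq, hev.self_of_nhds]

/-- Each symmetry is read off in the chart at `x`; integrability is needed only for the Bianchi
identity, through the vanishing of the torsion. -/
theorem isKahlerCurvature_curvature (hJ : IsKahler 𝓘(ℝ, E) J)
    (hcov : IsChernConnection 𝓘(ℝ, E) J cov) (x : M) :
    IsKahlerCurvature (V := TangentSpace 𝓘(ℝ, E) x) (J x).toLinearMap (curvature 𝓘(ℝ, E) cov x) := by
  have hx := mem_chart_source E x
  have hxt := chart_mem_target hx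
  have ht := (isOpen_extChartAt_target (I := 𝓘(ℝ, E)) x).mem_nhds hxt
  have hi := tcoord_injective (E := E) hx
  have hR : ∀ u v w : TangentSpace 𝓘(ℝ, E) x, tcoord x x (curvature 𝓘(ℝ, E) cov x u v w) =
      symbolCurvature (chartChristoffel cov x) (extChartAt 𝓘(ℝ, E) x x) (tcoord x x u)
        (tcoord x x v) (tcoord x x w) := fun u v w => curvature_eq cov hcov.smooth u v w
  have hw := isParallelComplexAt_chart hJ.sq hJ.contMDiff hcov.smooth hcov.parallel x
  have hΓ := hw.contDiffAt_symbol.differentiableAt (by simp)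
  have hG : ContDiffAt ℝ 2 (chartMetric (M := M) x) (extChartAt 𝓘(ℝ, E) x x) :=
    ((contDiffOn_chartMetric (M := M) (x₀ := x)).contDiffAt ht).of_le ENat.LEInfty.out
  refine ⟨hJ.sq x, hJ.inner_map x, fun u v => ⟨fun a b => hi ?_, fun r a => hi ?_⟩,
    fun u v w => hi ?_, fun u v w => hi ?_, fun u v w z => ?_, fun u v w => hi ?_⟩
  · rw [map_add, hR, hR, hR, map_add, symbolCurvature_add_left]
    rfl
  · rw [map_smul, hR, hR, map_smul, symbolCurvature_smul_left]
    rfl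
  · rw [map_neg, hR, hR]
    exact symbolCurvature_skew _ _ _
  · rw [map_add, map_add, hR, hR, hR, map_zero]
    refine symbolCurvature_bianchi hΓ ?_ _ _ _
    filter_upwards [ht] with u hu using chartChristoffel_symm (torsion_eq_zero hJ hcov) hu
  · rw [← chartMetric_tcoord hx, ← chartMetric_tcoord hx, hR, hR]
    refine eq_neg_of_add_eq_zero_left (symbolCurvature_metric hΓ hG ?_ _ _ _ _)
    filter_upwards [ht] with u hu using fderiv_chartMetric hcov.metric hu
  · change tcoord x x (curvature 𝓘(ℝ, E) cov x u v (J x w)) =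
      tcoord x x (J x (curvature 𝓘(ℝ, E) cov x u v w))
    rw [← chartEnd_tcoord J hx, hR, hR, ← chartEnd_tcoord J hx]
    exact symbolCurvature_comm_end hw _ _ _

theorem ricci_unique (hJ : IsKahler 𝓘(ℝ, E) J) (hcov : IsChernConnection 𝓘(ℝ, E) J cov)
    (hlc : IsLeviCivita 𝓘(ℝ, E) lc) (x : M) (u v : TangentSpace 𝓘(ℝ, E) x) :
    ricci 𝓘(ℝ, E) lc x u v = ricci 𝓘(ℝ, E) cov x u v :=
  Finset.sum_congr rfl fun i _ => by
    rw [curvature_unique hcov.smooth hcov.metric (torsion_eq_zero hJ hcov) hlc.smooth hlc.metric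
      hlc.torsion_free]

theorem ricci_symm (hJ : IsKahler 𝓘(ℝ, E) J) (hcov : IsChernConnection 𝓘(ℝ, E) J cov)
    (hlc : IsLeviCivita 𝓘(ℝ, E) lc) (x : M) (u v : TangentSpace 𝓘(ℝ, E) x) :
    ricci 𝓘(ℝ, E) lc x u v = ricci 𝓘(ℝ, E) lc x v u := by
  rw [ricci_unique hJ hcov hlc, ricci_unique hJ hcov hlc]
  exact (isKahlerCurvature_curvature hJ hcov x).ricci_symm _ u v

theorem chernRicciForm_eq_ricci (hJ : IsKahler 𝓘(ℝ, E) J) (hcov : IsChernConnection 𝓘(ℝ, E) J cov)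
    (hlc : IsLeviCivita 𝓘(ℝ, E) lc) (x : M) (u v : TangentSpace 𝓘(ℝ, E) x) :
    chernRicciForm 𝓘(ℝ, E) J cov x (J x u) v = -2 * ricci 𝓘(ℝ, E) lc x v u := by
  rw [ricci_unique hJ hcov hlc]
  exact (isKahlerCurvature_curvature hJ hcov x).sum_inner_end _ u v

end Kahler

/-! ### Codifferential and divergence of the induced metric -/

section Codifferential

variable {n : ℕ} {L : Type*} [TopologicalSpace L] [ChartedSpace (EuclideanSpace ℝ (Fin n)) L]
  [IsManifold (𝓡 n) ∞ L]
  {M : Type*} [TopologicalSpace M] [ChartedSpace (EuclideanSpace ℝ (Fin (2 * n))) M]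
  [IsManifold (𝓡 (2 * n)) ∞ M] [RiemannianBundle (fun x : M => TangentSpace (𝓡 (2 * n)) x)]
  {J : Π x : M, TangentSpace (𝓡 (2 * n)) x →L[ℝ] TangentSpace (𝓡 (2 * n)) x}
  {cov : CovariantDerivative (𝓡 (2 * n)) (EuclideanSpace ℝ (Fin (2 * n)))
      (TangentSpace (𝓡 (2 * n)) : M → Type _)} {ι : L → M}

theorem det_inducedMetric_ne_zero (hJ : IsAlmostHermitian (𝓡 (2 * n)) J)
    (hι : IsTotallyRealImmersion J ι) (q : L) :
    (Matrix.of fun i k => inducedMetric (n := n) ι q (coordBasis q i) (coordBasis q k)).det ≠ 0 := by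
  have h := volDensity_mul_rho (mem_chart_source (EuclideanSpace ℝ (Fin n)) q)
    (mem_chart_source (EuclideanSpace ℝ (Fin (2 * n))) (ι q)) hι
  have hpos := Real.sqrt_pos.2 (chartHermGram_det_pos hJ hι q)
  rw [← h] at hpos
  have hv := left_ne_zero_of_mul hpos.ne'
  have hcb : ∀ i, coordField (n := n) q i q = coordBasis q i := fun i => extend_self _
  unfold volDensity at hv
  simp only [hcb] at hv
  intro h0
  rw [h0, Real.sqrt_zero] at hv
  exact hv rfl

/-- The codifferential is defined through `sharp`, so this inversion is what yields `d*(Z♭) = -Div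
Z`. It rests on the Gram matrix being invertible. -/
theorem sharp_flat_inducedMetric (hJ : IsAlmostHermitian (𝓡 (2 * n)) J)
    (hι : IsTotallyRealImmersion J ι) (Z : Π q : L, TangentSpace (𝓡 n) q) :
    sharp (inducedMetric (n := n) ι) (flat (inducedMetric (n := n) ι) Z) = Z := by
  funext q
  have hdet := det_inducedMetric_ne_zero hJ hι q
  set G : Matrix (Fin n) (Fin n) ℝ :=
    Matrix.of fun i k => inducedMetric (n := n) ι q (coordBasis q i) (coordBasis q k) with hG
  have hinv : G⁻¹ * G = 1 := Matrix.nonsing_inv_mul G (isUnit_iff_ne_zero.2 hdet)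
  have hflat : ∀ k, flat (inducedMetric (n := n) ι) Z q (coordBasis q k) =
      ∑ l, G k l * (coordBasis q).repr (Z q) l := by
    intro k
    have hZ := (coordBasis (n := n) q).sum_repr (Z q)
    unfold flat inducedMetric
    conv_lhs => rw [← hZ, map_sum, sum_inner]
    refine Finset.sum_congr rfl fun l _ => ?_
    rw [map_smul, real_inner_smul_left, real_inner_comm, mul_comm]
    rfl
  unfold sharp
  conv_rhs => rw [← (coordBasis (n := n) q).sum_repr (Z q)]
  refine Finset.sum_congr rfl fun i _ => ?_
  rw [← Finset.sum_smul]
  congr 1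
  have h : (G⁻¹ * G).mulVec (fun l => (coordBasis (n := n) q).repr (Z q) l) i =
      (coordBasis (n := n) q).repr (Z q) i := by
    rw [hinv, Matrix.one_mulVec]
  rw [← h, ← Matrix.mulVec_mulVec]
  refine Finset.sum_congr rfl fun k _ => ?_
  rw [hflat]
  rfl

theorem codifferential_flat_inducedMetric (hJ : IsAlmostHermitian (𝓡 (2 * n)) J)
    (hι : IsTotallyRealImmersion J ι) (Z : Π q : L, TangentSpace (𝓡 n) q) (q : L) :
    codifferential (inducedMetric (n := n) ι) (flat (inducedMetric (n := n) ι) Z) q =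
      -divergence (inducedMetric (n := n) ι) Z q := by
  rw [codifferential, sharp_flat_inducedMetric hJ hι]

omit [RiemannianBundle (fun x : M => TangentSpace (𝓡 (2 * n)) x)] in
theorem contMDiff_zero_vectorField : ContMDiff (𝓡 n) ((𝓡 n).prod 𝓘(ℝ, EuclideanSpace ℝ (Fin n))) ∞
    (fun p : L => TotalSpace.mk' (EuclideanSpace ℝ (Fin n)) p (0 : TangentSpace (𝓡 n) p)) :=
  Bundle.contMDiff_zeroSection ℝ (TangentSpace (𝓡 n) : L → Type _)

omit [RiemannianBundle (fun x : M => TangentSpace (𝓡 (2 * n)) x)] in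
theorem tangentialDiv_zero (hι : IsTotallyRealImmersion J ι) (hJ : ∀ x v, J x (J x v) = -v) (q : L) :
    tangentialDiv J cov ι (fun _ => 0) q = 0 := by
  have h0 : chartField (M := L) q (fun q => (0 : TangentSpace (𝓡 n) q)) = fun _ => 0 :=
    funext fun u => map_zero _
  rw [tangentialDiv_eq_sliceDiv (mem_chart_source _ q) (mem_chart_source _ (ι q)) hι hJ
    (contMDiff_zero_vectorField q), h0]
  simp [sliceDiv]

theorem chernRicciForm_zero_left [T2Space M] (hcov : CovariantDerivative.ContMDiffCovariantDerivative cov ∞)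
    (x : M) (v : TangentSpace (𝓡 (2 * n)) x) : chernRicciForm (𝓡 (2 * n)) J cov x 0 v = 0 := by
  rw [chernRicciForm_eq_clmTrace hcov, map_zero, symbolCurvature_zero_left, mul_zero, map_zero]

end Codifferential

end

/-! ### The variation formulas for the Maslov form -/

theorem mainTheorem7 {n : ℕ}
    {L : Type*} [TopologicalSpace L] [T2Space L] [ChartedSpace (EuclideanSpace ℝ (Fin n)) L]
    [IsManifold (𝓡 n) ∞ L]
    {M : Type*} [TopologicalSpace M] [T2Space M] [ChartedSpace (EuclideanSpace ℝ (Fin (2 * n))) M]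
    [IsManifold (𝓡 (2 * n)) ∞ M] [RiemannianBundle (fun x : M => TangentSpace (𝓡 (2 * n)) x)]
    [IsContMDiffRiemannianBundle (𝓡 (2 * n)) ∞ (EuclideanSpace ℝ (Fin (2 * n)))
      (fun x : M => TangentSpace (𝓡 (2 * n)) x)]
    (J : Π x : M, TangentSpace (𝓡 (2 * n)) x →L[ℝ] TangentSpace (𝓡 (2 * n)) x)
    (chern : CovariantDerivative (𝓡 (2 * n)) (EuclideanSpace ℝ (Fin (2 * n)))
      (TangentSpace (𝓡 (2 * n)) : M → Type _))
    (hchern : IsChernConnection (𝓡 (2 * n)) J chern)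
    (ι : L → M) (hι : IsTotallyRealImmersion J ι)
    (Y : Π p : L, TangentSpace (𝓡 n) p)
    (hY : ContMDiff (𝓡 n) ((𝓡 n).prod 𝓘(ℝ, EuclideanSpace ℝ (Fin n))) ∞
      (fun p => TotalSpace.mk' (EuclideanSpace ℝ (Fin n)) p (Y p))) :
    -- the almost Kähler formula
    (IsAlmostKahler (𝓡 (2 * n)) J →
      MDifferentiable (𝓡 n) 𝓘(ℝ, ℝ) (fun q =>
        divergence (inducedMetric ι) (fun r => rho J ι r • Y r) q / rho J ι q
          - 2 * torsionTrace J chern ι q (Y q)) ∧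
      HasMaslovDifferential J chern ι (fun p => J (ι p) (pushforward ι p (Y p)))
        (fun p X =>
          -mvfderiv (𝓡 n) (fun q =>
            divergence (inducedMetric ι) (fun r => rho J ι r • Y r) q / rho J ι q
              - 2 * torsionTrace J chern ι q (Y q)) p X
          + 1 / 2 * chernRicciForm (𝓡 (2 * n)) J chern (ι p)
              (J (ι p) (pushforward ι p (Y p))) (pushforward ι p X))) ∧
    (∀ lc : CovariantDerivative (𝓡 (2 * n)) (EuclideanSpace ℝ (Fin (2 * n)))
        (TangentSpace (𝓡 (2 * n)) : M → Type _),
      IsLeviCivita (𝓡 (2 * n)) lc → IsKahler (𝓡 (2 * n)) J →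
      -- the Kähler formula
      (MDifferentiable (𝓡 n) 𝓘(ℝ, ℝ) (fun q =>
          divergence (inducedMetric ι) (fun r => rho J ι r • Y r) q / rho J ι q) ∧
        HasMaslovDifferential J chern ι (fun p => J (ι p) (pushforward ι p (Y p)))
          (fun p X =>
            -mvfderiv (𝓡 n) (fun q =>
              divergence (inducedMetric ι) (fun r => rho J ι r • Y r) q / rho J ι q) p X
            - ricci (𝓡 (2 * n)) lc (ι p) (pushforward ι p X) (pushforward ι p (Y p)))) ∧
      -- the linearisation at an immersion with vanishing Maslov form
      ((∀ (p : L) (V : TangentSpace (𝓡 n) p), maslovForm J chern ι p V = 0) →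
        ∀ X : Π p : L, TangentSpace (𝓡 n) p,
          ContMDiff (𝓡 n) ((𝓡 n).prod 𝓘(ℝ, EuclideanSpace ℝ (Fin n))) ∞
            (fun p => TotalSpace.mk' (EuclideanSpace ℝ (Fin n)) p (X p)) →
          MDifferentiable (𝓡 n) 𝓘(ℝ, ℝ) (fun q => (rho J ι q)⁻¹ *
            codifferential (inducedMetric ι)
              (flat (inducedMetric ι) (fun r => rho J ι r • Y r)) q) ∧
          HasMaslovDifferential J chern ι
            (fun p => pushforward ι p (X p) + J (ι p) (pushforward ι p (Y p)))
            (fun p V =>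
              mvfderiv (𝓡 n) (fun q => (rho J ι q)⁻¹ *
                codifferential (inducedMetric ι)
                  (flat (inducedMetric ι) (fun r => rho J ι r • Y r)) q) p V
              - ricci (𝓡 (2 * n)) lc (ι p) (pushforward ι p (Y p)) (pushforward ι p V)) ∧
          HasMaslovDifferential J chern ι (fun p => pushforward ι p (X p)) (fun _ _ => 0))) := by
  -- A variation in the direction `JZ` is the case `X = 0` of the general formula.
  have htt : ∀ Z : Π q : L, TangentSpace (𝓡 n) q, (fun p => J (ι p) (pushforward ι p (Z p))) =
      fun p => pushforward (n := n) ι p 0 + J (ι p) (pushforward ι p (Z p)) := fun Z =>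
    funext fun p => by rw [map_zero, zero_add]
  have hdiv : IsAlmostHermitian (𝓡 (2 * n)) J → ∀ q,
      divergence (inducedMetric ι) (fun r => rho J ι r • Y r) q / rho J ι q =
        tangentialDiv J chern ι Y q + 2 * torsionTrace J chern ι q (Y q) := fun hJ =>
    divergence_eq_tangentialDiv hJ hchern hι hY
  refine ⟨fun hJ => ?_, fun lc hlc hJ => ?_⟩
  · have hfun : (fun q => divergence (inducedMetric ι) (fun r => rho J ι r • Y r) q / rho J ι q
        - 2 * torsionTrace J chern ι q (Y q)) = tangentialDiv J chern ι Y := funext fun q => by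
      rw [hdiv hJ.toIsAlmostHermitian, add_sub_cancel_right]
    rw [hfun, htt]
    exact ⟨mdifferentiable_tangentialDiv hJ.toIsAlmostHermitian hchern hι hY,
      hasMaslovDifferential_tangentialDiv hJ.toIsAlmostHermitian hchern
        (torsion_antilinear hJ hchern) hι contMDiff_zero_vectorField hY (Or.inl fun _ => rfl)⟩
  · have hK := hJ.toIsAlmostKahler
    have hH := hK.toIsAlmostHermitian
    have htor : ∀ q, torsionTrace J chern ι q (Y q) = 0 := fun q => by
      have h0 : chern.torsion (ι q) (pushforward ι q (Y q)) = 0 :=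
        ContinuousLinearMap.ext fun v => torsion_eq_zero hJ hchern _ _ v
      rw [torsionTrace, h0, ContinuousLinearMap.toLinearMap_zero, LinearMap.zero_comp,
        LinearMap.comp_zero, map_zero]
    have hfun : (fun q => divergence (inducedMetric ι) (fun r => rho J ι r • Y r) q / rho J ι q) =
        tangentialDiv J chern ι Y := funext fun q => by
      rw [hdiv hH, htor, mul_zero, add_zero]
    have hric : ∀ p V, 1 / 2 * chernRicciForm (𝓡 (2 * n)) J chern (ι p)
        (J (ι p) (pushforward ι p (Y p))) V =
        -ricci (𝓡 (2 * n)) lc (ι p) V (pushforward ι p (Y p)) := fun p V => by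
      rw [chernRicciForm_eq_ricci hJ hchern hlc]
      ring
    have hmd := mdifferentiable_tangentialDiv hH hchern hι hY
    refine ⟨?_, fun hξ X hX => ?_⟩
    · rw [hfun, htt]
      refine ⟨hmd, ?_⟩
      have h := hasMaslovDifferential_tangentialDiv hH hchern (torsion_antilinear hK hchern) hι
        contMDiff_zero_vectorField hY (Or.inl fun _ => rfl)
      simp only [hric, ← sub_eq_add_neg] at h
      exact h
    · have hcod : (fun q => (rho J ι q)⁻¹ * codifferential (inducedMetric ι)
          (flat (inducedMetric ι) (fun r => rho J ι r • Y r)) q) =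
          -tangentialDiv J chern ι Y := funext fun q => by
        rw [codifferential_flat_inducedMetric hH hι, ← hfun, Pi.neg_apply, mul_neg, mul_comm,
          div_eq_mul_inv]
      rw [hcod]
      refine ⟨hmd.neg, ?_, ?_⟩
      · have h := hasMaslovDifferential_tangentialDiv hH hchern (torsion_antilinear hK hchern) hι
          hX hY (Or.inr hξ)
        refine (congrArg (HasMaslovDifferential J chern ι _) (funext fun p => funext fun V => ?_)).mp h
        -- The curvature identity produces `Ric(V, Y)`; symmetry of the Ricci tensor brings it to
        -- the order `Ric(Y, V)`.
        rw [hric, ricci_symm hJ hchern hlc, mvfderiv_neg, sub_eq_add_neg]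
        rfl
      -- The tangential case is the formula with `Y = 0`, where both the divergence and the
      -- curvature term vanish.
      · have h := hasMaslovDifferential_tangentialDiv hH hchern (torsion_antilinear hK hchern) hι
          hX contMDiff_zero_vectorField (Or.inr hξ)
        have hz : tangentialDiv J chern ι (fun _ => 0) = fun _ => 0 :=
          funext (tangentialDiv_zero hι hH.sq)
        simp only [map_zero, add_zero, hz, chernRicciForm_zero_left hchern.smooth, mul_zero,
          mvfderiv_const] at h
        simpa using h
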